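/- Let $b\ge 1$ be an integer and let $\alpha>3$ be a quadratic unit with negative conjugate, i.e. $\alpha$ and $\alpha_2=-1/\alpha<0$ are the roots of $x^2-bx-1$. For real $x$ let $\|x\|$ be the distance from $x$ to the nearest integer. Define integer sequences $(p_n)_{n\ge0}$, $(q_n)_{n\ge 0}$ by $$p_0=0,\quad p_2=b,\quad p_{2n+2}=(b^2+2)p_{2n}-p_{2n-2},\quad p_{2n-1}=p_{2n-2}+p_{2n},$$ $$q_0=1,\quad q_2=b^2+3,\quad q_{2n+2}=(b^2+2)q_{2n}-q_{2n-2},\quad q_{2n-1}=q_{2n-2}+q_{2n}\qquad(n\ge 1).$$ Notation. A finite word over $\{0,1\}$ is balanced if any two of its factors of equal length differ by at most $1$ in their number of letters $1$. A word $y=y_1y_2\cdots\in\{0,1\}^{\mathbb N}$ is eventually balanced if there are $m_0$ and $r:\mathbb N\to\mathbb N$ with $r(m)\to\infty$ such that the factor $y_{\max\{1,m-r(m)\}}\cdots y_{m+r(m)}$ is balanced for all $m\ge m_0$. For coprime integers $0\le p\le q$, the lower Christoffel word of slope $p/q$ is $\left(\lfloor p(i+1)/q\rfloor-\lfloor pi/q\rfloor\right)_{0\le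 i<q}$, and the upper one is obtained by replacing $\lfloor\cdot\rfloor$ by $\lceil\cdot\rceil$; a Christoffel word is a lower or an upper one. Let $\gamma$ be the substitution $0\mapsto 0\,0$, $1\mapsto 0\,1\,0\,\overline 1$ with $\overline 1=-1$, let $\sigma$ be the shift, and for an integer word $s=s_1s_2\cdots$ that is bounded put $$g(s)=\frac1{\alpha-\alpha_2}\sum_{j\ge 1}s_j\alpha^{-j},\qquad \Lambda=\frac{1}{\alpha-\alpha_2}\mathbb Z[\alpha].$$ Then: 1. $(p_n/q_n)_{n\ge 0}$ is strictly increasing and converges to $b/(1+\alpha^2)$. 2. $\displaystyle\Bigl\{\limsup_{n\to\infty}\|\xi\alpha^n\| : \xi\in\mathbb R\Bigr\}\cap\Bigl[0,\frac b{1+\alpha^2}\Bigr]=\Bigl\{\frac{p_n}{q_n}: n=0,1,2,\dots\Bigr\}\cup\Bigl\{\frac b{1+\alpha^2}\Bigr\}.$ 3. For every $n\ge 0$ the set $X_n=\{\xi\in\mathbb R:\limsup_{m\to\infty}\|\xi\alpha^m\|=p_n/q_n\}$ is contained in $\mathbb Q(\alpha)$, and $$X_n=\bigl\{\pm g\bigl(\sigma^k(\gamma(\nu)^\infty)\bigr)+x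 : \nu\text{ a Christoffel word},\ |\gamma(\nu)|=2(n+1),\ 0\le k<2(n+1),\ x\in\Lambda\bigr\}.$$ 4. The set $X_\infty=\{\xi\in\mathbb R:\limsup_{m\to\infty}\|\xi\alpha^m\|=b/(1+\alpha^2)\}$ is uncountable. It consists exactly of the numbers $g(s)+x$ where $x\in\Lambda$ and $s=s_1s_2\cdots$ is an integer word that is not eventually periodic and for which there are $m_0$ and $r:\mathbb N\to\mathbb N$ with $r(m)\to\infty$ such that, for all $m\ge m_0$, the factor $s_{\max\{1,m-r(m)\}}\cdots s_{m+r(m)}$ or its negative is a factor of $\gamma(u)$ for some balanced finite word $u$ over $\{0,1\}$. In particular $X_\infty$ contains all numbers $\pm g(\sigma^k(\gamma(y)))+x$ with $k\ge0$, $x\in\Lambda$ and $y\in\{0,1\}^{\mathbb N}$ eventually balanced and not eventually periodic. -/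

import Mathlib

namespace MarkoffPisot

noncomputable section

/-! ### The spectrum -/

/-- Distance from a real number to the nearest integer. -/
def distInt (x : ℝ) : ℝ := |x - round x|

/-- `limsup ‖ξ αⁿ‖` as `n → ∞`; the sequence takes values in `[0, 1/2]`. -/
def limsupDist (α ξ : ℝ) : ℝ :=
  Filter.limsup (fun n : ℕ => distInt (ξ * α ^ n)) Filter.atTop

/-- The multiplicative Markoff-Lagrange spectrum of `α`. -/
def spectrumL (α : ℝ) : Set ℝ := Set.range (limsupDist α)

/-- The set of `ξ` whose `limsup` equals `η`. -/
def levelSet (α η : ℝ) : Set ℝ := {ξ : ℝ | limsupDist α ξ = η}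

/-! ### The sequences of numerators and denominators -/

/-- The sequence `x₀, x₁, …` with `xₙ₊₂ = (b² + 2) xₙ₊₁ - xₙ`. -/
def recSeq (b : ℕ) (x₀ x₁ : ℤ) : ℕ → ℤ
  | 0 => x₀
  | 1 => x₁
  | n + 2 => ((b : ℤ) ^ 2 + 2) * recSeq b x₀ x₁ (n + 1) - recSeq b x₀ x₁ n

/-- Put `x n` at the index `2 n` and `x n + x (n + 1)` at the index `2 n + 1`. -/
def interleave (x : ℕ → ℤ) (m : ℕ) : ℤ :=
  if Even m then x (m / 2) else x (m / 2) + x (m / 2 + 1)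

def pSeq (b : ℕ) : ℕ → ℤ := interleave (recSeq b 0 b)

def qSeq (b : ℕ) : ℕ → ℤ := interleave (recSeq b 1 ((b : ℤ) ^ 2 + 3))

/-! ### Words over `{0, 1}` -/

/-- The factor of an infinite word (indexed from `0`) at the positions `i, …, j`. -/
def window {A : Type*} (y : ℕ → A) (i j : ℕ) : List A :=
  (List.range (j + 1 - i)).map fun l => y (i + l)

/-- A finite word is balanced if two factors of equal length differ by at most one in their
number of letters `1`. -/
def IsBalanced (u : List (Fin 2)) : Prop :=
  ∀ v w : List (Fin 2), v <:+: u → w <:+: u → v.length = w.length →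
    |((v.count 1 : ℕ) : ℤ) - ((w.count 1 : ℕ) : ℤ)| ≤ 1

/-- An infinite word is eventually balanced if its windows around `m`, of a radius that tends to
infinity with `m`, are balanced (a window is cut off at the first letter of the word). -/
def IsEventuallyBalanced (y : ℕ → Fin 2) : Prop :=
  ∃ (m₀ : ℕ) (r : ℕ → ℕ), Filter.Tendsto r Filter.atTop Filter.atTop ∧
    ∀ m ≥ m₀, IsBalanced (window y (m - r m) (m + r m))

def IsEventuallyPeriodic {A : Type*} (y : ℕ → A) : Prop :=
  ∃ (N t : ℕ), 0 < t ∧ ∀ n ≥ N, y (n + t) = y n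

/-- The lower Christoffel word of slope `p / q`. -/
def IsLowerChristoffel (p q : ℕ) (ν : List (Fin 2)) : Prop :=
  ν.length = q ∧ ∀ (i : ℕ) (h : i < ν.length),
    (((ν[i] : Fin 2) : ℕ) : ℤ) = ⌊((p : ℚ) * (i + 1)) / q⌋ - ⌊((p : ℚ) * i) / q⌋

/-- The upper Christoffel word of slope `p / q`. -/
def IsUpperChristoffel (p q : ℕ) (ν : List (Fin 2)) : Prop :=
  ν.length = q ∧ ∀ (i : ℕ) (h : i < ν.length),
    (((ν[i] : Fin 2) : ℕ) : ℤ) = ⌈((p : ℚ) * (i + 1)) / q⌉ - ⌈((p : ℚ) * i) / q⌉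

def IsChristoffel (ν : List (Fin 2)) : Prop :=
  ∃ p q : ℕ, p.Coprime q ∧ p ≤ q ∧ (IsLowerChristoffel p q ν ∨ IsUpperChristoffel p q ν)

/-! ### Coding by words over `{-1, 0, 1}` -/

/-- The substitution `0 ↦ 0 0`, `1 ↦ 0 1 0 (-1)` on letters. -/
def codeLetter (a : Fin 2) : List ℤ := if a = 0 then [0, 0] else [0, 1, 0, -1]

/-- The substitution on finite words. -/
def code (u : List (Fin 2)) : List ℤ := u.flatMap codeLetter

/-- The substitution on infinite words. The image of the prefix of length `n + 1` has length at
least `2 (n + 1)`, so it contains the letter at the index `n` of the image. -/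
def codeInf (y : ℕ → Fin 2) (n : ℕ) : ℤ := (code ((List.range (n + 1)).map y)).getD n 0

/-- The infinite word `u u u …`. -/
def periodicWord (u : List ℤ) (n : ℕ) : ℤ := u.getD (n % u.length) 0

/-- The bi-infinite word which is `0` at all indices `≤ 0` and is `s` from the index `1` on. -/
def rightWord (s : ℕ → ℤ) (j : ℤ) : ℤ := if 1 ≤ j then s (j - 1).toNat else 0

/-- The realization map
`(… + s₋₂ α₂² + s₋₁ α₂ + s₀ + s₁ α⁻¹ + s₂ α⁻² + …) / (α - α₂)` on bounded words. -/
def realize (α α₂ : ℝ) (s : ℤ → ℤ) : ℝ :=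
  ((∑' k : ℕ, (s (-(k : ℤ)) : ℝ) * α₂ ^ k) +
    ∑' k : ℕ, (s ((k : ℤ) + 1) : ℝ) / α ^ (k + 1)) / (α - α₂)

/-- The module `ℤ[α] / (α - α₂)`. -/
def lattice (α α₂ : ℝ) : Set ℝ :=
  {x : ℝ | ∃ z ∈ Algebra.adjoin ℤ ({α} : Set ℝ), x = z / (α - α₂)}

/-- The numbers `± g(0^∞ . σᵏ(code(ν)^∞)) + x` with a Christoffel word `ν` whose code has length
`2 (n + 1)`, with `k` running through a period, and `x ∈ ℤ[α] / (α - α₂)`. -/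
def christoffelSet (α α₂ : ℝ) (n : ℕ) : Set ℝ :=
  {ξ : ℝ | ∃ ν : List (Fin 2), IsChristoffel ν ∧ (code ν).length = 2 * (n + 1) ∧
    ∃ k < 2 * (n + 1), ∃ x ∈ lattice α α₂,
      ξ = realize α α₂ (rightWord fun j => periodicWord (code ν) (j + k)) + x ∨
      ξ = -realize α α₂ (rightWord fun j => periodicWord (code ν) (j + k)) + x}

/-- The numbers `± g(0^∞ . σᵏ(code(y))) + x` with an eventually balanced word `y` that is not
eventually periodic, and `x ∈ ℤ[α] / (α - α₂)`. -/
def eventuallyBalancedSet (α α₂ : ℝ) : Set ℝ :=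
  {ξ : ℝ | ∃ y : ℕ → Fin 2, IsEventuallyBalanced y ∧ ¬ IsEventuallyPeriodic y ∧
    ∃ k : ℕ, ∃ x ∈ lattice α α₂,
      ξ = realize α α₂ (rightWord fun j => codeInf y (j + k)) + x ∨
      ξ = -realize α α₂ (rightWord fun j => codeInf y (j + k)) + x}

/-- A word of integers is eventually balanced in code if its windows around `m`, of a radius that
tends to infinity with `m`, are up to sign factors of codes of balanced words. -/
def IsEventuallyBalancedCode (s : ℕ → ℤ) : Prop :=
  ∃ (m₀ : ℕ) (r : ℕ → ℕ), Filter.Tendsto r Filter.atTop Filter.atTop ∧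
    ∀ m ≥ m₀, ∃ u : List (Fin 2), IsBalanced u ∧
      (window s (m - r m) (m + r m) <:+: code u ∨
        (window s (m - r m) (m + r m)).map (fun a => -a) <:+: code u)

/-- The numbers `g(0^∞ . s) + x` with a word `s` that is eventually balanced in code and not
eventually periodic, and `x ∈ ℤ[α] / (α - α₂)`. -/
def eventuallyBalancedCodeSet (α α₂ : ℝ) : Set ℝ :=
  {ξ : ℝ | ∃ s : ℕ → ℤ, IsEventuallyBalancedCode s ∧ ¬ IsEventuallyPeriodic s ∧
    ∃ x ∈ lattice α α₂, ξ = realize α α₂ (rightWord s) + x}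

end

end MarkoffPisot

namespace MarkoffPisot

/-! ### Bi-infinite binary words: Markoff property and balance -/

/-! Write ρ = α⁻¹ and θ = ρ². Rounding ξαⁿ to integers uₙ gives the bounded integer word sₙ = uₙ₊₂ -
b uₙ₊₁ - uₙ, which determines ξ modulo the lattice (`exists_coding`). Conversely, for a coded
number, ξαⁿ is an integer plus the two-sided value of the shifted word divided by α + α⁻¹, up to an
error tending to 0 (`realize_mul_pow`, `lattice_mul_pow`). The limsup is therefore governed by the
values `evalWord` of the bi-infinite limits of shifts of s. These are taken along ultrafilters, and
the family of limits is closed under shifts.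

If the limsup is at most b/(1+α²), every limit word is ternary and all its shifts have value at most
1 - ρ². Folding the two halves at a position gives a power series in ρ with digits of size at most
2. Since ρ < 1/3, comparing it with 1 - ρ² is a lexicographic comparison, and this yields
`TernaryMarkoff`. That condition forces nonzero letters to alternate in sign and to lie on one
parity class, so the word is the interlaced difference word of a binary word y, and the condition
becomes the Markoff property of y. The Markoff property is equivalent to balance
(`MarkoffProp.balancedSum`, `BalancedSum.markoffProp`).

At a change of letters of a balanced y, the value is 1 - θ times the sum of (y(j+1+i) - y(j-i)) θⁱ,
so it is large exactly when y is symmetric around the change for a long stretch. A mechanical word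
of slope p/N in lowest terms with 0 < p < N is symmetric up to distance N - 2, which gives the
maximum `maxValue α N`; slope 0 is the zero word, of value 0 = `maxValue α 1`. These values give
pₙ/qₙ with N = n + 1. If the period 2(2ⁿ)! fails, a right special factor of length n exists and
produces a centre of symmetry of radius about n (`BalancedSum.exists_center`). Hence a coding word
that is not eventually periodic has limsup exactly b/(1+α²) (`limsupDist_eq_top`).

Cutting y into blocks 0 and 01 turns difference words into codes of balanced words, and into codes
of Christoffel words in the periodic case. This describes the level sets. A family of sparse words
makes the top one uncountable. -/

/-- `S` is a summatory function of the binary word `y`. -/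
structure IsBinarySum (S y : ℤ → ℤ) : Prop where
  step : ∀ i, S (i + 1) = S i + y i
  bin : ∀ i, y i = 0 ∨ y i = 1

/-- The Markoff property of a bi-infinite binary word: reading away from a change of letters in
both directions, the first disagreement is opposite to the change. -/
def MarkoffProp (y : ℤ → ℤ) : Prop :=
  ∀ j K : ℤ, 1 ≤ K → (∀ k, 1 ≤ k → k < K → y (j + 1 + k) = y (j - k)) →
    (y (j + 1) - y j) * (y (j + 1 + K) - y (j - K)) ≤ 0

/-- Two windows of equal length of the underlying word differ by at most one in their sum. -/
def BalancedSum (S : ℤ → ℤ) : Prop :=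
  ∀ i j n : ℤ, 0 ≤ n → S (j + n) - S j ≤ S (i + n) - S i + 1

theorem IsBinarySum.compl {S y : ℤ → ℤ} (h : IsBinarySum S y) :
    IsBinarySum (fun i => i - S i) (fun i => 1 - y i) where
  step i := by have := h.step i; omega
  bin i := by have := h.bin i; omega

theorem MarkoffProp.compl {y : ℤ → ℤ} (h : MarkoffProp y) : MarkoffProp (fun i => 1 - y i) := by
  intro j K hK hk
  have := h j K hK (fun k h1 h2 => by have := hk k h1 h2; simp only at this; omega)
  simp only
  linarith

theorem BalancedSum.compl {S : ℤ → ℤ} (h : BalancedSum S) : BalancedSum (fun i => i - S i) := by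
  intro i j n hn
  have := h j i n hn
  simp only
  omega

/-- Minimal counterexample for Markoff implies balanced: the length n is the least for which an
unbalanced pair exists, and the starting points i < j are as close as possible. Minimality makes the
lighter window a palindrome and makes the word n-periodic between the two starts. Reading outwards
from the change at the right end of the lighter window then contradicts the Markoff property. -/
theorem no_closest_unbalanced_pair {S y : ℤ → ℤ} (hS : IsBinarySum S y) (hM : MarkoffProp y)
    {n : ℤ} (hlt : ∀ m, 0 ≤ m → m < n → ∀ i j, S (j + m) - S j ≤ S (i + m) - S i + 1)
    {i j : ℤ} (hij : i < j) (hC : S (i + n) - S i + 2 ≤ S (j + n) - S j) (hn0 : 0 ≤ n)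
    (hmin : ∀ i' j' : ℤ, |i' - j'| < j - i → S (j' + n) - S j' ≤ S (i' + n) - S i' + 1) :
    False := by
  have hstep : ∀ a b, b = a + 1 → S b = S a + y a := by rintro a b rfl; exact hS.step a
  have hn2 : 2 ≤ n := by
    by_contra hlt2
    have : n = 0 ∨ n = 1 := by omega
    rcases this with rfl | rfl
    · simp at hC
    · have h1 := hstep i (i + 1) rfl
      have h2 := hstep j (j + 1) rfl
      have := hS.bin i
      have := hS.bin j
      omega
  -- At each cut the defect 2 splits as 1 + 1, because shorter windows are balanced. Comparing
  -- prefixes of one window with suffixes of the other then equates the prefix and suffix sums of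
  -- the window at i.
  have pal : ∀ k, 0 ≤ k → k ≤ n → S (i + k) - S i = S (i + n) - S (i + n - k) := by
    intro k hk0 hkn
    rcases eq_or_lt_of_le hk0 with rfl | hk0'
    · simp
    rcases eq_or_lt_of_le hkn with rfl | hkn'
    · simp
    have a1 := hlt k hk0 hkn' i j
    have a2 := hlt (n - k) (by omega) (by omega) (i + k) (j + k)
    have a3 := hlt (n - k) (by omega) (by omega) i j
    have a4 := hlt k hk0 hkn' (i + n - k) (j + n - k)
    have a5 := hlt k hk0 hkn' i (j + n - k)
    have a6 := hlt k hk0 hkn' (i + n - k) j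
    rw [show j + k + (n - k) = j + n by ring, show i + k + (n - k) = i + n by ring] at a2
    rw [show j + (n - k) = j + n - k by ring, show i + (n - k) = i + n - k by ring] at a3
    rw [show j + n - k + k = j + n by ring, show i + n - k + k = i + n by ring] at a4
    rw [show j + n - k + k = j + n by ring] at a5
    rw [show i + n - k + k = i + n by ring] at a6
    omega
  have paly : ∀ k, 0 ≤ k → k < n → y (i + n - 1 - k) = y (i + k) := by
    intro k hk0 hkn
    have a1 := pal k hk0 hkn.le
    have a2 := pal (k + 1) (by omega) (by omega)
    have a3 := hstep (i + k) (i + (k + 1)) (by ring)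
    have a4 := hstep (i + n - 1 - k) (i + n - k) (by ring)
    rw [show i + n - (k + 1) = i + n - 1 - k by ring] at a2
    omega
  -- A window starting strictly between i and j is closer to both, so its sum is exactly the
  -- intermediate value.
  have mid : ∀ l, i < l → l < j → S (l + n) - S l = S (i + n) - S i + 1 := by
    intro l h1 h2
    have b1 := hmin l j (by rw [abs_lt]; omega)
    have b2 := hmin i l (by rw [abs_lt]; omega)
    omega
  have cstep : ∀ a c, c = a + 1 → S (c + n) - S c = S (a + n) - S a + y (a + n) - y a := by
    rintro a c rfl
    have := hstep a (a + 1) rfl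
    have := hstep (a + n) (a + 1 + n) (by ring)
    omega
  have hij2 : i + 2 ≤ j := by
    by_contra hlt2
    obtain rfl : j = i + 1 := by omega
    have := cstep i (i + 1) rfl
    have := hS.bin i
    have := hS.bin (i + n)
    omega
  have yi : y i = 0 ∧ y (i + n) = 1 := by
    have := cstep i (i + 1) rfl
    have := mid (i + 1) (by omega) (by omega)
    have := hS.bin i
    have := hS.bin (i + n)
    omega
  have yj : y (j - 1) = 0 ∧ y (j - 1 + n) = 1 := by
    have := cstep (j - 1) j (by ring)
    have := mid (j - 1) (by omega) (by omega)
    have := hS.bin (j - 1)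
    have := hS.bin (j - 1 + n)
    omega
  have per : ∀ l, i < l → l < j - 1 → y (l + n) = y l := by
    intro l h1 h2
    have := cstep l (l + 1) rfl
    have := mid l (by omega) (by omega)
    have := mid (l + 1) (by omega) (by omega)
    omega
  obtain ⟨e, rfl⟩ : ∃ e, j = i + 1 + e := ⟨j - 1 - i, by ring⟩
  rw [show i + 1 + e - 1 = i + e by ring] at yj
  have y0 : y (i + n - 1) = 0 := by
    have := paly 0 le_rfl (by omega)
    simpa [yi.1] using this
  -- The Markoff property is used only at the change 0, 1 between the positions i + n - 1 and i + n.
  have hMar : ∀ K, 1 ≤ K → (∀ k, 1 ≤ k → k < K → y (i + n + k) = y (i + n - 1 - k)) →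
      y (i + n + K) ≤ y (i + n - 1 - K) := by
    intro K hK h
    have := hM (i + n - 1) K hK (fun k h1 h2 => by
      rw [show i + n - 1 + 1 + k = i + n + k by ring]; exact h k h1 h2)
    rw [show i + n - 1 + 1 = i + n by ring, yi.2, y0] at this
    linarith
  have small : ∀ k, 1 ≤ k → k < n → k < e → y (i + n + k) = y (i + n - 1 - k) := by
    intro k h1 h2 h3
    rw [paly k (by omega) h2, ← per (i + k) (by omega) (by omega)]
    congr 1; ring
  rcases lt_trichotomy e n with hen | rfl | hen
  · have := hMar e (by omega) (fun k h1 h2 => small k h1 (by omega) h2)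
    rw [paly e (by omega) hen, yj.1, show i + n + e = i + e + n by ring, yj.2] at this
    omega
  · omega
  -- The symmetry must be continued to the left of the window at i. Windows starting there are
  -- closer to i than j is, so minimality bounds their sums from above, while the Markoff inequality
  -- pushes the letters the other way.
  · have Q : ∀ l : ℕ, (l : ℤ) < e - n → y (i + n + (n + l)) = y (i + n - 1 - (n + l)) ∧
        S (i - 1 - l + n) - S (i - 1 - l) = S (i + n) - S i + 1 := by
      intro l
      induction l using Nat.strong_induction_on with
      | _ l ih =>
        intro hl
        have eqs : ∀ k, 1 ≤ k → k < n + l → y (i + n + k) = y (i + n - 1 - k) := by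
          intro k h1 h2
          rcases lt_or_ge k n with h3 | h3
          · exact small k h1 h3 (by omega)
          · have := (ih (k - n).toNat (by omega) (by omega)).1
            rw [show ((k - n).toNat : ℤ) = k - n by omega] at this
            simpa using this
        have hle := hMar (n + l) (by omega) eqs
        have hR : y (i + n + (n + l)) = y (i + n + l) := by
          rw [← per (i + n + l) (by omega) (by omega)]; congr 1; ring
        have hcs := cstep (i - 1 - l) (i - l) (by ring)
        have e1 : y (i + n - 1 - (n + l)) = y (i - 1 - l) := by congr 1; ring
        have e2 : y (i - 1 - l + n) = y (i + n - 1 - l) := by congr 1; ring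
        have b1 := hS.bin (i - 1 - l)
        rcases Nat.eq_zero_or_pos l with rfl | hlpos
        · simp only [Nat.cast_zero, add_zero, sub_zero] at *
          rw [yi.2] at hR
          rw [e2, y0] at hcs
          omega
        · have := (ih (l - 1) (by omega) (by omega)).2
          rw [show ((l - 1 : ℕ) : ℤ) = l - 1 by omega, show i - 1 - ((l : ℤ) - 1) = i - l by ring]
            at this
          have e3 := eqs l (by omega) (by omega)
          have hm := hmin i (i - 1 - l) (by rw [abs_lt]; omega)
          omega
    have eqs : ∀ k, 1 ≤ k → k < e → y (i + n + k) = y (i + n - 1 - k) := by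
      intro k h1 h2
      rcases lt_or_ge k n with h3 | h3
      · exact small k h1 h3 h2
      · have := (Q (k - n).toNat (by omega)).1
        rw [show ((k - n).toNat : ℤ) = k - n by omega] at this
        simpa using this
    have hle := hMar e (by omega) eqs
    have hprev := (Q (e - n - 1).toNat (by omega)).2
    rw [show ((e - n - 1).toNat : ℤ) = e - n - 1 by omega,
      show i - 1 - (e - n - 1) = i - (e - n) by ring] at hprev
    have hcs := cstep (i - 1 - (e - n)) (i - (e - n)) (by ring)
    have e1 : y (i + n - 1 - e) = y (i - 1 - (e - n)) := by congr 1; ring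
    have e2 : y (i - 1 - (e - n) + n) = y (i + n - 1 - (e - n)) := by congr 1; ring
    have e3 := eqs (e - n) (by omega) (by omega)
    rw [show i + n + (e - n) = i + e by ring, yj.1] at e3
    rw [show i + n + e = i + e + n by ring, yj.2] at hle
    have hm := hmin i (i - 1 - (e - n)) (by rw [abs_lt]; omega)
    have := hS.bin (i - 1 - (e - n))
    omega

theorem MarkoffProp.balancedSum {S y : ℤ → ℤ} (hS : IsBinarySum S y) (hM : MarkoffProp y) :
    BalancedSum S := by
  have key : ∀ n : ℕ, ∀ i j : ℤ, S (j + n) - S j ≤ S (i + n) - S i + 1 := by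
    intro n
    induction n using Nat.strong_induction_on with
    | _ n ih =>
      have hlt : ∀ m, 0 ≤ m → m < (n : ℤ) → ∀ i j, S (j + m) - S j ≤ S (i + m) - S i + 1 := by
        intro m h0 h1 i j
        have := ih m.toNat (by omega) i j
        rwa [show (m.toNat : ℤ) = m by omega] at this
      have main : ∀ D : ℕ, ∀ i j : ℤ, (i - j).natAbs = D →
          S (j + n) - S j ≤ S (i + n) - S i + 1 := by
        intro D
        induction D using Nat.strong_induction_on with
        | _ D ihD =>
          intro i j hD
          by_contra hcon
          have hmin : ∀ i' j' : ℤ, |i' - j'| < |i - j| →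
              S (j' + n) - S j' ≤ S (i' + n) - S i' + 1 := by
            intro i' j' h
            rw [Int.abs_eq_natAbs, Int.abs_eq_natAbs] at h
            exact ihD _ (by omega) i' j' rfl
          rcases lt_trichotomy i j with h | rfl | h
          · refine no_closest_unbalanced_pair hS hM hlt h (by omega) (by omega)
              (fun i' j' h' => hmin i' j' ?_)
            rw [abs_sub_comm i j, abs_of_pos (by omega : (0 : ℤ) < j - i)]
            exact h'
          · omega
          · refine no_closest_unbalanced_pair hS.compl hM.compl (n := n) ?_ h ?_ (by omega) ?_
            · intro m h0 h1 i' j'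
              have := hlt m h0 h1 j' i'
              omega
            · omega
            · intro i' j' h'
              have := hmin j' i' (by
                rw [abs_sub_comm j' i', abs_of_pos (by omega : (0 : ℤ) < i - j)]; exact h')
              omega
      exact fun i j => main _ i j rfl
  intro i j n hn
  have := key n.toNat i j
  rwa [show (n.toNat : ℤ) = n by omega] at this

/-- The adjacent windows j-K, …, j and j+1, …, j+1+K have interiors of equal sum. If the first
disagreement had the sign of the change, their total sums would differ by 2. -/
theorem BalancedSum.markoffProp {S y : ℤ → ℤ} (hS : IsBinarySum S y) (hB : BalancedSum S) :
    MarkoffProp y := by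
  intro j K hK hk
  have sums : ∀ m : ℕ, (m : ℤ) < K → S (j + 1 + 1 + m) - S (j + 1 + 1) = S j - S (j - m) := by
    intro m
    induction m with
    | zero => simp
    | succ m ih =>
      intro hm
      have h1 := ih (by push_cast at hm; omega)
      have h2 := hk (m + 1) (by omega) (by push_cast at hm; omega)
      have h3 := hS.step (j + 1 + 1 + m)
      have h4 := hS.step (j - (m + 1))
      rw [show j + 1 + (↑m + 1) = j + 1 + 1 + m by ring] at h2
      rw [show j - ((m : ℤ) + 1) + 1 = j - m by ring] at h4
      push_cast
      rw [show j + 1 + 1 + ((m : ℤ) + 1) = j + 1 + 1 + m + 1 by ring]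
      omega
  have h1 := sums (K - 1).toNat (by omega)
  rw [show ((K - 1).toNat : ℤ) = K - 1 by omega,
    show j + 1 + 1 + (K - 1) = j + 1 + K by ring, show j - (K - 1) = j - K + 1 by ring] at h1
  have h2 := hS.step (j + 1 + K)
  have h3 := hS.step (j - K)
  have h4 := hS.step j
  have h5 := hS.step (j + 1)
  have b1 := hB (j - K) (j + 1) (K + 1) (by omega)
  have b2 := hB (j + 1) (j - K) (K + 1) (by omega)
  rw [show j + 1 + (K + 1) = j + 1 + K + 1 by ring, show j - K + (K + 1) = j + 1 by ring] at b1 b2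
  have c1 := hS.bin j
  have c2 := hS.bin (j + 1)
  have c3 := hS.bin (j + 1 + K)
  have c4 := hS.bin (j - K)
  rcases c1 with c1 | c1 <;> rcases c2 with c2 | c2 <;> rcases c3 with c3 | c3 <;>
    rcases c4 with c4 | c4 <;> simp only [c1, c2, c3, c4] at * <;> omega

/-! ### Bi-infinite ternary words -/

/-- The lexicographic condition on a word over `{-1, 0, 1}` at every nonzero letter. -/
def TernaryMarkoff (t : ℤ → ℤ) : Prop :=
  (∀ n, |t n| ≤ 1) ∧ ∀ n, t n ≠ 0 →
    t n * (t (n + 1) - t (n - 1)) ≤ 0 ∧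
    (t (n + 1) = t (n - 1) → t n * (t (n + 2) + t (n - 2)) ≤ -1 ∧
      (t n * (t (n + 2) + t (n - 2)) = -1 → ∀ k : ℕ, 3 ≤ k →
        (∀ l : ℕ, 3 ≤ l → l < k → t (n + l) + (-1) ^ l * t (n - l) = 0) →
        t n * (t (n + k) + (-1) ^ k * t (n - k)) ≤ 0))

/-- The word `t` vanishes on one parity class and on the other one it is the difference word of
a balanced binary word. -/
def IsBalancedDiff (t : ℤ → ℤ) : Prop :=
  ∃ (e : ℤ) (S y : ℤ → ℤ), IsBinarySum S y ∧ BalancedSum S ∧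
    (∀ j, t (2 * j + e) = y (j + 1) - y j) ∧ ∀ j, t (2 * j + e + 1) = 0

theorem exists_summatory (f : ℤ → ℤ) : ∃ F : ℤ → ℤ, ∀ n, F (n + 1) = F n + f n := by
  refine ⟨fun n => ∑ i ∈ Finset.range n.toNat, f i -
    ∑ i ∈ Finset.range (-n).toNat, f (-1 - i), fun n => ?_⟩
  rcases le_or_gt 0 n with h | h
  · obtain ⟨m, rfl⟩ := Int.eq_ofNat_of_zero_le h
    have h1 : ((m : ℤ) + 1).toNat = m + 1 := by omega
    have h2 : (-((m : ℤ) + 1)).toNat = 0 := by omega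
    have h3 : (-(m : ℤ)).toNat = 0 := by omega
    simp only [h1, h2, h3, Finset.sum_range_succ, Int.toNat_natCast]
    simp
  · obtain ⟨m, rfl⟩ : ∃ m : ℕ, n = -(m + 1 : ℤ) := ⟨(-n - 1).toNat, by omega⟩
    have h1 : (-((m : ℤ) + 1) + 1).toNat = 0 := by omega
    have h2 : (-(-((m : ℤ) + 1) + 1)).toNat = m := by omega
    have h3 : (-((m : ℤ) + 1)).toNat = 0 := by omega
    have h4 : (- -((m : ℤ) + 1)).toNat = m + 1 := by omega
    simp only [h1, h2, h3, h4, Finset.sum_range_succ]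
    rw [show -1 - (m : ℤ) = -(m + 1) by ring]
    simp

theorem TernaryMarkoff.neg {t : ℤ → ℤ} (h : TernaryMarkoff t) :
    TernaryMarkoff (fun n => -t n) := by
  refine ⟨fun n => by simpa using h.1 n, fun n hn => ?_⟩
  obtain ⟨h1, h2⟩ := h.2 n (by simpa using hn)
  refine ⟨by linarith, fun he => ?_⟩
  obtain ⟨h3, h4⟩ := h2 (by simpa using he)
  refine ⟨by linarith, fun he2 k hk hl => ?_⟩
  have := h4 (by linarith) k hk (fun l h5 h6 => by have := hl l h5 h6; linarith)
  linarith

theorem TernaryMarkoff.cases {t : ℤ → ℤ} (ht : TernaryMarkoff t) (n : ℤ) :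
    t n = 0 ∨ t n = 1 ∨ t n = -1 := by
  have := abs_le.1 (ht.1 n)
  omega

/-- A neighbour 1 propagates to the left as further letters 1, and a neighbour -1 propagates to the
right as an alternating run, until the bound on the second neighbours fails. -/
theorem TernaryMarkoff.succ_eq_zero_of_eq_one {t : ℤ → ℤ} (ht : TernaryMarkoff t) {n : ℤ}
    (hn : t n = 1) : t (n + 1) = 0 := by
  have c := ht.cases
  rcases c (n + 1) with h | h | h
  · exact h
  · exfalso
    have h1 := (ht.2 n (by omega)).1
    have h2 : t (n - 1) = 1 := by
      have := c (n - 1)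
      rw [hn, h] at h1
      omega
    have h3 := ht.2 (n - 1) (by omega)
    rw [h2, show n - 1 + 1 = n by ring, hn, show n - 1 - 1 = n - 2 by ring,
      show n - 1 + 2 = n + 1 by ring, h] at h3
    have := c (n - 2)
    have := c (n - 1 - 2)
    have h4 := h3.2 (by omega)
    omega
  · exfalso
    have h1 := (ht.2 (n + 1) (by omega)).1
    rw [h, show n + 1 - 1 = n by ring, show n + 1 + 1 = n + 2 by ring, hn] at h1
    have h2 : t (n + 2) = 1 := by have := c (n + 2); omega
    have h3 := ht.2 (n + 2) (by omega)
    rw [h2, show n + 2 + 1 = n + 3 by ring, show n + 2 - 1 = n + 1 by ring, h,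
      show n + 2 + 2 = n + 4 by ring, show n + 2 - 2 = n by ring, hn] at h3
    have h4 : t (n + 3) = -1 := by have := c (n + 3); omega
    have h5 := (ht.2 (n + 3) (by omega)).1
    rw [h4, show n + 3 + 1 = n + 4 by ring, show n + 3 - 1 = n + 2 by ring, h2] at h5
    have := h3.2 (by omega)
    omega

theorem TernaryMarkoff.succ_eq_zero {t : ℤ → ℤ} (ht : TernaryMarkoff t) {n : ℤ}
    (hn : t n ≠ 0) : t (n + 1) = 0 := by
  rcases ht.cases n with h | h | h
  · exact absurd h hn
  · exact ht.succ_eq_zero_of_eq_one h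
  · have := ht.neg.succ_eq_zero_of_eq_one (n := n) (by omega)
    omega

theorem TernaryMarkoff.pred_eq_zero {t : ℤ → ℤ} (ht : TernaryMarkoff t) {n : ℤ}
    (hn : t n ≠ 0) : t (n - 1) = 0 := by
  by_contra h
  have := ht.succ_eq_zero h
  rw [sub_add_cancel] at this
  exact hn this

theorem TernaryMarkoff.second_neighbours {t : ℤ → ℤ} (ht : TernaryMarkoff t) {n : ℤ}
    (hn : t n ≠ 0) : t n * (t (n + 2) + t (n - 2)) ≤ -1 :=
  ((ht.2 n hn).2 ((ht.succ_eq_zero hn).trans (ht.pred_eq_zero hn).symm)).1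

theorem TernaryMarkoff.lex {t : ℤ → ℤ} (ht : TernaryMarkoff t) {n : ℤ}
    (hn : t n ≠ 0) (h2 : t n * (t (n + 2) + t (n - 2)) = -1) {k : ℕ} (hk : 3 ≤ k)
    (hl : ∀ l : ℕ, 3 ≤ l → l < k → t (n + l) + (-1) ^ l * t (n - l) = 0) :
    t n * (t (n + k) + (-1) ^ k * t (n - k)) ≤ 0 :=
  ((ht.2 n hn).2 ((ht.succ_eq_zero hn).trans (ht.pred_eq_zero hn).symm)).2 h2 k hk hl

/-- Consecutive nonzero letters are at an even distance and of opposite sign. -/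
theorem TernaryMarkoff.gap {t : ℤ → ℤ} (ht : TernaryMarkoff t) (g : ℕ) :
    ∀ i : ℤ, 1 ≤ g → t i ≠ 0 → t (i + g) ≠ 0 →
      (∀ l : ℤ, i < l → l < i + g → t l = 0) → Even g ∧ t (i + g) = -t i := by
  induction g using Nat.strong_induction_on with
  | _ g ih =>
    intro i hg hi hj hz
    have c := ht.cases
    have hg1 : g ≠ 1 := by
      rintro rfl
      exact hj (by exact_mod_cast ht.succ_eq_zero hi)
    rcases Nat.lt_or_ge g 3 with hg3 | hg3
    · obtain rfl : g = 2 := by omega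
      refine ⟨even_two, ?_⟩
      have := ht.second_neighbours hi
      push_cast at *
      have := c (i - 2)
      rcases c i with h | h | h <;> rcases c (i + 2) with h' | h' | h' <;> simp only [h, h'] at * <;> omega
    have left2 : t (i - 2) = -t i := by
      have := ht.second_neighbours hi
      rw [hz (i + 2) (by omega) (by omega)] at this
      have := c (i - 2)
      rcases c i with h | h | h <;> simp only [h] at * <;> omega
    have eq2 : t i * (t (i + 2) + t (i - 2)) = -1 := by
      rw [left2, hz (i + 2) (by omega) (by omega)]
      rcases c i with h | h | h <;> simp only [h] at * <;> omega
    -- As the letter at i + 2 is zero, the letter at i - 2 is forced to be -t i. A further nonzero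
    -- letter at i - l then ends a gap of length l - 2 < g, to which the induction applies.
    have leftgap : ∀ l : ℕ, 3 ≤ l → l ≤ g → (∀ m : ℕ, 3 ≤ m → m < l → t (i - m) = 0) →
        t (i - l) ≠ 0 → Even l ∧ t (i - l) = t i := by
      intro l h3 hlg hm hl
      have := ih (l - 2) (by omega) (i - l) (by omega) hl
        (by rw [show i - (l : ℤ) + (l - 2 : ℕ) = i - 2 by omega, left2]; omega)
        (fun m h1 h2 => by
          have := hm (i - m).toNat (by omega) (by omega)
          rwa [show i - ((i - m).toNat : ℤ) = m by omega] at this)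
      rw [show i - (l : ℤ) + (l - 2 : ℕ) = i - 2 by omega, left2] at this
      exact ⟨by obtain ⟨r, hr⟩ := this.1; exact ⟨r + 1, by omega⟩, by omega⟩
    have leftzero : ∀ l : ℕ, 3 ≤ l → l < g → t (i - l) = 0 := by
      intro l
      induction l using Nat.strong_induction_on with
      | _ l ihl =>
        intro h3 hlg
        by_contra hne
        obtain ⟨he, hv⟩ := leftgap l h3 hlg.le (fun m h1 h2 => ihl m h2 h1 (by omega)) hne
        have := ht.lex hi eq2 h3 (fun m h1 h2 => by
          rw [hz (i + m) (by omega) (by omega), ihl m h2 h1 (by omega)]; simp)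
        rw [he.neg_one_pow, hv, hz (i + l) (by omega) (by omega)] at this
        rcases c i with h | h | h <;> simp only [h] at * <;> omega
    have lexg := ht.lex hi eq2 hg3 (fun m h1 h2 => by
          rw [hz (i + m) (by omega) (by omega), leftzero m h1 h2]; simp)
    have lg : t (i - g) ≠ 0 → Even g ∧ t (i - g) = t i :=
      leftgap g hg3 le_rfl leftzero
    rcases Nat.even_or_odd g with he | ho
    · refine ⟨he, ?_⟩
      rw [he.neg_one_pow] at lexg
      by_cases h0 : t (i - g) = 0
      · rw [h0] at lexg
        rcases c i with h | h | h <;> rcases c (i + g) with h' | h' | h' <;> simp only [h, h'] at * <;>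
          omega
      · rw [(lg h0).2] at lexg
        rcases c i with h | h | h <;> rcases c (i + g) with h' | h' | h' <;> simp only [h, h'] at * <;>
          omega
    -- For odd g the conditions at both ends of the gap are needed. The first forces opposite signs,
    -- but the factor (-1)^g at the other end turns the opposite letter into a positive
    -- contribution.
    · exfalso
      have hne : ¬ Even g := Nat.not_even_iff_odd.2 ho
      have h0 : t (i - g) = 0 := by
        by_contra h0
        exact hne (lg h0).1
      rw [h0] at lexg
      have hba : t (i + g) = -t i := by
        rcases c i with h | h | h <;> rcases c (i + g) with h' | h' | h' <;> simp only [h, h'] at * <;>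
          omega
      obtain ⟨j, hjdef⟩ : ∃ j, j = i + (g : ℤ) := ⟨_, rfl⟩
      rw [← hjdef] at hj hba hz
      have right2 : t (j + 2) = -t j := by
        have := ht.second_neighbours hj
        rw [hz (j - 2) (by omega) (by omega)] at this
        have := c (j + 2)
        rcases c j with h | h | h <;> simp only [h] at * <;> omega
      have eq2' : t j * (t (j + 2) + t (j - 2)) = -1 := by
        rw [right2, hz (j - 2) (by omega) (by omega)]
        rcases c j with h | h | h <;> simp only [h] at * <;> omega
      have rightgap : ∀ l : ℕ, 3 ≤ l → l ≤ g → (∀ m : ℕ, 3 ≤ m → m < l → t (j + m) = 0) →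
          t (j + l) ≠ 0 → Even l ∧ t (j + l) = t j := by
        intro l h3 hlg hm hl
        have := ih (l - 2) (by omega) (j + 2) (by omega)
          (by rw [right2]; omega)
          (by rwa [show j + 2 + ((l - 2 : ℕ) : ℤ) = j + l by omega])
          (fun m h1 h2 => by
            have := hm (m - j).toNat (by omega) (by omega)
            rwa [show j + ((m - j).toNat : ℤ) = m by omega] at this)
        rw [show j + 2 + ((l - 2 : ℕ) : ℤ) = j + l by omega, right2] at this
        exact ⟨by obtain ⟨r, hr⟩ := this.1; exact ⟨r + 1, by omega⟩, by omega⟩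
      have rightzero : ∀ l : ℕ, 3 ≤ l → l < g → t (j + l) = 0 := by
        intro l
        induction l using Nat.strong_induction_on with
        | _ l ihl =>
          intro h3 hlg
          by_contra hne
          obtain ⟨he, hv⟩ := rightgap l h3 hlg.le (fun m h1 h2 => ihl m h2 h1 (by omega)) hne
          have := ht.lex hj eq2' h3 (fun m h1 h2 => by
            rw [hz (j - m) (by omega) (by omega), ihl m h2 h1 (by omega)]; simp)
          rw [he.neg_one_pow, hv, hz (j - l) (by omega) (by omega)] at this
          rcases c j with h | h | h <;> simp only [h] at * <;> omega
      have lexj := ht.lex hj eq2' hg3 (fun m h1 h2 => by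
          rw [hz (j - m) (by omega) (by omega), rightzero m h1 h2]; simp)
      have h0' : t (j + g) = 0 := by
        by_contra h0
        exact hne (rightgap g hg3 le_rfl rightzero h0).1
      rw [h0', ho.neg_one_pow, show j - (g : ℤ) = i by omega] at lexj
      rcases c i with h | h | h <;> rcases c j with h' | h' | h' <;> simp only [h, h'] at * <;> omega

theorem TernaryMarkoff.even_dist {t : ℤ → ℤ} (ht : TernaryMarkoff t) (g : ℕ) :
    ∀ i : ℤ, t i ≠ 0 → t (i + g) ≠ 0 → Even g := by
  induction g using Nat.strong_induction_on with
  | _ g ih =>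
    intro i hi hj
    rcases Nat.eq_zero_or_pos g with rfl | hg
    · exact Even.zero
    by_cases hz : ∀ l : ℤ, i < l → l < i + g → t l = 0
    · exact (ht.gap g i hg hi hj hz).1
    · push Not at hz
      obtain ⟨l, h1, h2, h3⟩ := hz
      have a := ih (l - i).toNat (by omega) i hi (by rwa [show i + ((l - i).toNat : ℤ) = l by omega])
      have b := ih (i + g - l).toNat (by omega) l h3
        (by rwa [show l + ((i + g - l).toNat : ℤ) = i + g by omega])
      have := a.add b
      rwa [show (l - i).toNat + (i + g - l).toNat = g by omega] at this

theorem TernaryMarkoff.exists_parity {t : ℤ → ℤ} (ht : TernaryMarkoff t) :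
    ∃ e, ∀ j, t (2 * j + e + 1) = 0 := by
  by_cases hz : ∀ n, t n = 0
  · exact ⟨0, fun j => hz _⟩
  push Not at hz
  obtain ⟨e, he⟩ := hz
  refine ⟨e, fun j => ?_⟩
  by_contra h
  rcases le_or_gt 0 (2 * j + 1) with h0 | h0
  · have := ht.even_dist (2 * j + 1).toNat e he
      (by rwa [show e + ((2 * j + 1).toNat : ℤ) = 2 * j + e + 1 by omega])
    obtain ⟨r, hr⟩ := this
    omega
  · have := ht.even_dist (-(2 * j + 1)).toNat (2 * j + e + 1) h
      (by rwa [show 2 * j + e + 1 + ((-(2 * j + 1)).toNat : ℤ) = e by omega])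
    obtain ⟨r, hr⟩ := this
    omega

/-- Nonzero letters alternate in sign, so the sum over an interval is half the sum of its first and
its last nonzero letter. In `key`, v is the first one and `t l` the last. -/
theorem TernaryMarkoff.abs_sum_le {t Y : ℤ → ℤ} (ht : TernaryMarkoff t)
    (hY : ∀ n, Y (n + 1) = Y n + t n) (i : ℤ) (k : ℕ) : |Y (i + k) - Y i| ≤ 1 := by
  have key : ((∀ l : ℤ, i ≤ l → l < i + k → t l = 0) ∧ Y (i + k) = Y i) ∨
      ∃ v l : ℤ, |v| ≤ 1 ∧ i ≤ l ∧ l < i + k ∧ t l ≠ 0 ∧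
        (∀ m, l < m → m < i + k → t m = 0) ∧ 2 * (Y (i + k) - Y i) = v + t l := by
    induction k with
    | zero => left; simp; intro l; omega
    | succ k ih =>
      have hs := hY (i + k)
      have e : i + ((k + 1 : ℕ) : ℤ) = i + k + 1 := by push_cast; ring
      rw [e, hs]
      rcases ih with ⟨h1, h2⟩ | ⟨v, l, hv, h1, h2, h3, h4, h5⟩
      · by_cases h0 : t (i + k) = 0
        · left
          refine ⟨fun l a b => ?_, by omega⟩
          rcases eq_or_ne l (i + k) with rfl | hne
          · exact h0
          · exact h1 l a (by omega)
        · right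
          exact ⟨t (i + k), i + k, ht.1 _, by omega, by omega, h0, fun m _ _ => by omega, by omega⟩
      · right
        by_cases h0 : t (i + k) = 0
        · refine ⟨v, l, hv, h1, by omega, h3, fun m a b => ?_, by omega⟩
          rcases eq_or_ne m (i + k) with rfl | hne
          · exact h0
          · exact h4 m a (by omega)
        · have e2 : l + ((i + k - l).toNat : ℤ) = i + k := by omega
          have := (ht.gap (i + k - l).toNat l (by omega) h3 (by rwa [e2])
            (fun m a b => h4 m a (by omega))).2
          rw [e2] at this
          exact ⟨v, i + k, hv, by omega, by omega, h0, fun m _ _ => by omega, by omega⟩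
  rcases key with ⟨_, h⟩ | ⟨v, l, hv, -, -, -, -, h⟩
  · simp [h]
  · have := abs_le.1 hv
    have := ht.cases l
    rw [abs_le]
    omega

/-- Bounded oscillation means that the summatory function of t takes only two consecutive values, so
on one parity class it is a binary word. The lexicographic condition on t is then the Markoff
property of that word. -/
theorem TernaryMarkoff.isBalancedDiff {t : ℤ → ℤ} (ht : TernaryMarkoff t) :
    IsBalancedDiff t := by
  obtain ⟨e, he⟩ := ht.exists_parity
  obtain ⟨Y, hY⟩ := exists_summatory t
  have hdiff : ∀ i j, Y j - Y i ≤ 1 ∧ Y i - Y j ≤ 1 := by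
    intro i j
    rcases le_total i j with h | h
    · have := abs_le.1 (ht.abs_sum_le hY i (j - i).toNat)
      rw [show i + ((j - i).toNat : ℤ) = j by omega] at this
      omega
    · have := abs_le.1 (ht.abs_sum_le hY j (i - j).toNat)
      rw [show j + ((i - j).toNat : ℤ) = i by omega] at this
      omega
  obtain ⟨m, hm⟩ : ∃ m, ∀ i, Y i = m ∨ Y i = m + 1 := by
    by_cases h : ∃ i, Y i = Y 0 - 1
    · obtain ⟨i, hi⟩ := h
      exact ⟨Y 0 - 1, fun j => by have := hdiff i j; have := hdiff 0 j; omega⟩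
    · push Not at h
      exact ⟨Y 0, fun j => by have := hdiff 0 j; have := h j; omega⟩
  obtain ⟨S, hS⟩ := exists_summatory (fun j => Y (2 * j + e) - m)
  have hbin : IsBinarySum S (fun j => Y (2 * j + e) - m) :=
    ⟨hS, fun i => by have := hm (2 * i + e); omega⟩
  have hx : ∀ j, t (2 * j + e) = (Y (2 * (j + 1) + e) - m) - (Y (2 * j + e) - m) := by
    intro j
    have h1 := hY (2 * j + e)
    have h2 := hY (2 * j + e + 1)
    rw [he j, show 2 * j + e + 1 + 1 = 2 * (j + 1) + e by ring] at h2
    omega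
  refine ⟨e, S, _, hbin, ?_, hx, he⟩
  refine MarkoffProp.balancedSum hbin ?_
  intro j K hK hk
  simp only at hk ⊢
  by_cases h0 : t (2 * j + e) = 0
  · rw [hx] at h0
    rw [h0, zero_mul]
  rw [← hx]
  -- The symmetric sum at distance 2k is D_k - D_{k-1}, where D_k = y(j+1+k) - y(j-k). If D₁, …,
  -- D_{K-1} vanish, the sum at distance 2 is -D₀, the later ones vanish, and the sum at distance 2K
  -- (for K > 1) is D_K.
  have x2 : ∀ k, t (2 * j + e + 2 * k) + t (2 * j + e - 2 * k) =
      (Y (2 * (j + 1 + k) + e) - Y (2 * (j - k) + e)) -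
      (Y (2 * (j + 1 + (k - 1)) + e) - Y (2 * (j - (k - 1)) + e)) := by
    intro k
    have h1 := hx (j + k)
    have h2 := hx (j - k)
    rw [show 2 * (j + k) + e = 2 * j + e + 2 * k by ring,
      show 2 * (j + k + 1) + e = 2 * (j + 1 + k) + e by ring] at h1
    rw [show 2 * (j - k) + e = 2 * j + e - 2 * k by ring] at h2
    rw [show 2 * (j + 1 + (k - 1)) + e = 2 * j + e + 2 * k by ring,
      show 2 * (j - (k - 1)) + e = 2 * (j - k + 1) + e by ring,
      show 2 * (j - k) + e = 2 * j + e - 2 * k by ring]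
    omega
  have c := ht.cases (2 * j + e)
  have hsn := ht.second_neighbours h0
  have x1 := x2 1
  simp only [mul_one, sub_self, add_zero, sub_zero] at x1
  have hx0 := hx j
  have b1 := hm (2 * (j + 1 + 1) + e)
  have b2 := hm (2 * (j - 1) + e)
  rcases eq_or_lt_of_le hK with rfl | hK1
  · rcases c with h | h | h <;> simp only [h] at * <;> omega
  · have e1 := hk 1 le_rfl hK1
    have eq2 : t (2 * j + e) * (t (2 * j + e + 2) + t (2 * j + e - 2)) = -1 := by
      rcases c with h | h | h <;> simp only [h] at * <;> omega
    have := ht.lex h0 eq2 (k := (2 * K).toNat) (by omega) (fun l h1 h2 => by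
      rcases Nat.even_or_odd' l with ⟨r, rfl | rfl⟩
      · rw [(even_two_mul r).neg_one_pow, one_mul]
        push_cast
        rw [x2]
        have a1 := hk r (by omega) (by omega)
        have a2 := hk (r - 1) (by omega) (by omega)
        omega
      · have a1 := he (j + r)
        have a2 := he (j - r - 1)
        rw [show 2 * (j + r) + e + 1 = 2 * j + e + ((2 * r + 1 : ℕ) : ℤ) by push_cast; ring] at a1
        rw [show 2 * (j - r - 1) + e + 1 = 2 * j + e - ((2 * r + 1 : ℕ) : ℤ) by push_cast; ring]
          at a2
        rw [a1, a2]; simp)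
    rw [show ((2 * K).toNat : ℤ) = 2 * K by omega, Even.neg_one_pow ⟨K.toNat, by omega⟩, one_mul,
      x2 K, hk (K - 1) (by omega) (by omega) |> sub_left_inj.1] at this
    rcases c with h | h | h <;> simp only [h] at * <;> linarith

/-! ### Symmetry centres of balanced words, periodic balanced words -/

theorem IsBinarySum.step' {S y : ℤ → ℤ} (h : IsBinarySum S y) {a c : ℤ} (hc : c = a + 1) :
    S c = S a + y a := by
  subst hc
  exact h.step a

theorem eq_of_pasts_eq {y : ℤ → ℤ} {n : ℤ}
    (hdet : ∀ i i', (∀ k, 1 ≤ k → k ≤ n → y (i - k) = y (i' - k)) → y i = y i') {i i' : ℤ}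
    (h : ∀ k, 1 ≤ k → k ≤ n → y (i - k) = y (i' - k)) (m : ℕ) : y (i + m) = y (i' + m) := by
  induction m using Nat.strong_induction_on with
  | _ m ih =>
    refine hdet _ _ fun k h1 h2 => ?_
    rcases lt_or_ge (m : ℤ) k with hk | hk
    · have := h (k - m) (by omega) (by omega)
      rwa [show i - (k - m) = i + m - k by ring, show i' - (k - m) = i' + m - k by ring] at this
    · have := ih (m - k).toNat (by omega)
      rwa [show i + ((m - k).toNat : ℤ) = i + m - k by omega,
        show i' + ((m - k).toNat : ℤ) = i' + m - k by omega] at this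

/-- A binary word in which every letter is determined by the `n` preceding ones is periodic. -/
theorem periodic_of_deterministic {y : ℤ → ℤ} (hy : ∀ i, y i = 0 ∨ y i = 1) {n : ℕ}
    (hdet : ∀ i i', (∀ k : ℤ, 1 ≤ k → k ≤ n → y (i - k) = y (i' - k)) → y i = y i') (x : ℤ) :
    y (x + ((2 ^ n).factorial : ℕ)) = y x := by
  -- Among the 2ⁿ + 1 pasts of the positions from a to x two coincide, and the repetition starts no
  -- later than x. The period so obtained is at most 2ⁿ, hence divides (2ⁿ)!, a period that does not
  -- depend on x.
  obtain ⟨a, ha⟩ : ∃ a : ℤ, a = x - (2 ^ n : ℕ) := ⟨_, rfl⟩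
  let f : Fin (2 ^ n + 1) → (Fin n → Bool) := fun u k => decide (y (a + u - 1 - k) = 1)
  obtain ⟨u, v, huv, hf⟩ : ∃ u v, u ≠ v ∧ f u = f v :=
    Fintype.exists_ne_map_eq_of_card_lt f (by simp)
  wlog hlt : u < v generalizing u v
  · exact this v u huv.symm hf.symm (lt_of_le_of_ne (not_lt.1 hlt) huv.symm)
  have hpast : ∀ k : ℤ, 1 ≤ k → k ≤ n → y (a + u - k) = y (a + v - k) := by
    intro k h1 h2
    have := congrFun hf ⟨(k - 1).toNat, by omega⟩
    simp only [f, decide_eq_decide] at this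
    rw [show a + u - 1 - ((k - 1).toNat : ℤ) = a + u - k by omega,
      show a + v - 1 - ((k - 1).toNat : ℤ) = a + v - k by omega] at this
    rcases hy (a + u - k) with h | h <;> rcases hy (a + v - k) with h' | h' <;>
      rw [h, h'] at this <;> simp_all
  have hper : ∀ z : ℤ, x ≤ z → y (z + ((v : ℕ) - (u : ℕ) : ℤ)) = y z := by
    intro z hz
    have := eq_of_pasts_eq hdet hpast (z - a - u).toNat
    have hu := u.2
    rw [show a + u + ((z - a - u).toNat : ℤ) = z by omega,
      show a + v + ((z - a - u).toNat : ℤ) = z + ((v : ℕ) - (u : ℕ) : ℤ) by omega] at this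
    exact this.symm
  have hlt' : (u : ℕ) < v := hlt
  have hper' : ∀ m : ℕ, y (x + m * ((v : ℕ) - (u : ℕ) : ℤ)) = y x := by
    intro m
    induction m with
    | zero => simp
    | succ m ih =>
      rw [← ih, ← hper (x + m * ((v : ℕ) - (u : ℕ) : ℤ))
        (by have : (0 : ℤ) ≤ m * ((v : ℕ) - (u : ℕ) : ℤ) := by
              apply mul_nonneg <;> omega
            omega)]
      congr 1
      push_cast
      ring
  obtain ⟨w, hw⟩ : (v : ℕ) - u ∣ (2 ^ n).factorial :=
    Nat.dvd_factorial (by omega) (by have := v.2; omega)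
  rw [hw, ← hper' w]
  congr 1
  push_cast [Nat.cast_sub hlt'.le]
  ring

theorem BalancedSum.exists_min {S : ℤ → ℤ} (hB : BalancedSum S) :
    ∃ c : ℤ → ℤ, ∀ m, 0 ≤ m → (∀ i, c m ≤ S (i + m) - S i ∧ S (i + m) - S i ≤ c m + 1) ∧
      ∃ i, S (i + m) - S i = c m := by
  suffices h : ∀ m, ∃ c, 0 ≤ m → (∀ i, c ≤ S (i + m) - S i ∧ S (i + m) - S i ≤ c + 1) ∧
      ∃ i, S (i + m) - S i = c by
    choose c hc using h
    exact ⟨c, hc⟩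
  intro m
  by_cases hm : 0 ≤ m
  · by_cases h : ∃ i, S (i + m) - S i = S (0 + m) - S 0 - 1
    · obtain ⟨i, hi⟩ := h
      refine ⟨_, fun _ => ⟨fun j => ?_, i, hi⟩⟩
      have := hB i j m hm
      have := hB j 0 m hm
      omega
    · push Not at h
      refine ⟨_, fun _ => ⟨fun j => ?_, 0, rfl⟩⟩
      have := hB j 0 m hm
      have := hB 0 j m hm
      have := h j
      omega
  · exact ⟨0, fun h => absurd h hm⟩

/-- A balanced word with a right special factor of length `n` has a change of letters around which
it is symmetric at distances less than `n`. -/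
theorem BalancedSum.exists_center_of_special {S y : ℤ → ℤ} (hS : IsBinarySum S y)
    (hB : BalancedSum S) {n i i' : ℤ} (hn : 1 ≤ n)
    (hpast : ∀ k, 1 ≤ k → k ≤ n → y (i - k) = y (i' - k)) (hi : y i = 0) (hi' : y i' = 1) :
    ∃ j, y (j + 1) ≠ y j ∧ ∀ k, 1 ≤ k → k < n → y (j + 1 + k) = y (j - k) := by
  obtain ⟨c, hc⟩ := hB.exists_min
  have same : ∀ k : ℕ, (k : ℤ) ≤ n → S i - S (i - k) = S i' - S (i' - k) := by
    intro k
    induction k with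
    | zero => simp
    | succ k ih =>
      intro hk
      push_cast at hk ⊢
      have h1 := ih (by omega)
      have h2 := hpast (k + 1) (by omega) (by omega)
      have h3 := hS.step' (a := i - (k + 1)) (c := i - k) (by ring)
      have h4 := hS.step' (a := i' - (k + 1)) (c := i' - k) (by ring)
      omega
  -- Windows ending at i and at i' agree except for the last letter, so they realize the minimal and
  -- the maximal sum of every length up to n + 1.
  have past : ∀ m, 1 ≤ m → m ≤ n + 1 → S (i + 1) - S (i + 1 - m) = c m ∧
      S (i' + 1) - S (i' + 1 - m) = c m + 1 := by
    intro m h1 h2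
    have h3 := same (m - 1).toNat (by omega)
    rw [show i - ((m - 1).toNat : ℤ) = i + 1 - m by omega,
      show i' - ((m - 1).toNat : ℤ) = i' + 1 - m by omega] at h3
    have h4 := (hc m (by omega)).1 (i + 1 - m)
    have h5 := (hc m (by omega)).1 (i' + 1 - m)
    rw [sub_add_cancel] at h4 h5
    have := hS.step i
    have := hS.step i'
    omega
  have super : ∀ k l, 0 ≤ k → 0 ≤ l → c (k + l) = c k + c l ∨ c (k + l) = c k + c l + 1 := by
    intro k l hk hl
    obtain ⟨a, ha⟩ := (hc k hk).2
    obtain ⟨a', ha'⟩ := (hc (k + l) (by omega)).2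
    have h1 := (hc l hl).1 (a + k)
    have h2 := (hc (k + l) (by omega)).1 a
    have h3 := (hc k hk).1 a'
    have h4 := (hc l hl).1 (a' + k)
    rw [show a + (k + l) = a + k + l by ring] at h2
    rw [show a' + (k + l) = a' + k + l by ring] at ha'
    omega
  have one := past 1 le_rfl (by omega)
  rw [add_sub_cancel_right, add_sub_cancel_right] at one
  have s1 := hS.step i
  have s2 := hS.step i'
  -- The minimal sums c are additive up to 0 or 1. If each k ≤ n has a partner l with no excess, the
  -- heavy past of i' forces a minimal future after i'. Otherwise some k₀ has excess with every l,
  -- and the light past of i forces a maximal future after i. In either case past and future sums of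
  -- equal length differ by one, which is the claimed symmetry.
  by_cases htype : ∀ k, 1 ≤ k → k ≤ n → ∃ l, 1 ≤ l ∧ l ≤ n ∧ c (k + l) = c k + c l
  · have fut : ∀ k, 1 ≤ k → k ≤ n → S (i' + 1 + k) - S (i' + 1) = c k := by
      intro k h1 h2
      obtain ⟨l, h3, h4, h5⟩ := htype k h1 h2
      have h6 := (hc (k + l) (by omega)).1 (i' + 1 - l)
      rw [show i' + 1 - l + (k + l) = i' + 1 + k by ring] at h6
      have h7 := (past l h3 (by omega)).2
      have h8 := (hc k (by omega)).1 (i' + 1)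
      omega
    refine ⟨i', ?_, fun k h1 h2 => ?_⟩
    · have := fut 1 le_rfl hn
      have := hS.step (i' + 1)
      omega
    · have a1 := fut k h1 (by omega)
      have a2 := fut (k + 1) (by omega) (by omega)
      have a3 := (past k h1 (by omega)).2
      have a4 := (past (k + 1) (by omega) (by omega)).2
      have a5 := hS.step' (a := i' + 1 + k) (c := i' + 1 + (k + 1)) (by ring)
      have a6 := hS.step' (a := i' - k) (c := i' + 1 - k) (by ring)
      rw [show i' + 1 - (k + 1) = i' - k by ring] at a4
      omega
  · push Not at htype
    obtain ⟨k₀, h1, h2, h3⟩ := htype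
    have fut : ∀ k, 1 ≤ k → k ≤ n → S (i + 1 + k) - S (i + 1) = c k + 1 := by
      intro k h4 h5
      have h6 := h3 k h4 h5
      have h7 := super k₀ k (by omega) (by omega)
      rw [add_comm] at h6 h7
      have h8 := (hc (k + k₀) (by omega)).1 (i + 1 - k₀)
      rw [show i + 1 - k₀ + (k + k₀) = i + 1 + k by ring] at h8
      have h9 := (past k₀ h1 (by omega)).1
      have h10 := (hc k (by omega)).1 (i + 1)
      omega
    refine ⟨i, ?_, fun k h4 h5 => ?_⟩
    · have := fut 1 le_rfl hn
      have := hS.step (i + 1)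
      omega
    · have a1 := fut k h4 (by omega)
      have a2 := fut (k + 1) (by omega) (by omega)
      have a3 := (past k h4 (by omega)).1
      have a4 := (past (k + 1) (by omega) (by omega)).1
      have a5 := hS.step' (a := i + 1 + k) (c := i + 1 + (k + 1)) (by ring)
      have a6 := hS.step' (a := i - k) (c := i + 1 - k) (by ring)
      rw [show i + 1 - (k + 1) = i - k by ring] at a4
      omega

/-- If the n preceding letters always determined the next one, the word would be periodic. So some
factor of length n has both continuations. -/
theorem BalancedSum.exists_center {S y : ℤ → ℤ} (hS : IsBinarySum S y) (hB : BalancedSum S)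
    {n : ℕ} (hn : 1 ≤ n) (hper : ¬ ∀ x, y (x + ((2 ^ n).factorial : ℕ)) = y x) :
    ∃ j, y (j + 1) ≠ y j ∧ ∀ k : ℤ, 1 ≤ k → k < n → y (j + 1 + k) = y (j - k) := by
  by_cases hdet : ∀ i i', (∀ k : ℤ, 1 ≤ k → k ≤ n → y (i - k) = y (i' - k)) → y i = y i'
  · exact absurd (periodic_of_deterministic hS.bin hdet) hper
  · push Not at hdet
    obtain ⟨i, i', h1, h2⟩ := hdet
    rcases hS.bin i with h3 | h3 <;> rcases hS.bin i' with h4 | h4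
    · omega
    · exact hB.exists_center_of_special hS (by omega) h1 h3 h4
    · exact hB.exists_center_of_special hS (by omega) (fun k a b => (h1 k a b).symm) h4 h3
    · omega

theorem eq_of_step_eq {f : ℤ → ℤ} (h : ∀ i, f (i + 1) = f i) (i j : ℤ) : f i = f j := by
  have key : ∀ i, f i = f 0 := by
    intro i
    induction i using Int.induction_on with
    | zero => rfl
    | succ i ih => rw [h, ih]
    | pred i ih => rw [← ih, ← h (-(i : ℤ) - 1), sub_add_cancel]
  rw [key i, key j]

theorem IsBinarySum.add_mul_period {S y : ℤ → ℤ} (hS : IsBinarySum S y) {T : ℤ}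
    (hT : ∀ j, y (j + T) = y j) (i m : ℤ) : S (i + m * T) = S i + m * (S T - S 0) := by
  have h1 : ∀ i, S (i + T) - S i = S T - S 0 := by
    intro i
    have := eq_of_step_eq (f := fun i => S (i + T) - S i) (fun i => by
      have := hS.step i
      have := hS.step' (a := i + T) (c := i + 1 + T) (by ring)
      have := hT i
      omega) i 0
    simpa using this
  have := eq_of_step_eq (f := fun m => S (i + m * T) - m * (S T - S 0)) (fun m => by
    have := h1 (i + m * T)
    rw [show i + (m + 1) * T = i + m * T + T by ring]
    linarith) m 0
  simp only [zero_mul, add_zero, sub_zero] at this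
  linarith

/-- A periodic balanced word is a mechanical word of rational slope. -/
theorem BalancedSum.exists_slope {S y : ℤ → ℤ} (hS : IsBinarySum S y) (hB : BalancedSum S)
    {T : ℤ} (hT0 : 0 < T) (hT : ∀ j, y (j + T) = y j) :
    ∃ (a : ℤ) (p N : ℕ), 0 < N ∧ p ≤ N ∧ p.Coprime N ∧ ∀ l, S (a + l) = S a + l * p / N := by
  obtain ⟨P, hP⟩ : ∃ P, P = S T - S 0 := ⟨_, rfl⟩
  have hmul := hS.add_mul_period hT
  rw [← hP] at hmul
  -- Adding consecutive windows of length l costs at most one per window. With T windows the total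
  -- length is a multiple of the period, so the sum of one window deviates from its mean by less
  -- than 1.
  have lower : ∀ i l : ℤ, 0 ≤ l → ∀ m : ℕ,
      (m + 1) * (S (i + l) - S i) - m ≤ S (i + (m + 1) * l) - S i ∧
      S (i + (m + 1) * l) - S i ≤ (m + 1) * (S (i + l) - S i) + m := by
    intro i l hl m
    induction m with
    | zero => simp
    | succ m ih =>
      have h1 := hB i (i + (m + 1) * l) l hl
      have h2 := hB (i + (m + 1) * l) i l hl
      push_cast
      rw [show i + ((m : ℤ) + 1 + 1) * l = i + (m + 1) * l + l by ring]
      constructor <;> linarith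
  have dev : ∀ i l : ℤ, 0 ≤ l → T * (S (i + l) - S i) < l * P + T ∧
      l * P - T < T * (S (i + l) - S i) := by
    intro i l hl
    have h1 := lower i l hl (T - 1).toNat
    rw [show ((T - 1).toNat : ℤ) = T - 1 by omega, sub_add_cancel, mul_comm T l, hmul] at h1
    constructor <;> linarith
  -- Start where the deviation from the line of slope P / T is maximal. Seen from there all
  -- deviations lie in (-1, 0], so the sums are floors.
  obtain ⟨a, -, ha⟩ := Finset.exists_max_image (Finset.Ico 0 T) (fun i => T * S i - i * P)
    ⟨0, by simp [hT0]⟩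
  have hmax : ∀ i, T * S i - i * P ≤ T * S a - a * P := by
    intro i
    have h1 := ha (i % T) (by simp [Int.emod_nonneg _ hT0.ne', Int.emod_lt_of_pos _ hT0])
    have h2 := hmul (i % T) (i / T)
    have h3 : i % T + i / T * T = i := by rw [mul_comm]; exact Int.emod_add_mul_ediv i T
    rw [h3] at h2
    have : T * S i - i * P = T * S (i % T) - (i % T) * P := by
      rw [h2]
      linear_combination P * h3
    rw [this]
    exact h1
  have nonneg : ∀ l : ℤ, 0 ≤ l → S (a + l) = S a + l * P / T := by
    intro l hl
    have h1 := dev a l hl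
    have h2 := hmax (a + l)
    have : l * P / T = S (a + l) - S a := by
      rw [Int.ediv_eq_iff_of_pos hT0]
      constructor <;> linarith
    omega
  have all : ∀ l : ℤ, S (a + l) = S a + l * P / T := by
    intro l
    have h0 : 0 ≤ l + |l| * T := by
      have : |l| * 1 ≤ |l| * T := mul_le_mul_of_nonneg_left hT0 (abs_nonneg l)
      have := neg_abs_le l
      linarith
    have h1 := nonneg _ h0
    rw [← add_assoc, hmul, show (l + |l| * T) * P = l * P + |l| * P * T by ring,
      Int.add_mul_ediv_right _ _ hT0.ne'] at h1
    linarith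
  have hP0 : 0 ≤ P ∧ P ≤ T := by
    have key : ∀ m : ℕ, 0 ≤ S m - S 0 ∧ S m - S 0 ≤ m := by
      intro m
      induction m with
      | zero => simp
      | succ m ih =>
        have := hS.step m
        have := hS.bin m
        push_cast
        omega
    have := key T.toNat
    rw [show (T.toNat : ℤ) = T by omega] at this
    omega
  have hg : 0 < Nat.gcd P.toNat T.toNat := Nat.gcd_pos_of_pos_right _ (by omega)
  obtain ⟨p, hp⟩ := Nat.gcd_dvd_left P.toNat T.toNat
  obtain ⟨N, hN⟩ := Nat.gcd_dvd_right P.toNat T.toNat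
  have hcop : p.Coprime N := by
    have := Nat.coprime_div_gcd_div_gcd hg
    rwa [Nat.div_eq_of_eq_mul_right hg hp, Nat.div_eq_of_eq_mul_right hg hN] at this
  have hPp : P = (Nat.gcd P.toNat T.toNat : ℕ) * p := by
    have : P = (P.toNat : ℤ) := by omega
    rw [this, ← Nat.cast_mul]
    exact_mod_cast hp
  have hTN : T = (Nat.gcd P.toNat T.toNat : ℕ) * N := by
    have : T = (T.toNat : ℤ) := by omega
    rw [this, ← Nat.cast_mul]
    exact_mod_cast hN
  refine ⟨a, p, N, ?_, ?_, hcop, fun l => ?_⟩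
  · rcases Nat.eq_zero_or_pos N with rfl | h
    · simp at hTN; omega
    · exact h
  · have := hP0.2
    generalize Nat.gcd P.toNat T.toNat = g at *
    rw [hPp, hTN] at this
    have := le_of_mul_le_mul_left this (by exact_mod_cast hg)
    exact_mod_cast this
  · rw [all l]
    congr 1
    generalize (Nat.gcd P.toNat T.toNat) = g at *
    rw [hPp, hTN, show l * ((g : ℤ) * p) = g * (l * p) by ring,
      Int.mul_ediv_mul_of_pos _ _ (by exact_mod_cast hg)]

/-! ### Mechanical words of rational slope -/

/-- The summatory function of a mechanical word of slope `p / N`. -/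
def mechSum (p N r j : ℤ) : ℤ := (j * p + r) / N

/-- The mechanical word of slope `p / N`. -/
def mechWord (p N r j : ℤ) : ℤ := mechSum p N r (j + 1) - mechSum p N r j

theorem mechSum_spec {N : ℤ} (hN : 0 < N) (p r j : ℤ) :
    N * mechSum p N r j ≤ j * p + r ∧ j * p + r < N * mechSum p N r j + N :=
  ⟨Int.mul_ediv_self_le hN.ne', Int.lt_mul_ediv_self_add hN⟩

theorem mechSum_isBinarySum {p N : ℤ} (hN : 0 < N) (hp : 0 ≤ p) (hpN : p ≤ N) (r : ℤ) :
    IsBinarySum (mechSum p N r) (mechWord p N r) where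
  step i := by simp [mechWord]
  bin i := by
    have h1 := mechSum_spec hN p r i
    have h2 := mechSum_spec hN p r (i + 1)
    have h3 : N * (mechSum p N r (i + 1) - mechSum p N r i) < N * 2 := by linarith
    have h4 : N * (-1) < N * (mechSum p N r (i + 1) - mechSum p N r i) := by linarith
    have h5 := lt_of_mul_lt_mul_left h3 hN.le
    have h6 := lt_of_mul_lt_mul_left h4 hN.le
    unfold mechWord
    omega

theorem mechSum_balanced {p N : ℤ} (hN : 0 < N) (r : ℤ) : BalancedSum (mechSum p N r) := by
  intro i j n _
  have h1 := mechSum_spec hN p r i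
  have h2 := mechSum_spec hN p r j
  have h3 := mechSum_spec hN p r (i + n)
  have h4 := mechSum_spec hN p r (j + n)
  have h5 : N * (mechSum p N r (j + n) - mechSum p N r j - mechSum p N r (i + n)
    + mechSum p N r i) < N * 2 := by linarith
  have := lt_of_mul_lt_mul_left h5 hN.le
  omega

theorem mechSum_add_period {N : ℤ} (hN : 0 < N) (p r j : ℤ) :
    mechSum p N r (j + N) = mechSum p N r j + p := by
  unfold mechSum
  rw [show (j + N) * p + r = j * p + r + p * N by ring, Int.add_mul_ediv_right _ _ hN.ne']

theorem mechWord_periodic {N : ℤ} (hN : 0 < N) (p r j : ℤ) :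
    mechWord p N r (j + N) = mechWord p N r j := by
  unfold mechWord
  rw [show j + N + 1 = j + 1 + N by ring, mechSum_add_period hN, mechSum_add_period hN]
  ring

/-- A mechanical word of slope `p / N` in lowest terms, `0 < p < N`, has a change of letters around
which it is symmetric at distances at most `N - 2`. -/
theorem mechWord_exists_center {p N : ℤ} (hp : 0 < p) (hpN : p < N) (hcop : IsCoprime p N)
    (r : ℤ) : ∃ j, mechWord p N r j = 1 ∧ mechWord p N r (j + 1) = 0 ∧
      ∀ k, 1 ≤ k → k ≤ N - 2 → mechWord p N r (j + 1 + k) = mechWord p N r (j - k) := by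
  have hN : 0 < N := by omega
  obtain ⟨u, v, huv⟩ := hcop
  -- Since u p + v N = 1, starting at -(u r) absorbs the intercept r into an additive integer.
  have hj : ∀ k, mechSum p N r (-(u * r) + k) = mechSum p N 0 k + v * r := by
    intro k
    unfold mechSum
    rw [← Int.add_mul_ediv_right _ _ hN.ne']
    congr 1
    linear_combination -r * huv
  -- For k not divisible by N the floors of k p / N and -k p / N add up to -1, which is the
  -- reflection symmetry of the word.
  have symm : ∀ k, 1 ≤ k → k ≤ N - 1 → mechSum p N 0 (-k) = -mechSum p N 0 k - 1 := by
    intro k h1 h2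
    have a1 := mechSum_spec hN p 0 k
    have a2 := mechSum_spec hN p 0 (-k)
    have a3 : N * mechSum p N 0 k ≠ k * p := by
      intro h
      have : N ∣ k * p := ⟨_, h.symm⟩
      have hd : N ∣ k := (show IsCoprime N p from ⟨v, u, by linarith⟩).dvd_of_dvd_mul_right this
      have := Int.le_of_dvd (by omega) hd
      omega
    have a4 : N * mechSum p N 0 k < k * p := lt_of_le_of_ne (by linarith) a3
    have a5 : N * (mechSum p N 0 (-k) + mechSum p N 0 k) < N * 0 := by linarith
    have a6 : N * (-2) < N * (mechSum p N 0 (-k) + mechSum p N 0 k) := by linarith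
    have := lt_of_mul_lt_mul_left a5 hN.le
    have := lt_of_mul_lt_mul_left a6 hN.le
    omega
  have z0 : mechSum p N 0 0 = 0 := by simp [mechSum]
  have z1 : mechSum p N 0 1 = 0 := by
    simp only [mechSum, one_mul, add_zero]
    exact Int.ediv_eq_zero_of_lt hp.le hpN
  have hw : ∀ k, mechWord p N r (-(u * r) + k) = mechSum p N 0 (k + 1) - mechSum p N 0 k := by
    intro k
    unfold mechWord
    rw [add_assoc, hj, hj]
    ring
  refine ⟨-(u * r) - 1, ?_, ?_, fun k h1 h2 => ?_⟩
  · rw [sub_eq_add_neg, hw, symm 1 le_rfl (by omega)]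
    simp [z0, z1]
  · rw [sub_add_cancel]
    have := hw 0
    simp only [add_zero, zero_add] at this
    rw [this, z0, z1, sub_zero]
  · rw [sub_add_cancel, hw, show -(u * r) - 1 - k = -(u * r) + -(k + 1) by ring, hw,
      symm (k + 1) (by omega) (by omega), show -(k + 1) + 1 = -k by ring, symm k h1 (by omega)]
    ring

/-! ### Finite words and their codes -/

theorem code_cons (a : Fin 2) (u : List (Fin 2)) : code (a :: u) = codeLetter a ++ code u := rfl

theorem code_append (u v : List (Fin 2)) : code (u ++ v) = code u ++ code v := by
  simp [code]

theorem codeLetter_zero : codeLetter 0 = [0, 0] := rfl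

theorem codeLetter_one : codeLetter 1 = [0, 1, 0, -1] := rfl

theorem code_length (u : List (Fin 2)) : (code u).length = 2 * (u.length + u.count 1) := by
  induction u with
  | nil => rfl
  | cons a u ih =>
    rw [code_cons, List.length_append, ih]
    fin_cases a
    · simp [codeLetter]; ring
    · simp [codeLetter]; ring

/-- The letter of the code of `u` at the index `i`, and `0` beyond its end. -/
def codeAt (u : List (Fin 2)) (i : ℕ) : ℤ := (code u).getD i 0

theorem codeAt_append_right (p q : List (Fin 2)) (i : ℕ) :
    codeAt (p ++ q) ((code p).length + i) = codeAt q i := by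
  simp [codeAt, code_append, List.getD_eq_getElem?_getD, List.getElem?_append_right]

theorem codeAt_append_left (p q : List (Fin 2)) {i : ℕ} (h : i < (code p).length) :
    codeAt (p ++ q) i = codeAt p i := by
  simp [codeAt, code_append, List.getD_eq_getElem?_getD, List.getElem?_append_left h]

theorem codeAt_zero_cons (u : List (Fin 2)) (i : ℕ) : codeAt (0 :: u) (i + 2) = codeAt u i := by
  simp [codeAt, code_cons, codeLetter]

theorem codeAt_one_cons (u : List (Fin 2)) (i : ℕ) : codeAt (1 :: u) (i + 4) = codeAt u i := by
  simp [codeAt, code_cons, codeLetter]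

/-- Reversal exchanges the letters 1 and -1 of a block; moving a zero from one end to the other
realigns the blocks. -/
theorem code_reverse (p : List (Fin 2)) :
    0 :: (code p).reverse = (code p.reverse).map (fun a => -a) ++ [0] := by
  induction p with
  | nil => rfl
  | cons a p ih =>
    rw [code_cons, List.reverse_append, List.reverse_cons, code_append, List.map_append,
      ← List.cons_append, ih]
    fin_cases a <;> simp [code, codeLetter]

theorem codeAt_reverse (p : List (Fin 2)) {i : ℕ} (h : i < (code p).length) :
    codeAt p ((code p).length - 1 - i) = -codeAt p.reverse (i + 1) := by
  have hlen : (code p.reverse).length = (code p).length := by simp [code_length]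
  have key : (0 :: (code p).reverse).getD (i + 1) 0 =
      ((code p.reverse).map (fun a => -a) ++ [0]).getD (i + 1) 0 := by rw [code_reverse]
  rw [List.getD_cons_succ] at key
  have h1 : (code p).reverse.getD i 0 = codeAt p ((code p).length - 1 - i) := by
    rw [codeAt, List.getD_eq_getElem?_getD, List.getD_eq_getElem?_getD, List.getElem?_reverse h]
  rw [← h1, key, codeAt]
  rcases lt_or_ge (i + 1) (code p.reverse).length with h2 | h2
  · simp [List.getD_eq_getElem?_getD, List.getElem?_append_left, h2]
  · have hi : (code p).length = i + 1 := by omega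
    rw [List.getD_eq_getElem?_getD, List.getD_eq_getElem?_getD,
      List.getElem?_append_right (by simpa using h2), List.getElem?_eq_none h2]
    simp [hlen, hi]

theorem codeAt_even (u : List (Fin 2)) (i : ℕ) : codeAt u (2 * i) = 0 := by
  induction u generalizing i with
  | nil => simp [codeAt, code]
  | cons a u ih =>
    fin_cases a
    · rcases i with _ | i
      · rfl
      · exact (codeAt_zero_cons u (2 * i)).trans (ih i)
    · rcases i with _ | _ | i
      · rfl
      · rfl
      · exact (codeAt_one_cons u (2 * i)).trans (ih i)

theorem codeAt_abs_le (u : List (Fin 2)) (i : ℕ) : |codeAt u i| ≤ 1 := by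
  induction u generalizing i with
  | nil => simp [codeAt, code]
  | cons a u ih =>
    fin_cases a
    · rcases i with _ | _ | i
      · simp [codeAt, code_cons, codeLetter]
      · simp [codeAt, code_cons, codeLetter]
      · exact (codeAt_zero_cons u i).symm ▸ ih i
    · rcases i with _ | _ | _ | _ | i
      · simp [codeAt, code_cons, codeLetter]
      · simp [codeAt, code_cons, codeLetter]
      · simp [codeAt, code_cons, codeLetter]
      · simp [codeAt, code_cons, codeLetter]
      · exact (codeAt_one_cons u i).symm ▸ ih i

theorem codeAt_ne_zero {u : List (Fin 2)} {x : ℕ} (h : codeAt u x ≠ 0) :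
    ∃ p q, u = p ++ 1 :: q ∧ (x = (code p).length + 1 ∨ x = (code p).length + 3) := by
  induction u generalizing x with
  | nil => simp [codeAt, code] at h
  | cons a u ih =>
    fin_cases a
    · rcases x with _ | _ | x
      · exact absurd rfl h
      · exact absurd rfl h
      · obtain ⟨p, q, hu, hx⟩ := ih (x := x) (by rw [← codeAt_zero_cons]; exact h)
        refine ⟨0 :: p, q, by simp [hu], ?_⟩
        simp only [code_cons, codeLetter_zero, List.length_append, List.length_cons,
          List.length_nil]
        omega
    · rcases x with _ | _ | _ | _ | x
      · exact absurd rfl h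
      · exact ⟨[], u, rfl, Or.inl rfl⟩
      · exact absurd rfl h
      · exact ⟨[], u, rfl, Or.inr rfl⟩
      · obtain ⟨p, q, hu, hx⟩ := ih (x := x) (by rw [← codeAt_one_cons]; exact h)
        refine ⟨1 :: p, q, by simp [hu], ?_⟩
        simp only [code_cons, codeLetter_one, List.length_append, List.length_cons,
          List.length_nil]
        omega

/-- The substitution is monotone for the lexicographic order. -/
theorem codeAt_lex (P Q : List (Fin 2)) (h : ∀ m, ¬ (m ++ [0] <+: P ∧ m ++ [1] <+: Q)) (i : ℕ)
    (hP : i < (code P).length) (hQ : i < (code Q).length)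
    (heq : ∀ l < i, codeAt P l = codeAt Q l) : codeAt Q i ≤ codeAt P i := by
  induction P generalizing Q i with
  | nil => simp [code] at hP
  | cons x P ih =>
    rcases Q with _ | ⟨z, Q⟩
    · simp [code] at hQ
    have hrec : x = z → ∀ m, ¬ (m ++ [0] <+: P ∧ m ++ [1] <+: Q) := by
      rintro rfl m ⟨h1, h2⟩
      exact h (x :: m) ⟨by simpa using h1, by simpa using h2⟩
    rw [code_cons, List.length_append] at hP hQ
    fin_cases x <;> fin_cases z
    · rcases i with _ | _ | i
      · exact le_rfl
      · exact le_rfl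
      · simp only [Fin.zero_eta, codeAt_zero_cons]
        refine ih Q (hrec rfl) i ?_ ?_ fun l hl => ?_
        · simp [codeLetter] at hP; omega
        · simp [codeLetter] at hQ; omega
        · have := heq (l + 2) (by omega)
          simpa only [Fin.zero_eta, codeAt_zero_cons] using this
    · exact absurd ⟨by simp, by simp⟩ (h [])
    · rcases i with _ | _ | i
      · exact le_rfl
      · simp [codeAt, code_cons, codeLetter]
      · have := heq 1 (by omega)
        simp [codeAt, code_cons, codeLetter] at this
    · rcases i with _ | _ | _ | _ | i
      · exact le_rfl
      · exact le_rfl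
      · exact le_rfl
      · exact le_rfl
      · simp only [Fin.mk_one, codeAt_one_cons]
        refine ih Q (hrec rfl) i ?_ ?_ fun l hl => ?_
        · simp [codeLetter] at hP; omega
        · simp [codeLetter] at hQ; omega
        · have := heq (l + 4) (by omega)
          simpa only [Fin.mk_one, codeAt_one_cons] using this

/-- The finite form of the Markoff property: otherwise x m' x, with m' the reversal of m, and z m z
would be factors of equal length whose numbers of ones differ by 2. -/
theorem IsBalanced.not_split {u : List (Fin 2)} (hu : IsBalanced u) {x z : Fin 2} (hxz : x ≠ z)
    {p q : List (Fin 2)} (h : u = p ++ x :: z :: q) (m : List (Fin 2)) :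
    ¬ (m ++ [x] <+: p.reverse ∧ m ++ [z] <+: q) := by
  rintro ⟨⟨P, hP⟩, ⟨Q, hQ⟩⟩
  have hp : p = P.reverse ++ ([x] ++ m.reverse) := by
    rw [← List.reverse_reverse p, ← hP]; simp
  have h1 : [x] ++ m.reverse ++ [x] <:+: u := ⟨P.reverse, z :: q, by rw [h, hp]; simp⟩
  have h2 : [z] ++ m ++ [z] <:+: u := ⟨p ++ [x], Q, by rw [h, ← hQ]; simp⟩
  have := hu _ _ h1 h2 (by simp)
  rw [abs_le] at this
  fin_cases x <;> fin_cases z <;> simp at this hxz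
  omega

/-! ### Windows of bi-infinite words and the lexicographic condition for codes -/

/-- The window of length `n` of a bi-infinite word that starts at `a`. -/
def zwindow (t : ℤ → ℤ) (a : ℤ) (n : ℕ) : List ℤ := (List.range n).map fun l : ℕ => t (a + l)

theorem zwindow_length (t : ℤ → ℤ) (a : ℤ) (n : ℕ) : (zwindow t a n).length = n := by
  simp [zwindow]

theorem zwindow_add (t : ℤ → ℤ) (a : ℤ) (m n : ℕ) :
    zwindow t a (m + n) = zwindow t a m ++ zwindow t (a + m) n := by
  simp only [zwindow, List.range_add, List.map_append, List.map_map]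
  congr 1
  refine List.map_congr_left fun l _ => ?_
  simp only [Function.comp_apply]
  congr 1
  push_cast
  ring

theorem zwindow_congr {t t' : ℤ → ℤ} {a a' : ℤ} {n : ℕ}
    (h : ∀ l : ℕ, l < n → t (a + l) = t' (a' + l)) : zwindow t a n = zwindow t' a' n :=
  List.map_congr_left fun l hl => h l (List.mem_range.1 hl)

theorem zwindow_neg (t : ℤ → ℤ) (a : ℤ) (n : ℕ) :
    zwindow (fun i => -t i) a n = (zwindow t a n).map fun i => -i := by
  simp [zwindow]

theorem zwindow_infix (t : ℤ → ℤ) {a a' : ℤ} {n n' : ℕ} (h1 : a' ≤ a) (h2 : a + n ≤ a' + n') :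
    zwindow t a n <:+: zwindow t a' n' := by
  obtain ⟨k, rfl⟩ : ∃ k : ℕ, a = a' + k := ⟨(a - a').toNat, by omega⟩
  obtain ⟨m, rfl⟩ : ∃ m : ℕ, n' = k + n + m := ⟨n' - (k + n), by omega⟩
  rw [zwindow_add, zwindow_add]
  exact ⟨_, _, rfl⟩

theorem zwindow_getD (t : ℤ → ℤ) (a : ℤ) {n i : ℕ} (h : i < n) :
    (zwindow t a n).getD i 0 = t (a + i) := by
  simp [zwindow, List.getD_eq_getElem?_getD, h]

theorem eq_codeAt_of_infix {t : ℤ → ℤ} {a : ℤ} {n : ℕ} {u : List (Fin 2)}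
    (h : zwindow t a n <:+: code u) :
    ∃ x : ℕ, x + n ≤ (code u).length ∧ ∀ i : ℕ, i < n → t (a + i) = codeAt u (x + i) := by
  obtain ⟨X, Y, hXY⟩ := h
  refine ⟨X.length, ?_, fun i hi => ?_⟩
  · rw [← hXY]; simp [zwindow_length]
  · rw [codeAt, ← hXY, ← zwindow_getD t a hi, List.append_assoc, List.getD_eq_getElem?_getD,
      List.getD_eq_getElem?_getD, List.getElem?_append_right (by omega), Nat.add_sub_cancel_left,
      List.getElem?_append_left (by simpa [zwindow_length] using hi)]

/-- The lexicographic condition at `n` for a word that agrees with a code of a balanced word in a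
neighbourhood of `n`. -/
theorem local_markoff {t : ℤ → ℤ} {u : List (Fin 2)} (hu : IsBalanced u) {n : ℤ} {k : ℕ}
    (h : zwindow t (n - (k + 5)) (2 * (k + 5) + 1) <:+: code u) (hn : t n ≠ 0) :
    t (n + 1) = 0 ∧ t (n - 1) = 0 ∧ t n * (t (n + 2) + t (n - 2)) ≤ -1 ∧
    (t n * (t (n + 2) + t (n - 2)) = -1 → 3 ≤ k →
        (∀ l : ℕ, 3 ≤ l → l < k → t (n + l) + (-1) ^ l * t (n - l) = 0) →
        t n * (t (n + k) + (-1) ^ k * t (n - k)) ≤ 0) := by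
  -- The margin 5 beyond k keeps all compared letters inside the codes on both sides of the block
  -- containing n, as `codeAt_lex` requires.
  obtain ⟨x₀, hx₀, hx⟩ := eq_codeAt_of_infix h
  obtain ⟨x, rfl⟩ : ∃ x, x = x₀ + (k + 5) := ⟨_, rfl⟩
  have R : ∀ i : ℕ, i ≤ k + 5 → t (n + i) = codeAt u (x₀ + (k + 5) + i) := by
    intro i hi
    rw [add_assoc, ← hx (k + 5 + i) (by omega)]
    congr 1; push_cast; ring
  have Lf : ∀ i : ℕ, i ≤ k + 5 → t (n - i) = codeAt u (x₀ + (k + 5) - i) := by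
    intro i hi
    rw [Nat.add_sub_assoc hi, ← hx (k + 5 - i) (by omega)]
    congr 1; push_cast [Nat.cast_sub hi]; ring
  have hlen : x₀ + (k + 5) + (k + 5) < (code u).length := by omega
  generalize hX : x₀ + (k + 5) = x at *
  have hxk : k + 5 ≤ x := by omega
  have R0 : t n = codeAt u x := by simpa using R 0 (by omega)
  obtain ⟨p, q, hupq, hp⟩ := codeAt_ne_zero (R0 ▸ hn)
  have hlu : (code u).length = (code p).length + 4 + (code q).length := by
    rw [hupq, code_append, code_cons, codeLetter_one]; simp; ring
  have inq : ∀ i, codeAt u ((code p).length + 4 + i) = codeAt q i := by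
    intro i
    rw [hupq, add_assoc, codeAt_append_right, add_comm 4 i, codeAt_one_cons]
  have in1 : ∀ i, codeAt u ((code p).length + i) = codeAt (1 :: q) i := by
    intro i
    rw [hupq, codeAt_append_right]
  have inp : ∀ i, i < (code p).length →
      codeAt u ((code p).length - 1 - i) = -codeAt p.reverse (i + 1) := by
    intro i hi
    rw [hupq, codeAt_append_left _ _ (by omega), codeAt_reverse p hi]
  have hcr : ∀ v : List (Fin 2), (code v.reverse).length = (code v).length := by
    intro v; simp [code_length]
  have R1 := R 1 (by omega)
  have R2 := R 2 (by omega)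
  have L1 := Lf 1 (by omega)
  have L2 := Lf 2 (by omega)
  push_cast at R1 R2 L1 L2
  -- The nonzero letter is either the 1 or the -1 of a block. In the first case one compares q with
  -- what is left of the block, in the second p read backwards with what is right of it.
  rcases hp with rfl | rfl
  · rw [in1] at R0
    rw [show (code p).length + 1 + 1 = (code p).length + 2 by ring, in1] at R1
    rw [show (code p).length + 1 + 2 = (code p).length + 3 by ring, in1] at R2
    rw [Nat.add_sub_cancel] at L1
    have := in1 0
    rw [add_zero] at this
    rw [this] at L1
    have := inp 0 (by omega)
    rw [show (code p).length + 1 - 2 = (code p).length - 1 - 0 by omega, this] at L2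
    change t n = 1 at R0
    change t (n + 1) = 0 at R1
    change t (n + 2) = -1 at R2
    change t (n - 1) = 0 at L1
    rcases hrev : p.reverse with _ | ⟨a, P⟩
    · have : (code p).length = 0 := by rw [← hcr, hrev]; rfl
      omega
    rw [hrev] at L2
    refine ⟨R1, L1, ?_, ?_⟩
    · rw [R0, R2, L2]
      have := (abs_le.1 (codeAt_abs_le (a :: P) (0 + 1)))
      fin_cases a
      · change 1 * (-1 + -0) ≤ (-1 : ℤ); norm_num
      · change 1 * (-1 + -1) ≤ (-1 : ℤ); norm_num
    · intro heq hk hl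
      fin_cases a
      swap
      · change t (n - 2) = -1 at L2
        rw [R0, R2, L2] at heq
        norm_num at heq
      simp only [Fin.zero_eta] at hrev
      have RR : ∀ i : ℕ, i + 3 ≤ k → t (n + (i + 3 : ℕ)) = codeAt q i := by
        intro i hi
        rw [R _ (by omega), ← inq]
        congr 1; ring
      have LL : ∀ i : ℕ, i + 3 ≤ k → t (n - (i + 3 : ℕ)) = -codeAt P i := by
        intro i hi
        have := inp (i + 1) (by omega)
        rw [hrev, codeAt_zero_cons] at this
        rw [Lf _ (by omega), ← this]
        congr 1; omega
      have hPl : (code p).length = (code P).length + 2 := by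
        rw [← hcr, hrev, code_cons, codeLetter_zero]; simp
      have dk : ∀ i : ℕ, i + 3 ≤ k → t (n + (i + 3 : ℕ)) + (-1) ^ (i + 3) * t (n - (i + 3 : ℕ)) =
          codeAt q i - codeAt P i := by
        intro i hi
        rw [RR i hi, LL i hi]
        rcases Nat.even_or_odd' i with ⟨r, rfl | rfl⟩
        · rw [codeAt_even, codeAt_even]; simp
        · rw [Even.neg_one_pow ⟨r + 2, by ring⟩]; ring
      obtain ⟨i, rfl⟩ : ∃ i, k = i + 3 := ⟨k - 3, by omega⟩
      rw [dk i le_rfl, R0, one_mul, sub_nonpos]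
      -- In the case of equality the letter before the block is 0, so u has the change 0, 1 at this
      -- point. Balance forbids a first disagreement in the wrong direction, and the monotone
      -- substitution carries this to the codes.
      refine codeAt_lex P q ?_ i (by omega) (by omega) fun l hl' => ?_
      · have hp' : p = P.reverse ++ [0] := by rw [← List.reverse_reverse p, hrev]; simp
        have := hu.not_split (x := 0) (z := 1) (by decide) (p := P.reverse) (q := q)
          (by rw [hupq, hp']; simp)
        simpa using this
      · have := hl (l + 3) (by omega) (by omega)
        rw [dk l (by omega)] at this
        linarith
  · rw [in1] at R0
    rw [show (code p).length + 3 + 1 = (code p).length + 4 + 0 by ring, inq] at R1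
    rw [show (code p).length + 3 + 2 = (code p).length + 4 + 1 by ring, inq] at R2
    rw [show (code p).length + 3 - 1 = (code p).length + 2 by omega, in1] at L1
    rw [show (code p).length + 3 - 2 = (code p).length + 1 by omega, in1] at L2
    change t n = -1 at R0
    change t (n - 1) = 0 at L1
    change t (n - 2) = 1 at L2
    rcases q with _ | ⟨a, Q⟩
    · change _ = _ + 4 + 0 at hlu; omega
    have hq0 : codeAt (a :: Q) 0 = 0 := codeAt_even _ 0
    refine ⟨by rw [R1, hq0], L1, ?_, ?_⟩
    · rw [R0, R2, L2]
      fin_cases a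
      · change -1 * ((0 : ℤ) + 1) ≤ (-1 : ℤ); norm_num
      · change -1 * ((1 : ℤ) + 1) ≤ (-1 : ℤ); norm_num
    · intro heq hk hl
      fin_cases a
      swap
      · change t (n + 2) = 1 at R2
        rw [R0, R2, L2] at heq
        norm_num at heq
      simp only [Fin.zero_eta] at *
      have RR : ∀ i : ℕ, i + 3 ≤ k → t (n + (i + 3 : ℕ)) = codeAt Q i := by
        intro i hi
        rw [R _ (by omega), ← codeAt_zero_cons Q, ← inq]
        congr 1; ring
      have LL : ∀ i : ℕ, i + 3 ≤ k → t (n - (i + 3 : ℕ)) = -codeAt p.reverse i := by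
        intro i hi
        rcases i with _ | i
        · have e0 : codeAt p.reverse 0 = 0 := codeAt_even _ 0
          rw [Lf _ (by omega), e0]
          have := in1 0
          rw [add_zero] at this
          simpa using this.trans (codeAt_even _ 0)
        · rw [Lf _ (by omega), ← inp i (by omega)]
          congr 1; omega
      have dk : ∀ i : ℕ, i + 3 ≤ k → t (n + (i + 3 : ℕ)) + (-1) ^ (i + 3) * t (n - (i + 3 : ℕ)) =
          codeAt Q i - codeAt p.reverse i := by
        intro i hi
        rw [RR i hi, LL i hi]
        rcases Nat.even_or_odd' i with ⟨r, rfl | rfl⟩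
        · rw [codeAt_even, codeAt_even]; simp
        · rw [Even.neg_one_pow ⟨r + 2, by ring⟩]; ring
      obtain ⟨i, rfl⟩ : ∃ i, k = i + 3 := ⟨k - 3, by omega⟩
      have hQl : (code (0 :: Q)).length = (code Q).length + 2 := by
        rw [code_cons, codeLetter_zero]; simp
      rw [dk i le_rfl, R0, neg_one_mul, neg_nonpos, sub_nonneg]
      -- Here the change is 1, 0 at the end of the block, and the two sides exchange their roles.
      refine codeAt_lex Q p.reverse ?_ i (by omega) (by rw [hcr]; omega) fun l hl' => ?_
      · have := hu.not_split (x := 1) (z := 0) (by decide) (p := p) (q := Q) hupq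
        intro m hm
        exact this m hm.symm
      · have := hl (l + 3) (by omega) (by omega)
        rw [dk l (by omega)] at this
        linarith

/-- A bi-infinite word all of whose windows are, up to sign, factors of codes of balanced words
satisfies the lexicographic condition. -/
theorem ternaryMarkoff_of_windows {t : ℤ → ℤ}
    (h : ∀ (a : ℤ) (n : ℕ), ∃ u, IsBalanced u ∧
      (zwindow t a n <:+: code u ∨ (zwindow t a n).map (fun i => -i) <:+: code u)) :
    TernaryMarkoff t := by
  have loc : ∀ (n : ℤ) (k : ℕ), t n ≠ 0 →
      t (n + 1) = 0 ∧ t (n - 1) = 0 ∧ t n * (t (n + 2) + t (n - 2)) ≤ -1 ∧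
      (t n * (t (n + 2) + t (n - 2)) = -1 → 3 ≤ k →
        (∀ l : ℕ, 3 ≤ l → l < k → t (n + l) + (-1) ^ l * t (n - l) = 0) →
        t n * (t (n + k) + (-1) ^ k * t (n - k)) ≤ 0) := by
    intro n k hn
    obtain ⟨u, hu, hw | hw⟩ := h (n - (k + 5)) (2 * (k + 5) + 1)
    · exact local_markoff hu hw hn
    · rw [← zwindow_neg] at hw
      obtain ⟨h1, h2, h3, h4⟩ := local_markoff hu hw (by simpa using hn)
      refine ⟨by simpa using h1, by simpa using h2, by linarith, fun a b c => ?_⟩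
      have := h4 (by linarith) b (fun l h5 h6 => by have := c l h5 h6; linarith)
      linarith
  refine ⟨fun n => ?_, fun n hn => ?_⟩
  · obtain ⟨u, -, hw | hw⟩ := h n 1
    · obtain ⟨x, -, hx⟩ := eq_codeAt_of_infix hw
      have := hx 0 one_pos
      simp only [Nat.cast_zero, add_zero] at this
      rw [this]
      exact codeAt_abs_le _ _
    · rw [← zwindow_neg] at hw
      obtain ⟨x, -, hx⟩ := eq_codeAt_of_infix hw
      have := hx 0 one_pos
      simp only [Nat.cast_zero, add_zero] at this
      rw [← abs_neg, this]
      exact codeAt_abs_le _ _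
  · obtain ⟨h1, h2, h3, -⟩ := loc n 0 hn
    refine ⟨by rw [h1, h2]; simp, fun _ => ⟨h3, fun he k hk hl => ?_⟩⟩
    exact (loc n k hn).2.2.2 he hk hl

/-! ### Desubstitution and Christoffel words -/

/-- Cut a word without two adjacent letters `1` into the blocks `0` and `0 1`. -/
theorem exists_desubstitution {S y t : ℤ → ℤ} {e : ℤ} (hS : IsBinarySum S y)
    (h11 : ∀ j, y j = 1 → y (j + 1) = 0) (ht : ∀ j, t (2 * j + e) = y (j + 1) - y j)
    (ht0 : ∀ j, t (2 * j + e + 1) = 0) (n : ℕ) :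
    ∀ a : ℤ, y a = 0 → y (a + n) = 0 → ∃ u : List (Fin 2),
      zwindow t (2 * a + e - 1) (2 * n) = code u ∧
      ∀ v, v <+: u → y (a + v.length + v.count 1) = 0 ∧
        S (a + v.length + v.count 1) = S a + v.count 1 := by
  induction n using Nat.strong_induction_on with
  | _ n ih =>
    intro a ha han
    rcases Nat.eq_zero_or_pos n with rfl | hn
    · exact ⟨[], rfl, fun v hv => by simp [List.prefix_nil.1 hv, ha]⟩
    have t0 : t (2 * a + e - 1) = 0 := by
      have := ht0 (a - 1)
      rwa [show 2 * (a - 1) + e + 1 = 2 * a + e - 1 by ring] at this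
    have t1 := ht a
    have s0 := hS.step a
    -- The letter after the initial 0 decides between the blocks 0 and 01. As every block starts
    -- with 0, the differences are 0 in the first case and 1, -1 in the second; interlaced with
    -- zeros they form `codeLetter`. The block after a prefix v starts at a + |v| + |v|₁, where |v|₁
    -- is the number of ones.
    rcases hS.bin (a + 1) with h1 | h1
    · obtain ⟨u, hu, hv⟩ := ih (n - 1) (by omega) (a + 1) h1
        (by rwa [show a + 1 + ((n - 1 : ℕ) : ℤ) = a + n by omega])
      refine ⟨0 :: u, ?_, fun v hvu => ?_⟩
      · rw [show 2 * n = 2 + 2 * (n - 1) by omega, zwindow_add, code_cons, ← hu]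
        congr 1
        · simp [zwindow, List.range_succ, codeLetter, t0]
          rw [t1, h1, ha]; simp
        · congr 1; push_cast; ring
      · rcases v with _ | ⟨x, v⟩
        · simp [ha]
        · obtain ⟨rfl, hvu'⟩ := List.cons_prefix_cons.1 hvu
          have := hv v hvu'
          rw [show a + ((0 :: v : List (Fin 2)).length : ℤ) + ((0 :: v).count 1 : ℕ) =
            a + 1 + v.length + v.count 1 by simp; ring]
          refine ⟨this.1, ?_⟩
          rw [this.2, s0, ha]
          simp
    · have h2 := h11 _ h1
      rw [show a + 1 + 1 = a + 2 by ring] at h2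
      have hn1 : n ≠ 1 := by rintro rfl; push_cast at han; omega
      have s1 := hS.step (a + 1)
      rw [show a + 1 + 1 = a + 2 by ring] at s1
      have t2 := ht0 a
      have t3 := ht (a + 1)
      rw [show a + 1 + 1 = a + 2 by ring, show 2 * (a + 1) + e = 2 * a + e + 2 by ring] at t3
      obtain ⟨u, hu, hv⟩ := ih (n - 2) (by omega) (a + 2) h2
        (by rwa [show a + 2 + ((n - 2 : ℕ) : ℤ) = a + n by omega])
      refine ⟨1 :: u, ?_, fun v hvu => ?_⟩
      · rw [show 2 * n = 4 + 2 * (n - 2) by omega, zwindow_add, code_cons, ← hu]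
        congr 1
        · simp only [zwindow, List.range_succ, codeLetter_one, List.range_zero,
            List.map_nil, List.map_cons, List.nil_append, List.cons_append]
          push_cast
          rw [add_zero, t0, show 2 * a + e - 1 + 1 = 2 * a + e by ring, t1,
            show 2 * a + e - 1 + 2 = 2 * a + e + 1 by ring, t2,
            show 2 * a + e - 1 + 3 = 2 * a + e + 2 by ring, t3, h1, h2, ha]
          simp
        · congr 1; push_cast; ring
      · rcases v with _ | ⟨x, v⟩
        · simp [ha]
        · obtain ⟨rfl, hvu'⟩ := List.cons_prefix_cons.1 hvu
          have := hv v hvu'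
          rw [show a + ((1 :: v : List (Fin 2)).length : ℤ) + ((1 :: v).count 1 : ℕ) =
            a + 2 + v.length + v.count 1 by simp; ring]
          refine ⟨this.1, ?_⟩
          rw [this.2, s1, s0, ha, h1]
          simp; ring

theorem IsBinarySum.add_le {S y : ℤ → ℤ} (hS : IsBinarySum S y) (a : ℤ) (m : ℕ) :
    S (a + m) ≤ S a + m := by
  induction m with
  | zero => simp
  | succ m ih =>
    have := hS.step' (a := a + m) (c := a + (m + 1 : ℕ)) (by push_cast; ring)
    have := hS.bin (a + m)
    push_cast at *
    omega

/-- Suppose v has at least two more ones than w. Then the image of v without its first 0 and the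
image of w followed by the next 0, cut to equal length, have sums differing by at least 2. -/
theorem desubstitution_balanced {S y : ℤ → ℤ} (hS : IsBinarySum S y) (hB : BalancedSum S)
    {a : ℤ} {u : List (Fin 2)}
    (hu : ∀ v, v <+: u → y (a + v.length + v.count 1) = 0 ∧
        S (a + v.length + v.count 1) = S a + v.count 1) : IsBalanced u := by
  have pos : ∀ v, v <:+: u → ∃ A : ℤ, y A = 0 ∧ y (A + v.length + v.count 1) = 0 ∧
      S (A + v.length + v.count 1) = S A + v.count 1 := by
    rintro v ⟨X, Y, h⟩
    have h1 := hu X ⟨v ++ Y, by rw [← h]; simp⟩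
    have h2 := hu (X ++ v) ⟨Y, by rw [← h]⟩
    refine ⟨a + X.length + X.count 1, h1.1, ?_⟩
    rw [show a + ((X ++ v).length : ℤ) + ((X ++ v).count 1 : ℕ) =
      a + X.length + X.count 1 + v.length + v.count 1 by simp; ring] at h2
    refine ⟨h2.1, ?_⟩
    rw [h2.2, h1.2]
    simp; ring
  have key : ∀ v w : List (Fin 2), v <:+: u → w <:+: u → v.length = w.length →
      v.count 1 ≤ w.count 1 + 1 := by
    intro v w hv hw hl
    obtain ⟨A, a1, -, a3⟩ := pos v hv
    obtain ⟨B, -, b2, b3⟩ := pos w hw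
    by_contra hcon
    have h1 := hS.step A
    have h2 := hS.step (B + w.length + w.count 1)
    -- The image of v without its first letter is longer than the compared length by |v|₁ - |w|₁ -
    -- 2, and at most that many ones are lost by cutting it.
    have h3 := hS.add_le (A + 1 + (w.length + w.count 1 + 1)) (v.count 1 - (w.count 1 + 2))
    rw [show A + 1 + (w.length + w.count 1 + 1) + ((v.count 1 - (w.count 1 + 2) : ℕ) : ℤ) =
      A + v.length + v.count 1 by omega] at h3
    have h4 := hB B (A + 1) (w.length + w.count 1 + 1) (by omega)
    rw [show B + ((w.length : ℤ) + w.count 1 + 1) = B + w.length + w.count 1 + 1 by ring] at h4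
    omega
  intro v w hv hw hl
  have h1 := key v w hv hw hl
  have h2 := key w v hw hv hl.symm
  rw [abs_le]
  omega

theorem BalancedSum.no_ones_or_no_zeros {S y : ℤ → ℤ} (hS : IsBinarySum S y)
    (hB : BalancedSum S) :
    (∀ j, y j = 1 → y (j + 1) = 0) ∨ ∀ j, 1 - y j = 1 → 1 - y (j + 1) = 0 := by
  by_contra hcon
  push Not at hcon
  obtain ⟨⟨j, h1, h2⟩, i, h3, h4⟩ := hcon
  have a1 := hS.step j
  have a2 := hS.step (j + 1)
  have a3 := hS.step i
  have a4 := hS.step (i + 1)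
  have := hB i j 2 (by norm_num)
  rw [show i + 2 = i + 1 + 1 by ring, show j + 2 = j + 1 + 1 by ring] at this
  have := hS.bin (i + 1)
  have := hS.bin (j + 1)
  omega

/-- The windows of a balanced difference word are, up to sign, factors of codes of balanced
words. -/
theorem IsBalancedDiff.windows {t : ℤ → ℤ} (ht : IsBalancedDiff t) (a : ℤ) (n : ℕ) :
    ∃ u, IsBalanced u ∧
      (zwindow t a n <:+: code u ∨ (zwindow t a n).map (fun i => -i) <:+: code u) := by
  have main : ∀ (S y t : ℤ → ℤ) (e : ℤ), IsBinarySum S y → BalancedSum S →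
      (∀ j, y j = 1 → y (j + 1) = 0) → (∀ j, t (2 * j + e) = y (j + 1) - y j) →
      (∀ j, t (2 * j + e + 1) = 0) → ∃ u, IsBalanced u ∧ zwindow t a n <:+: code u := by
    intro S y t e hS hB h11 h1 h2
    have zero_near : ∀ j, ∃ j', j ≤ j' ∧ j' ≤ j + 1 ∧ y j' = 0 := by
      intro j
      rcases hS.bin j with h | h
      · exact ⟨j, le_rfl, by omega, h⟩
      · exact ⟨j + 1, by omega, le_rfl, h11 j h⟩
    obtain ⟨A, hA1, hA2, hA⟩ := zero_near ((a - e) / 2 - 1)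
    obtain ⟨B, hB1, hB2, hB0⟩ := zero_near ((a + n - e) / 2 + 1)
    obtain ⟨u, hu, hv⟩ := exists_desubstitution hS h11 h1 h2 (B - A).toNat A hA
      (by rwa [show A + ((B - A).toNat : ℤ) = B by omega])
    refine ⟨u, desubstitution_balanced hS hB hv, ?_⟩
    rw [← hu]
    exact zwindow_infix t (by omega) (by omega)
  obtain ⟨e, S, y, hS, hB, h1, h2⟩ := ht
  rcases hB.no_ones_or_no_zeros hS with h11 | h00
  · obtain ⟨u, hu, hw⟩ := main S y t e hS hB h11 h1 h2
    exact ⟨u, hu, Or.inl hw⟩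
  -- If 11 occurs then 00 does not. Complementing y reduces to the other case and negates t, hence
  -- the sign in the statement.
  · obtain ⟨u, hu, hw⟩ := main _ _ (fun i => -t i) e hS.compl hB.compl h00
      (fun j => by simp only [h1]; ring) (fun j => by simp only [h2, neg_zero])
    exact ⟨u, hu, Or.inr (by rwa [zwindow_neg] at hw)⟩

/-! ### Christoffel words as mechanical words -/

theorem floor_eq_mechSum (p q i : ℕ) :
    ⌊((p : ℚ) * i) / q⌋ = mechSum p q 0 i := by
  rw [mechSum, add_zero, ← Rat.floor_intCast_div_natCast]
  push_cast
  rw [mul_comm]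

theorem ceil_eq_mechSum {p q : ℕ} (hq : 0 < q) (i : ℕ) :
    ⌈((p : ℚ) * i) / q⌉ = mechSum p q (q - 1) i := by
  have hq' : (0 : ℚ) < q := by exact_mod_cast hq
  have h := mechSum_spec (by exact_mod_cast hq : (0 : ℤ) < q) p (q - 1) i
  rw [Int.ceil_eq_iff, lt_div_iff₀ hq', div_le_iff₀ hq']
  have h1 : ((q : ℤ) * mechSum p q (q - 1) i : ℤ) + 1 ≤ i * p + q := by linarith [h.1]
  have h2 : ((i : ℤ) * p : ℤ) ≤ q * mechSum p q (q - 1) i := by linarith [h.2]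
  have h1' : ((q : ℚ) * mechSum p q (q - 1) i) + 1 ≤ i * p + q := by exact_mod_cast h1
  have h2' : ((i : ℚ) * p) ≤ q * mechSum p q (q - 1) i := by exact_mod_cast h2
  constructor <;> nlinarith

/-- A Christoffel word is the beginning of a mechanical word. -/
theorem IsChristoffel.exists_mech {ν : List (Fin 2)} (h : IsChristoffel ν) :
    ∃ (p q : ℕ) (r : ℤ), 0 < q ∧ p ≤ q ∧ p.Coprime q ∧ mechSum p q r 0 = 0 ∧ ν.length = q ∧
      ∀ (i : ℕ) (h : i < ν.length), (((ν[i] : Fin 2) : ℕ) : ℤ) = mechWord p q r i := by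
  obtain ⟨p, q, hc, hpq, h⟩ := h
  have hq : 0 < q := by
    rcases Nat.eq_zero_or_pos q with rfl | h
    · obtain rfl : p = 0 := by omega
      simp at hc
    · exact h
  rcases h with ⟨hl, hi⟩ | ⟨hl, hi⟩
  · refine ⟨p, q, 0, hq, hpq, hc, by simp [mechSum], hl, fun i h => ?_⟩
    rw [hi i h, mechWord, floor_eq_mechSum]
    have := floor_eq_mechSum p q (i + 1)
    push_cast at this
    rw [this]
  · refine ⟨p, q, q - 1, hq, hpq, hc, ?_, hl, fun i h => ?_⟩
    · simp only [mechSum, zero_mul, zero_add]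
      exact Int.ediv_eq_zero_of_lt (by omega) (by omega)
    · rw [hi i h, mechWord, ceil_eq_mechSum hq]
      have := ceil_eq_mechSum (p := p) hq (i + 1)
      push_cast at this
      rw [this]

/-- The image under `0 ↦ 0`, `1 ↦ 0 1` of a mechanical word of slope `p / q` is mechanical of slope
`p / (p + q)`; both letters at the start of a block are controlled. -/
theorem mechSum_block {p q r : ℤ} (hp : 0 ≤ p) (hq : 0 < q) (i : ℤ) :
    mechSum p (p + q) r (i + mechSum p q r i) = mechSum p q r i ∧
      mechSum p (p + q) r (i + mechSum p q r i + 1) = mechSum p q r i := by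
  have h := mechSum_spec hq p r i
  generalize mechSum p q r i = c at *
  constructor <;> rw [mechSum, Int.ediv_eq_iff_of_pos (by omega)] <;> constructor <;> nlinarith

/-- The nonzero part of a code sits at the odd indices. There it is the difference word of the image
of ν under 0 ↦ 0, 1 ↦ 01, which by `mechSum_block` has slope p / (p + q) and starts at i₀ plus the
number of ones before i₀. -/
theorem codeAt_mech {p q r : ℤ} (hp : 0 ≤ p) (hq : 0 < q) (ν : List (Fin 2)) :
    ∀ i₀ : ℤ, (∀ (i : ℕ) (h : i < ν.length),
      (((ν[i] : Fin 2) : ℕ) : ℤ) = mechWord p q r (i₀ + i)) →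
    (ν.count 1 : ℤ) = mechSum p q r (i₀ + ν.length) - mechSum p q r i₀ ∧
    ∀ j : ℕ, 2 * j < (code ν).length → codeAt ν (2 * j + 1) =
      mechWord p (p + q) r (i₀ + mechSum p q r i₀ + j + 1) -
      mechWord p (p + q) r (i₀ + mechSum p q r i₀ + j) := by
  induction ν with
  | nil => intro i₀ _; simp [code]
  | cons x ν ih =>
    intro i₀ h
    obtain ⟨c1, c2⟩ := ih (i₀ + 1) (fun i hi => by
      have := h (i + 1) (by simpa using hi)
      rw [List.getElem_cons_succ] at this
      rw [this]
      congr 1; push_cast; ring)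
    have hx := h 0 (by simp)
    simp only [List.getElem_cons_zero, Nat.cast_zero, add_zero, mechWord] at hx
    obtain ⟨b1, b2⟩ := mechSum_block (r := r) hp hq i₀
    obtain ⟨b3, b4⟩ := mechSum_block (r := r) hp hq (i₀ + 1)
    refine ⟨?_, fun j hj => ?_⟩
    · rw [show i₀ + ((x :: ν).length : ℤ) = i₀ + 1 + ν.length by simp; ring]
      fin_cases x
      · have hx' : (0 : ℤ) = mechSum p q r (i₀ + 1) - mechSum p q r i₀ := hx
        simp
        omega
      · have hx' : (1 : ℤ) = mechSum p q r (i₀ + 1) - mechSum p q r i₀ := hx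
        simp
        omega
    · rw [code_cons, List.length_append] at hj
      fin_cases x
      · have hx' : (0 : ℤ) = mechSum p q r (i₀ + 1) - mechSum p q r i₀ := hx
        have e1 : mechSum p q r (i₀ + 1) = mechSum p q r i₀ := by omega
        rw [e1] at b3 b4 c2
        rcases j with _ | j
        · change 0 = _
          simp only [mechWord, Nat.cast_zero, add_zero]
          rw [show i₀ + mechSum p q r i₀ + 1 + 1 = i₀ + 1 + mechSum p q r i₀ + 1 by ring, b4, b2, b1]
          ring
        · have := c2 j (by simp [codeLetter] at hj; omega)
          simp only [Fin.zero_eta]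
          rw [show 2 * (j + 1) + 1 = 2 * j + 1 + 2 by ring, codeAt_zero_cons, this]
          congr 2 <;> push_cast <;> ring
      · have hx' : (1 : ℤ) = mechSum p q r (i₀ + 1) - mechSum p q r i₀ := hx
        have e1 : mechSum p q r (i₀ + 1) = mechSum p q r i₀ + 1 := by omega
        rw [e1] at b3 b4 c2
        rcases j with _ | _ | j
        · change 1 = _
          simp only [mechWord, Nat.cast_zero, add_zero]
          rw [show i₀ + mechSum p q r i₀ + 1 + 1 = i₀ + 1 + (mechSum p q r i₀ + 1) by ring, b3, b2,
            b1]
          ring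
        · change -1 = _
          simp only [mechWord, zero_add, Nat.cast_one]
          rw [show i₀ + mechSum p q r i₀ + 1 + 1 = i₀ + 1 + (mechSum p q r i₀ + 1) by ring, b3, b4,
            b2]
          ring
        · have := c2 j (by simp [codeLetter] at hj; omega)
          simp only [Fin.mk_one]
          rw [show 2 * (j + 1 + 1) + 1 = 2 * j + 1 + 4 by ring, codeAt_one_cons, this]
          congr 2 <;> push_cast <;> ring

/-- A word cut out of a mechanical word of slope `p / N` is the lower Christoffel word of slope
`p / (N - p)`. -/
theorem isChristoffel_of_desubstitution {S y : ℤ → ℤ} (hS : IsBinarySum S y) {a : ℤ} {p N : ℕ}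
    (hN : 0 < N) (hcop : p.Coprime N) (hslope : ∀ l, S (a + l) = S a + l * p / N)
    {u : List (Fin 2)} (hlen : u.length + u.count 1 = N)
    (hu : ∀ v, v <+: u → y (a + v.length + v.count 1) = 0 ∧
        S (a + v.length + v.count 1) = S a + v.count 1) : IsChristoffel u := by
  have hN' : (0 : ℤ) < N := by exact_mod_cast hN
  have hcount : u.count 1 = p := by
    have := (hu u (List.prefix_refl u)).2
    rw [add_assoc, hslope, show (u.length : ℤ) + u.count 1 = N by exact_mod_cast hlen,
      Int.mul_ediv_cancel_left _ hN'.ne'] at this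
    omega
  have hple : p ≤ u.length := hcount ▸ List.count_le_length
  have hq : 0 < u.length := by
    rcases Nat.eq_zero_or_pos u.length with h | h
    · omega
    · exact h
  -- If c is the number of ones among the first i letters, then both floor((i+c)p/N) and
  -- floor((i+c+1)p/N) equal c, since a block starts with 0. With N = |u| + p these inequalities say
  -- c = floor(ip/|u|).
  have hcount' : ∀ i ≤ u.length, ((u.take i).count 1 : ℤ) = mechSum p u.length 0 i := by
    intro i hi
    have h1 := hu (u.take i) (List.take_prefix i u)
    rw [List.length_take, min_eq_left hi] at h1
    have h2 := hS.step (a + i + (u.take i).count 1)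
    rw [h1.1, h1.2, add_assoc, add_assoc, hslope] at h2
    have h3 := h1.2
    rw [add_assoc, hslope] at h3
    generalize ((u.take i).count 1 : ℤ) = c at *
    have e2 : ((i : ℤ) + (c + 1)) * p / N = c := by rw [← add_assoc, add_assoc] at h2; linarith
    have e3 : ((i : ℤ) + c) * p / N = c := by linarith
    rw [Int.ediv_eq_iff_of_pos hN'] at e2 e3
    symm
    rw [mechSum, Int.ediv_eq_iff_of_pos (by exact_mod_cast hq)]
    have hNq : (N : ℤ) = u.length + p := by omega
    rw [hNq] at e2 e3
    constructor <;> nlinarith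
  refine ⟨p, u.length, ?_, hple, Or.inl ⟨rfl, fun i hi => ?_⟩⟩
  · rw [← hlen, hcount] at hcop
    simpa using hcop
  · rw [floor_eq_mechSum]
    have e : ⌊((p : ℚ) * ((i : ℚ) + 1)) / u.length⌋ = mechSum p u.length 0 (i + 1 : ℕ) := by
      rw [← floor_eq_mechSum]; push_cast; rfl
    rw [e, ← hcount' i hi.le, ← hcount' (i + 1) hi, List.take_succ_eq_append_getElem hi]
    generalize u[i] = x
    fin_cases x <;> simp

/-! ### Values of words -/

theorem summable_bounded_mul_pow {f : ℕ → ℝ} {B ρ : ℝ} (hρ : |ρ| < 1) (hf : ∀ k, |f k| ≤ B) :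
    Summable fun k => f k * ρ ^ k := by
  refine Summable.of_norm_bounded (g := fun k => B * |ρ| ^ k)
    ((summable_geometric_of_lt_one (abs_nonneg _) hρ).mul_left B) fun k => ?_
  rw [Real.norm_eq_abs, abs_mul, abs_pow]
  exact mul_le_mul_of_nonneg_right (hf k) (by positivity)

/-- The error of a partial sum of a power series with bounded coefficients. -/
theorem abs_sub_partial_le {d : ℕ → ℝ} {ρ s D : ℝ} (h0 : 0 < ρ) (h1 : ρ < 1)
    (hs : HasSum (fun k => d k * ρ ^ k) s) (m : ℕ) (hd : ∀ k, m ≤ k → |d k| ≤ D) :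
    |s - ∑ k ∈ Finset.range m, d k * ρ ^ k| ≤ D * ρ ^ m / (1 - ρ) := by
  have h2 := (hasSum_nat_add_iff' m).2 hs
  rw [← h2.tsum_eq]
  have hg : HasSum (fun k : ℕ => D * ρ ^ m * ρ ^ k) (D * ρ ^ m * (1 - ρ)⁻¹) :=
    (hasSum_geometric_of_lt_one h0.le h1).mul_left _
  have := tsum_of_norm_bounded hg (f := fun k => d (k + m) * ρ ^ (k + m)) fun k => by
    rw [Real.norm_eq_abs, abs_mul, abs_of_pos (by positivity : 0 < ρ ^ (k + m))]
    calc |d (k + m)| * ρ ^ (k + m) ≤ D * ρ ^ (k + m) :=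
          mul_le_mul_of_nonneg_right (hd _ (by omega)) (by positivity)
      _ = D * ρ ^ m * ρ ^ k := by ring
  rwa [Real.norm_eq_abs, ← div_eq_mul_inv] at this

/-- The numerator of the realization map. -/
noncomputable def evalWord (α : ℝ) (t : ℤ → ℤ) : ℝ :=
  (∑' k : ℕ, (t (-(k : ℤ)) : ℝ) * (-α⁻¹) ^ k) + ∑' k : ℕ, (t ((k : ℤ) + 1) : ℝ) / α ^ (k + 1)

theorem realize_eq (α : ℝ) (t : ℤ → ℤ) :
    realize α (-α⁻¹) t = evalWord α t / (α + α⁻¹) := by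
  rw [realize, evalWord, sub_neg_eq_add]

/-- The coefficient of `α⁻ᵏ` in the value of a word. -/
def digit (t : ℤ → ℤ) (k : ℕ) : ℤ := if k = 0 then t 0 else t k + (-1) ^ k * t (-(k : ℤ))

/-- Because the conjugate is -α⁻¹, both halves are power series in α⁻¹, and the letter at -k enters
with the sign (-1)ᵏ. -/
theorem hasSum_digit {α : ℝ} (hα : 1 < α) {t : ℤ → ℤ} {B : ℤ} (hB : ∀ n, |t n| ≤ B) :
    HasSum (fun k => (digit t k : ℝ) * α⁻¹ ^ k) (evalWord α t) := by
  have hρ1 : α⁻¹ < 1 := inv_lt_one_of_one_lt₀ hα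
  have hρ0 : 0 < α⁻¹ := by positivity
  have hB' : ∀ n, |(t n : ℝ)| ≤ B := fun n => by exact_mod_cast hB n
  have s1 : HasSum (fun k : ℕ => (t (-(k : ℤ)) : ℝ) * (-α⁻¹) ^ k) _ :=
    (summable_bounded_mul_pow (by rwa [abs_neg, abs_of_pos hρ0])
      (fun k => hB' (-(k : ℤ)))).hasSum
  have s2 : Summable fun k : ℕ => (t ((k : ℤ) + 1) : ℝ) / α ^ (k + 1) := by
    have := (summable_bounded_mul_pow (by rwa [abs_of_pos hρ0])
      (fun k => hB' ((k : ℤ) + 1))).mul_right α⁻¹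
    refine this.congr fun k => ?_
    rw [div_eq_mul_inv, ← inv_pow, pow_succ, mul_assoc]
  have s3 := (hasSum_nat_add_iff' 1).2 s1
  have s4 := s3.add s2.hasSum
  rw [← hasSum_nat_add_iff' 1]
  convert s4 using 1
  · funext k
    rw [digit, if_neg (by omega), div_eq_mul_inv, ← inv_pow, neg_pow]
    push_cast
    ring
  · simp [digit, evalWord]; ring

theorem evalWord_neg (α : ℝ) (t : ℤ → ℤ) : evalWord α (fun n => -t n) = -evalWord α t := by
  simp only [evalWord, Int.cast_neg, neg_mul, neg_div, tsum_neg]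
  ring

theorem digit_abs_le {t : ℤ → ℤ} (ht : ∀ n, |t n| ≤ 1) (k : ℕ) : |digit t k| ≤ 2 := by
  unfold digit
  have h0 := ht 0
  split_ifs
  · omega
  · calc |t k + (-1) ^ k * t (-(k : ℤ))| ≤ |t k| + |(-1) ^ k * t (-(k : ℤ))| := abs_add_le _ _
      _ = |t k| + |t (-(k : ℤ))| := by rw [abs_mul, abs_neg_one_pow, one_mul]
      _ ≤ 2 := by linarith [ht k, ht (-(k : ℤ))]

/-- The place where α > 3 enters: 2ρ/(1-ρ) < 1 exactly for ρ < 1/3, so a digit of size 1 outweighs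
all later digits of size at most 2. -/
theorem lex_tail {ρ : ℝ} (h0 : 0 < ρ) (h3 : ρ < 1 / 3) (k : ℕ) :
    2 * ρ ^ (k + 1) / (1 - ρ) < ρ ^ k := by
  rw [div_lt_iff₀ (by linarith), pow_succ]
  have : 0 < ρ ^ k := by positivity
  nlinarith

theorem eval_gt_of_lex {ρ E c : ℝ} (h0 : 0 < ρ) (h3 : ρ < 1 / 3) {d : ℕ → ℤ}
    (hd : ∀ k, |d k| ≤ 2) (hs : HasSum (fun k => (d k : ℝ) * ρ ^ k) E) (k : ℕ)
    (hc : ∑ l ∈ Finset.range k, (d l : ℝ) * ρ ^ l = c) (hk : 1 ≤ d k) : c < E := by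
  have h := abs_sub_partial_le h0 (by linarith) hs (k + 1) (D := 2)
    (fun l _ => by exact_mod_cast hd l)
  rw [Finset.sum_range_succ, hc] at h
  have h1 := (abs_le.1 h).1
  have h2 := lex_tail h0 h3 k
  have h4 : (1 : ℝ) ≤ d k := by exact_mod_cast hk
  have h5 : ρ ^ k ≤ d k * ρ ^ k := le_mul_of_one_le_left (by positivity) h4
  linarith

/-- The bound 1 - α⁻² has the digits 1, 0, -1, 0, 0, …, and the digits of T cannot exceed them
lexicographically. -/
theorem eval_lex_at_one {α : ℝ} (hα : 3 < α) {T : ℤ → ℤ} (hT : ∀ n, |T n| ≤ 1)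
    (hE : evalWord α T ≤ 1 - α⁻¹ ^ 2) (h1 : T 0 = 1) :
    T 1 - T (-1) ≤ 0 ∧ (T 1 = T (-1) → T 2 + T (-2) ≤ -1 ∧
      (T 2 + T (-2) = -1 → ∀ k : ℕ, 3 ≤ k →
        (∀ l : ℕ, 3 ≤ l → l < k → T l + (-1) ^ l * T (-l) = 0) →
        T k + (-1) ^ k * T (-k) ≤ 0)) := by
  have h0 : 0 < α⁻¹ := by positivity
  have h3 : α⁻¹ < 1 / 3 := by
    rw [one_div]; exact inv_strictAnti₀ (by norm_num) hα
  have hs := hasSum_digit (by linarith : 1 < α) hT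
  have hd := digit_abs_le hT
  have key := fun k c => eval_gt_of_lex (k := k) (c := c) h0 h3 hd hs
  have d0 : digit T 0 = 1 := by simp [digit, h1]
  have d1 : digit T 1 = T 1 - T (-1) := by simp [digit]; ring
  have d2 : digit T 2 = T 2 + T (-2) := by simp [digit]
  have hsq : 0 < α⁻¹ ^ 2 := by positivity
  refine ⟨?_, fun h11 => ⟨?_, fun h2 k hk hl => ?_⟩⟩
  · by_contra hcon
    have := key 1 1 (by simp [d0]) (by rw [d1]; omega)
    linarith
  · by_contra hcon
    -- A nonnegative digit at 2 would leave a value of at least 1 minus a tail smaller than α⁻²,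
    -- which is above the bound.
    have h := abs_sub_partial_le h0 (by linarith) hs 3 (D := 2)
      (fun l _ => by exact_mod_cast hd l)
    simp only [Finset.sum_range_succ, Finset.sum_range_zero, d0, d1, h11, sub_self] at h
    have h4 := (abs_le.1 h).1
    have h5 := lex_tail h0 h3 2
    have h6 : (0 : ℝ) ≤ digit T 2 := by
      rw [d2]; exact_mod_cast (by omega : 0 ≤ T 2 + T (-2))
    have h7 : 0 ≤ (digit T 2 : ℝ) * α⁻¹ ^ 2 := by positivity
    norm_num at h4 h5
    norm_num at hE h7
    linarith
  · by_contra hcon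
    refine absurd (key k (1 - α⁻¹ ^ 2) ?_ ?_) (not_lt.2 hE)
    · rw [← Finset.sum_subset (Finset.range_subset_range.2 hk)]
      · simp only [Finset.sum_range_succ, Finset.sum_range_zero, d0, d1, d2, h11, h2]
        norm_num
        ring
      · intro l hl1 hl2
        have := hl l (by simpa using hl2) (by simpa using hl1)
        rw [digit, if_neg (by rintro rfl; simp at hl2), this]
        simp
    · rw [digit, if_neg (by omega)]
      omega

/-- A ternary word whose shifts all have small values satisfies the lexicographic condition. -/
theorem ternaryMarkoff_of_eval {α : ℝ} (hα : 3 < α) {t : ℤ → ℤ} (ht : ∀ n, |t n| ≤ 1)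
    (hE : ∀ n, |evalWord α (fun j => t (n + j))| ≤ 1 - α⁻¹ ^ 2) : TernaryMarkoff t := by
  refine ⟨ht, fun n hn => ?_⟩
  have hcases : t n = 1 ∨ t n = -1 := by have := abs_le.1 (ht n); omega
  rcases hcases with h | h
  · have := eval_lex_at_one hα (T := fun j => t (n + j)) (fun m => ht _) (abs_le.1 (hE n)).2
      (by simpa using h)
    simp only [h, one_mul, sub_eq_add_neg]
    simpa only [sub_eq_add_neg] using this
  · have := eval_lex_at_one hα (T := fun j => -t (n + j)) (fun m => by rw [abs_neg]; exact ht _)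
      (by rw [evalWord_neg]; linarith [(abs_le.1 (hE n)).1]) (by simp [h])
    obtain ⟨a1, a2⟩ := this
    simp only [h, sub_eq_add_neg]
    refine ⟨by linarith, fun he => ?_⟩
    obtain ⟨a3, a4⟩ := a2 (by linarith)
    refine ⟨by linarith, fun he2 k hk hl => ?_⟩
    have := a4 (by linarith) k hk (fun l h3 h4 => by have := hl l h3 h4; linarith)
    linarith

/-! ### Values of balanced difference words -/

/-- Digits at odd distance vanish and those at even distance are differences of consecutive D_i =
y(j+1+i) - y(j-i). Summation by parts yields the factor 1 - α⁻². -/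
theorem eval_even {α : ℝ} (hα : 1 < α) {t y : ℤ → ℤ} {e : ℤ} (hy : ∀ i, y i = 0 ∨ y i = 1)
    (ht : ∀ j, t (2 * j + e) = y (j + 1) - y j) (ht0 : ∀ j, t (2 * j + e + 1) = 0) (j : ℤ) :
    ∃ s, HasSum (fun i : ℕ => ((y (j + 1 + i) - y (j - i) : ℤ) : ℝ) * (α⁻¹ ^ 2) ^ i) s ∧
      evalWord α (fun l => t (2 * j + e + l)) = (1 - α⁻¹ ^ 2) * s := by
  have hρ1 : α⁻¹ < 1 := inv_lt_one_of_one_lt₀ hα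
  have hρ0 : 0 < α⁻¹ := by positivity
  have hθ : |α⁻¹ ^ 2| < 1 := by
    rw [abs_of_pos (by positivity)]; exact pow_lt_one₀ hρ0.le hρ1 (by norm_num)
  obtain ⟨D, hD⟩ : ∃ D : ℕ → ℤ, D = fun i : ℕ => y (j + 1 + i) - y (j - i) := ⟨_, rfl⟩
  have hDle : ∀ i, |(D i : ℝ)| ≤ 1 := by
    intro i
    have : |D i| ≤ 1 := by
      rw [hD, abs_le]
      have := hy (j + 1 + i)
      have := hy (j - i)
      simp only
      omega
    exact_mod_cast this
  obtain ⟨s, hs⟩ := summable_bounded_mul_pow hθ hDle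
  refine ⟨s, by rw [hD] at hs; exact hs, ?_⟩
  have htb : ∀ n, |t n| ≤ 1 := by
    intro n
    rcases Int.even_or_odd' (n - e) with ⟨r, hr | hr⟩
    · rw [show n = 2 * r + e by omega, ht, abs_le]
      have := hy (r + 1)
      have := hy r
      omega
    · rw [show n = 2 * r + e + 1 by omega, ht0]; simp
  have hE := hasSum_digit hα (t := fun l => t (2 * j + e + l)) (fun n => htb _)
  have hsub : HasSum (fun i : ℕ => (digit (fun l => t (2 * j + e + l)) (2 * i) : ℝ) *
      α⁻¹ ^ (2 * i)) (s - α⁻¹ ^ 2 * s) := by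
    rw [← hasSum_nat_add_iff' 1]
    have h1 := ((hasSum_nat_add_iff' 1).2 hs).sub (hs.mul_left (α⁻¹ ^ 2))
    convert h1 using 1
    · funext i
      have a1 := ht (j + (i + 1))
      have a2 := ht (j - (i + 1))
      rw [show 2 * (j + ((i : ℤ) + 1)) + e = 2 * j + e + (2 * (i + 1) : ℕ) by push_cast; ring,
        show j + ((i : ℤ) + 1) + 1 = j + 1 + (i + 1 : ℕ) by push_cast; ring,
        show j + ((i : ℤ) + 1) = j + 1 + i by ring] at a1
      rw [show 2 * (j - ((i : ℤ) + 1)) + e = 2 * j + e + -((2 * (i + 1) : ℕ) : ℤ) by push_cast; ring,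
        show j - ((i : ℤ) + 1) + 1 = j - i by ring] at a2
      rw [digit, if_neg (by omega), a1, (even_two_mul (i + 1)).neg_one_pow, a2, hD]
      push_cast
      ring
    · simp [digit, ht j, hD]; ring
  have hinj : Function.Injective fun i : ℕ => 2 * i := fun a b h => by simpa using h
  have := (hinj.hasSum_iff (f := fun k => (digit (fun l => t (2 * j + e + l)) k : ℝ) * α⁻¹ ^ k)
    (a := s - α⁻¹ ^ 2 * s) (fun k hk => by
      rcases Nat.even_or_odd' k with ⟨r, rfl | rfl⟩
      · exact absurd ⟨r, rfl⟩ hk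
      · have a1 := ht0 (j + r)
        have a2 := ht0 (j - r - 1)
        rw [show 2 * (j + (r : ℤ)) + e + 1 = 2 * j + e + (2 * r + 1 : ℕ) by push_cast; ring] at a1
        rw [show 2 * (j - (r : ℤ) - 1) + e + 1 = 2 * j + e + -((2 * r + 1 : ℕ) : ℤ) by
          push_cast; ring] at a2
        rw [digit, if_neg (by omega), a1, a2]
        simp)).1 hsub
  rw [hE.unique this]
  ring

/-- At a position of the vanishing parity class the crude bound 2ρ plus a tail suffices. The
right-hand side equals `maxValue α 2`, the smallest positive maximum, so such positions never decide
a maximum. -/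
theorem eval_odd_le {α : ℝ} (hα : 3.3 ≤ α) {t : ℤ → ℤ} {n : ℤ} (ht : ∀ n, |t n| ≤ 1)
    (h0 : t n = 0) (h2 : t (n + 2) = 0) (h2' : t (n - 2) = 0) :
    |evalWord α (fun l => t (n + l))| ≤ (1 - α⁻¹ ^ 2) / (1 + α⁻¹ ^ 2) := by
  have hρ0 : 0 < α⁻¹ := by positivity
  have hρ1 : α⁻¹ ≤ 10 / 33 := by
    rw [inv_le_comm₀ (by linarith) (by norm_num)]; norm_num at *; linarith
  have hE := hasSum_digit (by linarith : 1 < α) (t := fun l => t (n + l)) (fun n => ht _)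
  have hd := digit_abs_le (t := fun l => t (n + l)) (fun m => ht _)
  have h := abs_sub_partial_le hρ0 (by linarith) hE 3 (D := 2)
      (fun l _ => by exact_mod_cast hd l)
  have d0 : digit (fun l => t (n + l)) 0 = 0 := by simp [digit, h0]
  have d2 : digit (fun l => t (n + l)) 2 = 0 := by
    simp [digit, h2]; rw [← sub_eq_add_neg, h2']
  simp only [Finset.sum_range_succ, Finset.sum_range_zero, d0, d2] at h
  have h1 : |(digit (fun l => t (n + l)) 1 : ℝ) * α⁻¹| ≤ 2 * α⁻¹ := by
    rw [abs_mul, abs_of_pos hρ0]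
    exact mul_le_mul_of_nonneg_right (by exact_mod_cast hd 1) hρ0.le
  norm_num at h
  rw [← sub_add_cancel (evalWord α _) ((digit (fun l => t (n + l)) 1 : ℝ) * α⁻¹)]
  refine (abs_add_le _ _).trans ((add_le_add h h1).trans ?_)
  have e3 : 2 * (α ^ 3)⁻¹ / (1 - α⁻¹) ≤ 1 / 12 := by
    rw [div_le_iff₀ (by linarith), ← inv_pow]
    have : α⁻¹ ^ 3 ≤ (10 / 33) ^ 3 := pow_le_pow_left₀ hρ0.le hρ1 3
    norm_num at this ⊢
    linarith
  rw [le_div_iff₀ (by positivity)]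
  nlinarith

theorem lex_sum_bounds {θ s : ℝ} (h0 : 0 < θ) (h1 : θ < 1 / 9) {D : ℕ → ℤ}
    (hD : ∀ k, |D k| ≤ 1) (hs : HasSum (fun k => (D k : ℝ) * θ ^ k) s) (hD0 : D 0 = 1)
    {K : ℕ} (hK : 1 ≤ K) (hz : ∀ k, 1 ≤ k → k < K → D k = 0) :
    1 - θ ^ K / (1 - θ) ≤ s ∧ (D K = -1 → s ≤ 1 - θ ^ (K + 1)) := by
  have hsum : ∑ k ∈ Finset.range K, (D k : ℝ) * θ ^ k = 1 := by
    rw [← Finset.sum_subset (Finset.range_subset_range.2 hK)]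
    · simp [hD0]
    · intro k h2 h3
      rw [hz k (by simpa [Nat.one_le_iff_ne_zero] using h3) (by simpa using h2)]
      simp
  constructor
  · have h := abs_sub_partial_le h0 (by linarith) hs K (D := 1)
      (fun l _ => by exact_mod_cast hD l)
    rw [hsum] at h
    have := (abs_le.1 h).1
    rw [one_mul] at this
    linarith
  · intro hDK
    have h := abs_sub_partial_le h0 (by linarith) hs (K + 1) (D := 1)
      (fun l _ => by exact_mod_cast hD l)
    rw [Finset.sum_range_succ, hsum, hDK] at h
    have h2 := (abs_le.1 h).2
    push_cast at h2
    have h3 : 1 * θ ^ (K + 1) / (1 - θ) ≤ θ ^ K - θ ^ (K + 1) := by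
      rw [div_le_iff₀ (by linarith), pow_succ]
      have : 0 < θ ^ K := by positivity
      have h4 : (1 - θ) ^ 2 ≥ θ := by nlinarith
      nlinarith
    linarith

theorem lex_sum_le_one {θ s : ℝ} (h0 : 0 < θ) (h1 : θ < 1 / 9) {D : ℕ → ℤ}
    (hD : ∀ k, |D k| ≤ 1) (hs : HasSum (fun k => (D k : ℝ) * θ ^ k) s) (hD0 : D 0 = 1)
    (hM : ∀ K, 1 ≤ K → (∀ k, 1 ≤ k → k < K → D k = 0) → D K ≤ 0) : 0 ≤ s ∧ s ≤ 1 := by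
  constructor
  · have := (lex_sum_bounds h0 h1 hD hs hD0 le_rfl (fun k _ _ => by omega)).1
    have h2 : θ ^ 1 / (1 - θ) ≤ 1 := by rw [div_le_iff₀ (by linarith)]; linarith
    linarith
  · by_cases hex : ∃ K, 1 ≤ K ∧ D K ≠ 0
    · classical
      obtain ⟨h2, h3⟩ := Nat.find_spec hex
      have hz : ∀ k, 1 ≤ k → k < Nat.find hex → D k = 0 := by
        intro k h4 h5
        by_contra h6
        exact Nat.find_min hex h5 ⟨h4, h6⟩
      have h4 := hM _ h2 hz
      have h5 := abs_le.1 (hD (Nat.find hex))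
      have := (lex_sum_bounds h0 h1 hD hs hD0 h2 hz).2 (by omega)
      have : 0 < θ ^ (Nat.find hex + 1) := by positivity
      linarith
    · push Not at hex
      have := hasSum_single (f := fun k => (D k : ℝ) * θ ^ k) 0 (fun k hk => by
        rw [hex k (by omega)]; simp)
      rw [hs.unique this]
      simp [hD0]

theorem periodic_sum_eq {θ s : ℝ} (h0 : 0 < θ) (h1 : θ < 1) {D : ℕ → ℤ} {N : ℕ} (hN : 2 ≤ N)
    (hs : HasSum (fun k => (D k : ℝ) * θ ^ k) s) (hD0 : D 0 = 1)
    (hper : ∀ k, D (k + N) = D k) (hz : ∀ k, 1 ≤ k → k < N - 1 → D k = 0)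
    (hlast : D (N - 1) = -1) : s = (1 - θ ^ (N - 1)) / (1 - θ ^ N) := by
  have h2 := (hasSum_nat_add_iff' N).2 hs
  have h3 : HasSum (fun k => (D (k + N) : ℝ) * θ ^ (k + N)) (θ ^ N * s) := by
    refine (hs.mul_left (θ ^ N)).congr_fun fun k => ?_
    rw [hper]; ring
  have h4 := h2.unique h3
  have hsum : ∑ k ∈ Finset.range N, (D k : ℝ) * θ ^ k = 1 - θ ^ (N - 1) := by
    obtain ⟨M, rfl⟩ : ∃ M, N = M + 1 := ⟨N - 1, by omega⟩
    simp only [Nat.add_sub_cancel] at hz hlast ⊢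
    rw [Finset.sum_range_succ, hlast,
      ← Finset.sum_subset (Finset.range_subset_range.2 (by omega : 1 ≤ M))]
    · simp [hD0]; ring
    · intro k h2 h3
      rw [hz k (by simpa [Nat.one_le_iff_ne_zero] using h3) (by simpa using h2)]
      simp
  have h5 : θ ^ N < 1 := pow_lt_one₀ h0.le h1 (by omega)
  rw [eq_div_iff (by linarith), ← hsum]
  linarith

/-- The first nonzero coefficient after the initial one is -1 and comes before the index N. At N - 1
the sum is the geometric value; any earlier, the sum is at most 1 - θ^(N-1), which is smaller. -/
theorem periodic_sum_le {θ s : ℝ} (h0 : 0 < θ) (h1 : θ < 1 / 9) {D : ℕ → ℤ} {N : ℕ} (hN : 2 ≤ N)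
    (hD : ∀ k, |D k| ≤ 1) (hs : HasSum (fun k => (D k : ℝ) * θ ^ k) s) (hD0 : D 0 = 1)
    (hper : ∀ k, D (k + N) = D k)
    (hM : ∀ K, 1 ≤ K → (∀ k, 1 ≤ k → k < K → D k = 0) → D K ≤ 0) :
    s ≤ (1 - θ ^ (N - 1)) / (1 - θ ^ N) := by
  have hDN : D N = 1 := by have := hper 0; rw [zero_add] at this; rw [this, hD0]
  have hex : ∃ K, 1 ≤ K ∧ D K ≠ 0 := ⟨N, by omega, by omega⟩
  classical
  obtain ⟨h2, h3⟩ := Nat.find_spec hex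
  have hz : ∀ k, 1 ≤ k → k < Nat.find hex → D k = 0 := by
    intro k h4 h5
    by_contra h6
    exact Nat.find_min hex h5 ⟨h4, h6⟩
  have hle : Nat.find hex ≤ N := Nat.find_min' hex ⟨by omega, by omega⟩
  generalize Nat.find hex = K at *
  have h4 := hM _ h2 hz
  have h5 := abs_le.1 (hD K)
  have hKN : K ≠ N := by rintro rfl; omega
  have hDK : D K = -1 := by omega
  have hθN : 0 < θ ^ N := by positivity
  have hθN' : θ ^ N < 1 := pow_lt_one₀ h0.le (by linarith) (by omega)
  rcases Nat.lt_or_ge K (N - 1) with hlt | hge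
  · have h6 := (lex_sum_bounds h0 h1 hD hs hD0 h2 hz).2 hDK
    have h7 : θ ^ (N - 1) ≤ θ ^ (K + 1) :=
      pow_le_pow_of_le_one h0.le (by linarith) (by omega)
    have h8 : θ ^ (N - 1) < 1 := pow_lt_one₀ h0.le (by linarith) (by omega)
    rw [le_div_iff₀ (by linarith)]
    have : (1 - θ ^ (N - 1)) * (1 - θ ^ N) ≤ (1 - θ ^ (N - 1)) := by nlinarith
    nlinarith
  · obtain rfl : K = N - 1 := by omega
    exact (periodic_sum_eq h0 (by linarith) hN hs hD0 hper hz hDK).le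

open Filter Topology

/-! ### Bounds for the values of balanced difference words -/

theorem binary_diff_abs_le {y : ℤ → ℤ} (hy : ∀ i, y i = 0 ∨ y i = 1) (i j : ℤ) :
    |y i - y j| ≤ 1 := by
  have := hy i
  have := hy j
  rw [abs_le]
  omega

theorem diff_word_abs_le {t y : ℤ → ℤ} {e : ℤ} (hy : ∀ i, y i = 0 ∨ y i = 1)
    (ht : ∀ j, t (2 * j + e) = y (j + 1) - y j) (ht0 : ∀ j, t (2 * j + e + 1) = 0) (n : ℤ) :
    |t n| ≤ 1 := by
  rcases Int.even_or_odd' (n - e) with ⟨r, hr | hr⟩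
  · rw [show n = 2 * r + e by omega, ht]
    exact binary_diff_abs_le hy _ _
  · rw [show n = 2 * r + e + 1 by omega, ht0]; simp

/-- The sum attached to the change of letters between `j` and `j + 1`, made positive. -/
theorem exists_signed_center {θ s : ℝ} {y : ℤ → ℤ} (hy : ∀ i, y i = 0 ∨ y i = 1) {j : ℤ}
    (hne : y (j + 1) ≠ y j)
    (hs : HasSum (fun i : ℕ => ((y (j + 1 + i) - y (j - i) : ℤ) : ℝ) * θ ^ i) s) :
    ∃ (D : ℕ → ℤ) (s' : ℝ), |s'| = |s| ∧ HasSum (fun k => (D k : ℝ) * θ ^ k) s' ∧ D 0 = 1 ∧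
      (∀ k, |D k| ≤ 1) ∧
      ∀ k : ℕ, D k = (y (j + 1) - y j) * (y (j + 1 + k) - y (j - k)) := by
  have hbin := binary_diff_abs_le hy
  have ha : y (j + 1) - y j = 1 ∨ y (j + 1) - y j = -1 := by
    have := hy (j + 1)
    have := hy j
    omega
  refine ⟨fun k => (y (j + 1) - y j) * (y (j + 1 + k) - y (j - k)),
    ((y (j + 1) - y j : ℤ) : ℝ) * s, ?_, ?_, ?_, fun k => ?_, fun k => rfl⟩
  · rcases ha with h | h <;> rw [h] <;> simp
  · refine (hs.mul_left ((y (j + 1) - y j : ℤ) : ℝ)).congr_fun fun k => ?_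
    push_cast
    ring
  · rcases ha with h | h <;> simp [h]
  · rw [abs_mul]
    have := hbin (j + 1 + k) (j - k)
    rcases ha with h | h <;> simpa [h] using this

theorem MarkoffProp.signed {y : ℤ → ℤ} (hM : MarkoffProp y) {j : ℤ} (hne : y (j + 1) ≠ y j)
    {D : ℕ → ℤ} (hD : ∀ k : ℕ, D k = (y (j + 1) - y j) * (y (j + 1 + k) - y (j - k))) :
    ∀ K, 1 ≤ K → (∀ k, 1 ≤ k → k < K → D k = 0) → D K ≤ 0 := by
  intro K hK hz
  rw [hD]
  refine hM j K (by exact_mod_cast hK) fun k h1 h2 => ?_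
  have := hz k.toNat (by omega) (by omega)
  rw [hD, show (k.toNat : ℤ) = k by omega] at this
  rcases mul_eq_zero.1 this with h | h
  · exact absurd (sub_eq_zero.1 h) hne
  · exact sub_eq_zero.1 h

section

variable {θ s : ℝ} {y : ℤ → ℤ} {j : ℤ}

theorem center_abs_le (h0 : 0 < θ) (h1 : θ < 1 / 9) (hy : ∀ i, y i = 0 ∨ y i = 1)
    (hM : MarkoffProp y) (hne : y (j + 1) ≠ y j)
    (hs : HasSum (fun i : ℕ => ((y (j + 1 + i) - y (j - i) : ℤ) : ℝ) * θ ^ i) s) : |s| ≤ 1 := by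
  obtain ⟨D, s', hs', hsum, hD0, hDb, hD⟩ := exists_signed_center hy hne hs
  have := lex_sum_le_one h0 h1 hDb hsum hD0 (hM.signed hne hD)
  rw [← hs', abs_of_nonneg this.1]
  exact this.2

theorem center_abs_le_periodic (h0 : 0 < θ) (h1 : θ < 1 / 9) (hy : ∀ i, y i = 0 ∨ y i = 1)
    (hM : MarkoffProp y) (hne : y (j + 1) ≠ y j) {N : ℕ} (hN : 2 ≤ N)
    (hper : ∀ i, y (i + N) = y i)
    (hs : HasSum (fun i : ℕ => ((y (j + 1 + i) - y (j - i) : ℤ) : ℝ) * θ ^ i) s) :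
    |s| ≤ (1 - θ ^ (N - 1)) / (1 - θ ^ N) := by
  obtain ⟨D, s', hs', hsum, hD0, hDb, hD⟩ := exists_signed_center hy hne hs
  have hM' := hM.signed hne hD
  rw [← hs', abs_of_nonneg (lex_sum_le_one h0 h1 hDb hsum hD0 hM').1]
  refine periodic_sum_le h0 h1 hN hDb hsum hD0 (fun k => ?_) hM'
  rw [hD, hD]
  have a1 := hper (j + 1 + k)
  have a2 := hper (j - (k + N))
  rw [show j - ((k : ℤ) + N) + N = j - k by ring] at a2
  push_cast
  rw [← add_assoc, a1, a2]

theorem le_center_abs (h0 : 0 < θ) (h1 : θ < 1 / 9) (hy : ∀ i, y i = 0 ∨ y i = 1)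
    (hne : y (j + 1) ≠ y j) {n : ℕ} (hn : 1 ≤ n)
    (hsym : ∀ k : ℤ, 1 ≤ k → k < n → y (j + 1 + k) = y (j - k))
    (hs : HasSum (fun i : ℕ => ((y (j + 1 + i) - y (j - i) : ℤ) : ℝ) * θ ^ i) s) :
    1 - θ ^ n / (1 - θ) ≤ |s| := by
  obtain ⟨D, s', hs', hsum, hD0, hDb, hD⟩ := exists_signed_center hy hne hs
  rw [← hs']
  refine le_trans ?_ (le_abs_self s')
  refine (lex_sum_bounds h0 h1 hDb hsum hD0 hn fun k h2 h3 => ?_).1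
  rw [hD, hsym k (by omega) (by omega)]
  simp

theorem center_abs_eq (h0 : 0 < θ) (h1 : θ < 1 / 9) (hy : ∀ i, y i = 0 ∨ y i = 1)
    (hne : y (j + 1) ≠ y j) {N : ℕ} (hN : 2 ≤ N) (hper : ∀ i, y (i + N) = y i)
    (hsym : ∀ k : ℤ, 1 ≤ k → k ≤ N - 2 → y (j + 1 + k) = y (j - k))
    (hs : HasSum (fun i : ℕ => ((y (j + 1 + i) - y (j - i) : ℤ) : ℝ) * θ ^ i) s) :
    |s| = (1 - θ ^ (N - 1)) / (1 - θ ^ N) := by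
  obtain ⟨D, s', hs', hsum, hD0, hDb, hD⟩ := exists_signed_center hy hne hs
  have := periodic_sum_eq h0 (by linarith) hN hsum hD0 (fun k => ?_) (fun k h2 h3 => ?_) ?_
  · rw [← hs', this, abs_of_nonneg]
    have h2 : θ ^ (N - 1) < 1 := pow_lt_one₀ h0.le (by linarith) (by omega)
    have h3 : θ ^ N < 1 := pow_lt_one₀ h0.le (by linarith) (by omega)
    exact div_nonneg (by linarith) (by linarith)
  · rw [hD, hD]
    have a1 := hper (j + 1 + k)
    have a2 := hper (j - (k + N))
    rw [show j - ((k : ℤ) + N) + N = j - k by ring] at a2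
    push_cast
    rw [← add_assoc, a1, a2]
  · rw [hD, hsym k (by omega) (by omega)]
    simp
  -- Periodicity makes the coefficient at N - 1 the change of letters in reverse order, hence -1
  -- after normalization.
  · have a1 := hper j
    have a2 := hper (j - (N - 1 : ℕ))
    rw [show j - ((N - 1 : ℕ) : ℤ) + N = j + 1 by omega] at a2
    have a3 := hD 0
    rw [hD0] at a3
    simp only [Nat.cast_zero, add_zero, sub_zero] at a3
    rw [hD, ← a2, show j + 1 + ((N - 1 : ℕ) : ℤ) = j + N by omega, a1]
    linarith

/-- Only changes of letters matter: at an even position without a change the value is at most α⁻²,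
and the odd positions are covered by `eval_odd_le`. -/
theorem eval_le_of_centers {α C : ℝ} (hα : 3.3 ≤ α) {t : ℤ → ℤ} {e : ℤ}
    (hy : ∀ i, y i = 0 ∨ y i = 1)
    (ht : ∀ j, t (2 * j + e) = y (j + 1) - y j) (ht0 : ∀ j, t (2 * j + e + 1) = 0)
    (hC : (1 - α⁻¹ ^ 2) / (1 + α⁻¹ ^ 2) ≤ C)
    (hcent : ∀ j s, y (j + 1) ≠ y j →
      HasSum (fun i : ℕ => ((y (j + 1 + i) - y (j - i) : ℤ) : ℝ) * (α⁻¹ ^ 2) ^ i) s →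
      (1 - α⁻¹ ^ 2) * |s| ≤ C) (n : ℤ) : |evalWord α (fun l => t (n + l))| ≤ C := by
  have hρ0 : 0 < α⁻¹ := by positivity
  have hρ1 : α⁻¹ ≤ 10 / 33 := by
    rw [inv_le_comm₀ (by linarith) (by norm_num)]; norm_num at *; linarith
  have hθ : α⁻¹ ^ 2 < 1 / 9 := by nlinarith
  have hθ0 : 0 < α⁻¹ ^ 2 := by positivity
  rcases Int.even_or_odd' (n - e) with ⟨r, hr | hr⟩
  · obtain rfl : n = 2 * r + e := by omega
    obtain ⟨s, hs, hE⟩ := eval_even (by linarith : 1 < α) hy ht ht0 r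
    rw [hE, abs_mul, abs_of_pos (by linarith)]
    by_cases hne : y (r + 1) = y r
    · have h := abs_sub_partial_le hθ0 (by linarith) hs 1 (D := 1)
        (fun l _ => by exact_mod_cast binary_diff_abs_le hy _ _)
      simp only [Finset.sum_range_one, Nat.cast_zero, add_zero, sub_zero, hne, sub_self,
        Int.cast_zero, zero_mul, pow_one, one_mul] at h
      refine le_trans ?_ hC
      calc (1 - α⁻¹ ^ 2) * |s| ≤ (1 - α⁻¹ ^ 2) * (α⁻¹ ^ 2 / (1 - α⁻¹ ^ 2)) :=
            mul_le_mul_of_nonneg_left h (by linarith)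
        _ = α⁻¹ ^ 2 := mul_div_cancel₀ _ (by linarith)
        _ ≤ _ := by rw [le_div_iff₀ (by linarith)]; nlinarith
    · exact hcent r s hne hs
  · obtain rfl : n = 2 * r + e + 1 := by omega
    refine (eval_odd_le hα (diff_word_abs_le hy ht ht0) (ht0 r) ?_ ?_).trans hC
    · have := ht0 (r + 1)
      rwa [show 2 * (r + 1) + e + 1 = 2 * r + e + 1 + 2 by ring] at this
    · have := ht0 (r - 1)
      rwa [show 2 * (r - 1) + e + 1 = 2 * r + e + 1 - 2 by ring] at this

end

theorem inv_sq_bounds {α : ℝ} (hα : 3.3 ≤ α) : 0 < α⁻¹ ^ 2 ∧ α⁻¹ ^ 2 < 1 / 9 := by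
  have hρ0 : 0 < α⁻¹ := by positivity
  have hρ1 : α⁻¹ ≤ 10 / 33 := by
    rw [inv_le_comm₀ (by linarith) (by norm_num)]; norm_num at *; linarith
  exact ⟨by positivity, by nlinarith⟩

theorem IsBalancedDiff.abs_eval_le {α : ℝ} (hα : 3.3 ≤ α) {t : ℤ → ℤ} (ht : IsBalancedDiff t)
    (n : ℤ) : |evalWord α (fun l => t (n + l))| ≤ 1 - α⁻¹ ^ 2 := by
  obtain ⟨e, S, y, hS, hB, h1, h2⟩ := ht
  obtain ⟨hθ0, hθ⟩ := inv_sq_bounds hα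
  refine eval_le_of_centers hα hS.bin h1 h2 ?_ (fun j s hne hs => ?_) n
  · rw [div_le_iff₀ (by linarith)]; nlinarith
  · have := center_abs_le hθ0 hθ hS.bin (hB.markoffProp hS) hne hs
    nlinarith

/-- The largest value of a balanced difference word with minimal period `2 N`. -/
noncomputable def maxValue (α : ℝ) (N : ℕ) : ℝ :=
  (1 - α⁻¹ ^ 2) * ((1 - (α⁻¹ ^ 2) ^ (N - 1)) / (1 - (α⁻¹ ^ 2) ^ N))

theorem maxValue_spec_of_mech {α : ℝ} (hα : 3.3 ≤ α) {t : ℤ → ℤ} {e p r : ℤ} {N : ℕ}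
    (hN : 0 < N) (hp : 0 ≤ p) (hpN : 2 * p ≤ N) (hcop : IsCoprime p N)
    (ht : ∀ j, t (2 * j + e) = mechWord p N r (j + 1) - mechWord p N r j)
    (ht0 : ∀ j, t (2 * j + e + 1) = 0) :
    (∀ n, |evalWord α (fun l => t (n + l))| ≤ maxValue α N) ∧
      ∃ n, |evalWord α (fun l => t (n + l))| = maxValue α N := by
  obtain ⟨hθ0, hθ⟩ := inv_sq_bounds hα
  have hN' : (0 : ℤ) < N := by exact_mod_cast hN
  have hS := mechSum_isBinarySum hN' hp (by omega) r
  have hB := mechSum_balanced (p := p) hN' r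
  rcases hp.eq_or_lt with rfl | hp0
  -- Slope 0 in lowest terms is 0/1: the word is zero, and `maxValue α 1` is 0.
  · have hN1 : N = 1 := by
      have := isCoprime_zero_left.1 hcop
      have := Int.isUnit_iff.1 this
      omega
    subst hN1
    have hz : ∀ n, t n = 0 := by
      intro n
      rcases Int.even_or_odd' (n - e) with ⟨r, hr | hr⟩
      · rw [show n = 2 * r + e by omega, ht]; simp [mechWord, mechSum]
      · rw [show n = 2 * r + e + 1 by omega, ht0]
    simp [hz, evalWord, maxValue]
  have hN2 : 2 ≤ N := by omega
  constructor
  · refine eval_le_of_centers hα hS.bin ht ht0 ?_ fun j s hne hs => ?_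
    · have h1 : (α⁻¹ ^ 2) ^ (N - 1) ≤ α⁻¹ ^ 2 := pow_le_of_le_one hθ0.le (by linarith) (by omega)
      have h2 : (α⁻¹ ^ 2) ^ N < 1 := pow_lt_one₀ hθ0.le (by linarith) (by omega)
      have h3 : (α⁻¹ ^ 2) ^ N = (α⁻¹ ^ 2) ^ (N - 1) * α⁻¹ ^ 2 := by
        rw [← pow_succ, Nat.sub_add_cancel (by omega)]
      rw [maxValue, div_eq_mul_one_div]
      refine mul_le_mul_of_nonneg_left ?_ (by linarith)
      rw [div_le_div_iff₀ (by linarith) (by linarith), h3]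
      nlinarith
    · refine mul_le_mul_of_nonneg_left ?_ (by linarith)
      exact center_abs_le_periodic hθ0 hθ hS.bin (hB.markoffProp hS) hne hN2
        (mechWord_periodic hN' p r) hs
  · obtain ⟨j, h1, h2, h3⟩ := mechWord_exists_center hp0 (by omega) hcop r
    obtain ⟨s, hs, hE⟩ := eval_even (by linarith : 1 < α) hS.bin ht ht0 j
    refine ⟨2 * j + e, ?_⟩
    rw [hE, abs_mul, abs_of_pos (by linarith), maxValue]
    congr 1
    exact center_abs_eq hθ0 hθ hS.bin (by omega) hN2 (mechWord_periodic hN' p r) h3 hs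

/-- A balanced difference word that is not periodic has shifts of nearly maximal value. -/
theorem IsBalancedDiff.exists_large_eval {α : ℝ} (hα : 3.3 ≤ α) {t : ℤ → ℤ}
    (ht : IsBalancedDiff t) {n : ℕ} (hn : 1 ≤ n)
    (hper : ¬ ∀ x, t (x + 2 * ((2 ^ n).factorial : ℕ)) = t x) :
    ∃ m, (1 - α⁻¹ ^ 2) * (1 - (α⁻¹ ^ 2) ^ n / (1 - α⁻¹ ^ 2)) ≤
      |evalWord α (fun l => t (m + l))| := by
  obtain ⟨e, S, y, hS, hB, h1, h2⟩ := ht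
  obtain ⟨hθ0, hθ⟩ := inv_sq_bounds hα
  obtain ⟨j, h3, h4⟩ := hB.exists_center hS hn (fun hy => hper fun x => by
    generalize (2 ^ n).factorial = F at hy ⊢
    rcases Int.even_or_odd' (x - e) with ⟨r, hr | hr⟩
    · rw [show x = 2 * r + e by omega, h1,
        show 2 * r + e + 2 * (F : ℤ) =
          2 * (r + F) + e by ring, h1, hy,
        show r + (F : ℤ) + 1 = r + 1 + F by ring, hy]
    · rw [show x = 2 * r + e + 1 by omega, h2,
        show 2 * r + e + 1 + 2 * (F : ℤ) =
          2 * (r + F) + e + 1 by ring, h2])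
  obtain ⟨s, hs, hE⟩ := eval_even (by linarith : 1 < α) hS.bin h1 h2 j
  refine ⟨2 * j + e, ?_⟩
  rw [hE, abs_mul, abs_of_pos (by linarith : 0 < 1 - α⁻¹ ^ 2)]
  exact mul_le_mul_of_nonneg_left (le_center_abs hθ0 hθ hS.bin h3 hn h4 hs) (by linarith)

/-! ### Limit words -/

/-- `t` is the limit of the shifts of `s` along the ultrafilter `U`. -/
def IsLimitWord (U : Ultrafilter ℕ) (s : ℕ → ℤ) (t : ℤ → ℤ) : Prop :=
  ∀ j : ℤ, ∀ᶠ n : ℕ in (U : Filter ℕ), rightWord s (n + j) = t j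

theorem rightWord_abs_le {s : ℕ → ℤ} {B : ℤ} (hs : ∀ n, |s n| ≤ B) (j : ℤ) :
    |rightWord s j| ≤ B := by
  unfold rightWord
  split_ifs
  · exact hs _
  · simpa using (abs_nonneg _).trans (hs 0)

theorem rightWord_natCast (s : ℕ → ℤ) (n : ℕ) (j : ℤ) (h : 1 ≤ n + j) :
    rightWord s (n + j) = s (n + j - 1).toNat := by
  rw [rightWord, if_pos h]

theorem exists_limitWord {s : ℕ → ℤ} {B : ℤ} (hs : ∀ n, |s n| ≤ B) (U : Ultrafilter ℕ) :
    ∃ t, IsLimitWord U s t := by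
  have : ∀ j : ℤ, ∃ a, ∀ᶠ n : ℕ in (U : Filter ℕ), rightWord s (n + j) = a := by
    intro j
    have hfin : (Set.Icc (-B) B).Finite := Set.finite_Icc _ _
    have hmem : Set.Icc (-B) B ∈ U.map fun n : ℕ => rightWord s (n + j) := by
      rw [Ultrafilter.mem_map]
      filter_upwards with n
      exact abs_le.1 (rightWord_abs_le hs _)
    obtain ⟨a, -, ha⟩ := Ultrafilter.eq_pure_of_finite_mem hfin hmem
    refine ⟨a, ?_⟩
    have h1 : {a} ∈ U.map fun n : ℕ => rightWord s (n + j) := by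
      rw [ha]; exact Set.mem_singleton a
    exact h1
  choose t ht using this
  exact ⟨t, ht⟩

theorem eventually_natCast_add_ge {U : Ultrafilter ℕ} (hU : (U : Filter ℕ) ≤ atTop) (m c : ℤ) :
    ∀ᶠ n : ℕ in (U : Filter ℕ), c ≤ (n : ℤ) + m :=
  hU <| (eventually_ge_atTop (c - m).toNat).mono fun n hn => by omega

/-- Limit words are closed under shifts. -/
theorem IsLimitWord.shift {U : Ultrafilter ℕ} (hU : (U : Filter ℕ) ≤ atTop) {s : ℕ → ℤ}
    {t : ℤ → ℤ} (h : IsLimitWord U s t) (m : ℤ) :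
    ∃ U' : Ultrafilter ℕ, (U' : Filter ℕ) ≤ atTop ∧ IsLimitWord U' s fun j => t (m + j) := by
  refine ⟨U.map fun n : ℕ => (n + m).toNat, ?_, fun j => ?_⟩
  · rw [Ultrafilter.coe_map]
    refine tendsto_atTop.2 fun c => ?_
    filter_upwards [eventually_natCast_add_ge hU m c] with n hn
    omega
  · rw [Ultrafilter.coe_map, eventually_map]
    filter_upwards [h (m + j), eventually_natCast_add_ge hU m 0] with n h1 h2
    rw [← h1]
    congr 1
    omega

theorem IsLimitWord.window {U : Ultrafilter ℕ} {s : ℕ → ℤ} {t : ℤ → ℤ} (h : IsLimitWord U s t)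
    (a : ℤ) (n : ℕ) : ∀ᶠ m : ℕ in (U : Filter ℕ), ∀ l < n, rightWord s (m + (a + l)) = t (a + l) := by
  have : ∀ᶠ m : ℕ in (U : Filter ℕ), ∀ l ∈ Finset.range n,
      rightWord s (m + (a + l)) = t (a + l) :=
    (Finset.eventually_all _).2 fun l _ => h (a + l)
  simpa using this

theorem IsLimitWord.tendsto_eval {U : Ultrafilter ℕ} {s : ℕ → ℤ} {t : ℤ → ℤ}
    (h : IsLimitWord U s t) {B : ℤ} (hs : ∀ n, |s n| ≤ B) {α : ℝ} (hα : 1 < α) :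
    Tendsto (fun n : ℕ => evalWord α fun j => rightWord s (n + j)) U (𝓝 (evalWord α t)) := by
  have hρ1 : α⁻¹ < 1 := inv_lt_one_of_one_lt₀ hα
  have hρ0 : 0 < α⁻¹ := by positivity
  have hB : ∀ j, |(rightWord s j : ℝ)| ≤ B := fun j => by exact_mod_cast rightWord_abs_le hs j
  have lim : ∀ j, Tendsto (fun n : ℕ => (rightWord s (n + j) : ℝ)) U (𝓝 (t j : ℝ)) := by
    intro j
    refine tendsto_const_nhds.congr' ?_
    filter_upwards [h j] with n hn
    rw [hn]
  refine Tendsto.add ?_ ?_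
  · refine tendsto_tsum_of_dominated_convergence (bound := fun k => B * α⁻¹ ^ k)
      ((summable_geometric_of_lt_one hρ0.le hρ1).mul_left _) (fun k => (lim _).mul_const _)
      (Eventually.of_forall fun n k => ?_)
    rw [Real.norm_eq_abs, abs_mul, abs_pow, abs_neg, abs_of_pos hρ0]
    exact mul_le_mul_of_nonneg_right (hB _) (by positivity)
  · refine tendsto_tsum_of_dominated_convergence (bound := fun k => B * α⁻¹ ^ (k + 1))
      (((summable_nat_add_iff 1).2 (summable_geometric_of_lt_one hρ0.le hρ1)).mul_left _)
      (fun k => (lim _).div_const _) (Eventually.of_forall fun n k => ?_)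
    rw [Real.norm_eq_abs, abs_div, div_eq_mul_inv, abs_of_pos (by positivity : 0 < α ^ (k + 1)),
      inv_pow]
    exact mul_le_mul_of_nonneg_right (hB _) (by positivity)

theorem exists_ultrafilter_of_frequently {p : ℕ → Prop} (h : ∃ᶠ n in atTop, p n) :
    ∃ U : Ultrafilter ℕ, (U : Filter ℕ) ≤ atTop ∧ ∀ᶠ n in (U : Filter ℕ), p n := by
  have hne : (atTop ⊓ 𝓟 {n | p n}).NeBot := by
    rw [← frequently_mem_iff_neBot]; exact h
  refine ⟨Ultrafilter.of (atTop ⊓ 𝓟 {n | p n}), (Ultrafilter.of_le _).trans inf_le_left, ?_⟩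
  exact (Ultrafilter.of_le (atTop ⊓ 𝓟 {n | p n})) (mem_inf_of_right (mem_principal_self _))

/-! ### The distance to the nearest integer -/

theorem distInt_le (x : ℝ) (z : ℤ) : distInt x ≤ |x - z| := round_le x z

theorem distInt_nonneg (x : ℝ) : 0 ≤ distInt x := abs_nonneg _

theorem distInt_le_half (x : ℝ) : distInt x ≤ 1 / 2 := abs_sub_round x

theorem distInt_le_add (x y : ℝ) : distInt x ≤ distInt y + |x - y| := by
  have h1 := distInt_le x (round y)
  have h2 := abs_add_le (x - y) (y - round y)
  rw [sub_add_sub_cancel] at h2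
  unfold distInt at *
  linarith

theorem distInt_intCast_add (z : ℤ) (x : ℝ) : distInt (z + x) = distInt x := by
  unfold distInt
  rw [round_intCast_add]
  push_cast
  congr 1
  ring

theorem distInt_eq_abs {x : ℝ} (hx : |x| < 1 / 2) : distInt x = |x| := by
  have : round x = 0 := by
    rw [round_eq_zero_iff]
    have := abs_lt.1 hx
    exact ⟨this.1.le, this.2⟩
  simp [distInt, this]

theorem limsupDist_le {α ξ c : ℝ}
    (h : ∀ ε > 0, ∀ᶠ n : ℕ in atTop, distInt (ξ * α ^ n) ≤ c + ε) : limsupDist α ξ ≤ c := by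
  refine le_of_forall_pos_le_add fun ε hε => ?_
  refine limsup_le_of_le ⟨0, fun a ha => ?_⟩ (h ε hε)
  obtain ⟨n, hn⟩ := (eventually_map.1 ha).exists
  exact (distInt_nonneg _).trans hn

theorem le_limsupDist {α ξ c : ℝ}
    (h : ∀ ε > 0, ∃ᶠ n : ℕ in atTop, c - ε ≤ distInt (ξ * α ^ n)) : c ≤ limsupDist α ξ := by
  refine le_of_forall_pos_le_add fun ε hε => ?_
  have : c - ε ≤ limsupDist α ξ := by
    refine le_limsup_of_frequently_le (h ε hε) ⟨1 / 2, ?_⟩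
    rw [eventually_map]
    exact Eventually.of_forall fun n => distInt_le_half _
  linarith

theorem eventually_distInt_lt {α ξ c : ℝ} (h : limsupDist α ξ < c) :
    ∀ᶠ n : ℕ in atTop, distInt (ξ * α ^ n) < c := by
  refine eventually_lt_of_limsup_lt h ⟨1 / 2, ?_⟩
  rw [eventually_map]
  exact Eventually.of_forall fun n => distInt_le_half _

/-! ### From words to numbers -/

theorem alpha_sub_inv {α : ℝ} {b : ℕ} (hα : 3 < α) (hroot : α ^ 2 - b * α - 1 = 0) :
    (b : ℝ) = α - α⁻¹ := by
  have : α ≠ 0 := by linarith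
  field_simp
  linarith

/-- Integrality of b sharpens the hypothesis: b = α - α⁻¹ > 8/3 gives b ≥ 3, so α is at least (3 +
√13)/2 > 3.3. -/
theorem alpha_ge {α : ℝ} {b : ℕ} (hα : 3 < α) (hroot : α ^ 2 - b * α - 1 = 0) : 3.3 ≤ α := by
  have hb : 3 ≤ b := by
    by_contra h
    have : (b : ℝ) ≤ 2 := by exact_mod_cast (by omega : b ≤ 2)
    nlinarith
  have hb' : (3 : ℝ) ≤ b := by exact_mod_cast hb
  by_contra h
  push Not at h
  nlinarith

/-- The integers z are the Lucas numbers Uₙ with Uₙ₊₂ = b Uₙ₊₁ + Uₙ. -/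
theorem exists_int_lucas {α : ℝ} {b : ℕ} (hα : 3 < α) (hroot : α ^ 2 - b * α - 1 = 0) (n : ℕ) :
    ∃ z : ℤ, α ^ n - (-α⁻¹) ^ n = (α + α⁻¹) * z := by
  have hb := alpha_sub_inv hα hroot
  have h0 : α ≠ 0 := by linarith
  have h1 : α * α⁻¹ = 1 := mul_inv_cancel₀ h0
  induction n using Nat.twoStepInduction with
  | zero => exact ⟨0, by simp⟩
  | one => exact ⟨1, by simp⟩
  | more n h2 h3 =>
    obtain ⟨z, hz⟩ := h2
    obtain ⟨w, hw⟩ := h3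
    refine ⟨b * w + z, ?_⟩
    push_cast
    rw [mul_add, ← hz, mul_left_comm, ← hw, hb]
    linear_combination (α ^ n - (-α⁻¹) ^ n) * h1

theorem mem_adjoin_iff {α : ℝ} {b : ℕ} (hroot : α ^ 2 - b * α - 1 = 0) (z : ℝ) :
    z ∈ Algebra.adjoin ℤ ({α} : Set ℝ) ↔ ∃ c d : ℤ, z = c + d * α := by
  constructor
  · intro hz
    induction hz using Algebra.adjoin_induction with
    | mem x hx => exact ⟨0, 1, by rw [Set.mem_singleton_iff.1 hx]; simp⟩
    | algebraMap r => exact ⟨r, 0, by simp⟩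
    | add x y _ _ hx hy =>
      obtain ⟨c, d, rfl⟩ := hx
      obtain ⟨c', d', rfl⟩ := hy
      exact ⟨c + c', d + d', by push_cast; ring⟩
    | mul x y _ _ hx hy =>
      obtain ⟨c, d, rfl⟩ := hx
      obtain ⟨c', d', rfl⟩ := hy
      refine ⟨c * c' + d * d', c * d' + d * c' + d * d' * b, ?_⟩
      push_cast
      linear_combination (d * d' : ℝ) * hroot
  · rintro ⟨c, d, rfl⟩
    have h1 : (c : ℝ) ∈ Algebra.adjoin ℤ ({α} : Set ℝ) :=
      Subalgebra.algebraMap_mem (Algebra.adjoin ℤ ({α} : Set ℝ)) c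
    have h2 : (d : ℝ) ∈ Algebra.adjoin ℤ ({α} : Set ℝ) :=
      Subalgebra.algebraMap_mem (Algebra.adjoin ℤ ({α} : Set ℝ)) d
    exact add_mem h1 (mul_mem h2 (Algebra.subset_adjoin rfl))

theorem lattice_iff {α : ℝ} {b : ℕ} (hroot : α ^ 2 - b * α - 1 = 0) (x : ℝ) :
    x ∈ lattice α (-α⁻¹) ↔ ∃ c d : ℤ, x = (c + d * α) / (α + α⁻¹) := by
  simp only [lattice, Set.mem_ofPred_eq, sub_neg_eq_add]
  constructor
  · rintro ⟨z, hz, rfl⟩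
    obtain ⟨c, d, rfl⟩ := (mem_adjoin_iff hroot z).1 hz
    exact ⟨c, d, rfl⟩
  · rintro ⟨c, d, rfl⟩
    exact ⟨_, (mem_adjoin_iff hroot _).2 ⟨c, d, rfl⟩, rfl⟩

/-! ### Multiplication by powers of α of coded numbers and of lattice points -/

/-- The right half of the value of a word. -/
noncomputable def rightEval (α : ℝ) (t : ℤ → ℤ) : ℝ :=
  ∑' k : ℕ, (t ((k : ℤ) + 1) : ℝ) / α ^ (k + 1)

/-- The left half of the value of a word, including the letter at `0`. -/
noncomputable def leftEval (α : ℝ) (t : ℤ → ℤ) : ℝ := ∑' k : ℕ, (t (-(k : ℤ)) : ℝ) * (-α⁻¹) ^ k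

theorem summable_right {α : ℝ} (hα : 1 < α) {f : ℕ → ℝ} {B : ℝ} (hf : ∀ k, |f k| ≤ B) :
    Summable fun k : ℕ => f k / α ^ (k + 1) := by
  have hρ1 : α⁻¹ < 1 := inv_lt_one_of_one_lt₀ hα
  have hρ0 : 0 < α⁻¹ := by positivity
  refine ((summable_bounded_mul_pow (by rwa [abs_of_pos hρ0]) hf).mul_right α⁻¹).congr fun k => ?_
  rw [div_eq_mul_inv, ← inv_pow, pow_succ, mul_assoc]

theorem summable_left {α : ℝ} (hα : 1 < α) {f : ℕ → ℝ} {B : ℝ} (hf : ∀ k, |f k| ≤ B) :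
    Summable fun k : ℕ => f k * (-α⁻¹) ^ k := by
  refine summable_bounded_mul_pow ?_ hf
  rw [abs_neg, abs_of_pos (by positivity)]
  exact inv_lt_one_of_one_lt₀ hα

theorem rightEval_shift {α : ℝ} (hα : 1 < α) {t : ℤ → ℤ} {B : ℤ} (ht : ∀ n, |t n| ≤ B) (n : ℤ) :
    rightEval α (fun j => t (n + 1 + j)) = α * rightEval α (fun j => t (n + j)) - t (n + 1) := by
  have hB : ∀ j, |(t j : ℝ)| ≤ B := fun j => by exact_mod_cast ht j
  have h0 : α ≠ 0 := by linarith
  have hs : Summable fun k : ℕ => (t (n + ((k : ℤ) + 1)) : ℝ) / α ^ (k + 1) :=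
    summable_right hα fun k => hB _
  unfold rightEval
  rw [hs.tsum_eq_zero_add, mul_add, ← tsum_mul_left]
  have e0 : α * ((t (n + (((0 : ℕ) : ℤ) + 1)) : ℝ) / α ^ (0 + 1)) = t (n + 1) := by
    simp only [Nat.cast_zero, zero_add, pow_one]
    field_simp
  rw [e0, add_sub_cancel_left]
  refine tsum_congr fun k => ?_
  simp only
  rw [show n + 1 + ((k : ℤ) + 1) = n + ((k + 1 : ℕ) + 1 : ℤ) by push_cast; ring]
  field_simp
  ring

theorem leftEval_shift {α : ℝ} (hα : 1 < α) {t : ℤ → ℤ} {B : ℤ} (ht : ∀ n, |t n| ≤ B) (n : ℤ) :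
    leftEval α (fun j => t (n + 1 + j)) = t (n + 1) - α⁻¹ * leftEval α (fun j => t (n + j)) := by
  have hB : ∀ j, |(t j : ℝ)| ≤ B := fun j => by exact_mod_cast ht j
  have hs : Summable fun k : ℕ => (t (n + 1 + -(k : ℤ)) : ℝ) * (-α⁻¹) ^ k :=
    summable_left hα fun k => hB _
  unfold leftEval
  rw [hs.tsum_eq_zero_add, ← tsum_mul_left, sub_eq_add_neg, ← tsum_neg]
  congr 1
  · simp
  · refine tsum_congr fun k => ?_
    rw [show n + 1 + -((k + 1 : ℕ) : ℤ) = n + -(k : ℤ) by push_cast; ring, pow_succ]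
    ring

theorem leftEval_rightWord (α : ℝ) (s : ℕ → ℤ) : leftEval α (rightWord s) = 0 := by
  have : ∀ k : ℕ, rightWord s (-(k : ℤ)) = 0 := fun k => by rw [rightWord, if_neg (by omega)]
  simp [leftEval, this]

theorem evalWord_split (α : ℝ) (t : ℤ → ℤ) : evalWord α t = leftEval α t + rightEval α t := rfl

/-- Adding the conjugate left half replaces each power of α that multiplies a letter already passed
by a Lucas number, so only the value of the shifted word survives modulo integers. -/
theorem realize_mul_pow {α : ℝ} {b : ℕ} (hα : 3 < α) (hroot : α ^ 2 - b * α - 1 = 0)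
    {s : ℕ → ℤ} {B : ℤ} (hs : ∀ n, |s n| ≤ B) (n : ℕ) :
    ∃ z : ℤ, realize α (-α⁻¹) (rightWord s) * α ^ n =
      z + evalWord α (fun j => rightWord s (n + j)) / (α + α⁻¹) := by
  have hb := alpha_sub_inv hα hroot
  have h0 : α ≠ 0 := by linarith
  have h1 : α * α⁻¹ = 1 := mul_inv_cancel₀ h0
  have hpos : 0 < α + α⁻¹ := by positivity
  have hrw := rightWord_abs_le hs
  -- The integer z is the sum of the letters passed weighted by Lucas numbers. The second equation,
  -- with z' the next such sum before its new letter, is what closes the induction.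
  have key : ∃ z z' : ℤ, rightEval α (rightWord s) * α ^ n -
        rightEval α (fun j => rightWord s (n + j)) - leftEval α (fun j => rightWord s (n + j)) =
        (α + α⁻¹) * z ∧ α * z + leftEval α (fun j => rightWord s (n + j)) = z' := by
    induction n with
    | zero => exact ⟨0, 0, by simp [leftEval_rightWord], by simp [leftEval_rightWord]⟩
    | succ n ih =>
      obtain ⟨z, z', h2, h3⟩ := ih
      have e1 := rightEval_shift (by linarith : 1 < α) hrw n
      have e2 := leftEval_shift (by linarith : 1 < α) hrw n
      push_cast
      rw [e1, e2]
      generalize rightEval α (fun j => rightWord s (n + j)) = R at *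
      generalize leftEval α (fun j => rightWord s (n + j)) = L at *
      refine ⟨z', b * z' + z + rightWord s (n + 1), ?_, ?_⟩
      · rw [← h3, pow_succ]
        linear_combination α * h2
      · push_cast
        rw [hb]
        linear_combination (z : ℝ) * h1 - α⁻¹ * h3
  obtain ⟨z, -, h2, -⟩ := key
  refine ⟨z, ?_⟩
  have e : evalWord α (rightWord s) = rightEval α (rightWord s) := by
    rw [evalWord_split, leftEval_rightWord, zero_add]
  rw [realize_eq, e, evalWord_split]
  field_simp at h2 ⊢
  linear_combination h2

theorem tendsto_neg_inv_pow {α : ℝ} (hα : 3 < α) :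
    Tendsto (fun n : ℕ => (-α⁻¹) ^ n) atTop (𝓝 0) := by
  refine tendsto_pow_atTop_nhds_zero_of_abs_lt_one ?_
  rw [abs_neg, abs_of_pos (by positivity)]
  exact inv_lt_one_of_one_lt₀ (by linarith)

/-- Subtracting the conjugate numerator makes the quotient an integer, and the powers of the
conjugate tend to 0. -/
theorem lattice_mul_pow {α : ℝ} {b : ℕ} (hα : 3 < α) (hroot : α ^ 2 - b * α - 1 = 0) {x : ℝ}
    (hx : x ∈ lattice α (-α⁻¹)) :
    ∃ δ : ℕ → ℝ, Tendsto δ atTop (𝓝 0) ∧ ∀ n : ℕ, ∃ z : ℤ, x * α ^ n = z + δ n := by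
  obtain ⟨c, d, rfl⟩ := (lattice_iff hroot x).1 hx
  have hpos : 0 < α + α⁻¹ := by positivity
  refine ⟨fun n => (c * (-α⁻¹) ^ n + d * (-α⁻¹) ^ (n + 1)) / (α + α⁻¹), ?_, fun n => ?_⟩
  · have h1 := tendsto_neg_inv_pow hα
    have h2 := (tendsto_add_atTop_iff_nat 1).2 h1
    have := ((h1.const_mul (c : ℝ)).add (h2.const_mul (d : ℝ))).div_const (α + α⁻¹)
    simpa using this
  · obtain ⟨z, hz⟩ := exists_int_lucas hα hroot n
    obtain ⟨w, hw⟩ := exists_int_lucas hα hroot (n + 1)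
    refine ⟨c * z + d * w, ?_⟩
    push_cast
    rw [div_mul_eq_mul_div, div_eq_iff hpos.ne', add_mul _ (_ / _), div_mul_cancel₀ _ hpos.ne']
    linear_combination (c : ℝ) * hz + (d : ℝ) * hw

/-! ### The limit superior in terms of limit words -/

theorem dist_eq_eval {α : ℝ} {b : ℕ} (hα : 3 < α) (hroot : α ^ 2 - b * α - 1 = 0)
    {s : ℕ → ℤ} {B : ℤ} (hs : ∀ n, |s n| ≤ B) {x : ℝ} (hx : x ∈ lattice α (-α⁻¹)) :
    ∃ δ : ℕ → ℝ, Tendsto δ atTop (𝓝 0) ∧ ∀ n : ℕ,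
      distInt ((realize α (-α⁻¹) (rightWord s) + x) * α ^ n) =
        distInt (evalWord α (fun j => rightWord s (n + j)) / (α + α⁻¹) + δ n) := by
  obtain ⟨δ, hδ, h⟩ := lattice_mul_pow hα hroot hx
  refine ⟨δ, hδ, fun n => ?_⟩
  obtain ⟨z, hz⟩ := h n
  obtain ⟨w, hw⟩ := realize_mul_pow hα hroot hs n
  rw [add_mul, hz, hw, ← distInt_intCast_add (z + w) (_ / _ + _)]
  congr 1
  push_cast
  ring

/-- If distances above c + ε occurred infinitely often, an ultrafilter concentrated on them would
give a limit word whose value is too large. -/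
theorem limsupDist_le_of_limitWords {α : ℝ} {b : ℕ} (hα : 3 < α)
    (hroot : α ^ 2 - b * α - 1 = 0) {s : ℕ → ℤ} {B : ℤ} (hs : ∀ n, |s n| ≤ B) {x : ℝ}
    (hx : x ∈ lattice α (-α⁻¹)) {c : ℝ}
    (h : ∀ (U : Ultrafilter ℕ) (t : ℤ → ℤ), (U : Filter ℕ) ≤ atTop → IsLimitWord U s t →
      |evalWord α t| ≤ c * (α + α⁻¹)) :
    limsupDist α (realize α (-α⁻¹) (rightWord s) + x) ≤ c := by
  obtain ⟨δ, hδ, hd⟩ := dist_eq_eval hα hroot hs hx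
  have hpos : 0 < α + α⁻¹ := by positivity
  refine limsupDist_le fun ε hε => ?_
  by_contra hcon
  obtain ⟨U, hU, hUp⟩ := exists_ultrafilter_of_frequently (not_eventually.1 hcon)
  obtain ⟨t, ht⟩ := exists_limitWord hs U
  have h1 := (((ht.tendsto_eval hs (by linarith : 1 < α)).div_const (α + α⁻¹)).add
    (hδ.mono_left hU)).abs
  rw [add_zero] at h1
  have h2 : c + ε ≤ |evalWord α t / (α + α⁻¹)| := by
    refine ge_of_tendsto h1 ?_
    filter_upwards [hUp] with n hn
    rw [not_le, hd n] at hn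
    have := distInt_le (evalWord α (fun j => rightWord s (n + j)) / (α + α⁻¹) + δ n) 0
    simp only [Int.cast_zero, sub_zero] at this
    linarith
  have h3 := h U t hU ht
  rw [abs_div, abs_of_pos hpos, le_div_iff₀ hpos] at h2
  nlinarith

/-- Below 1/2 the distance to the nearest integer is the absolute value, so the value of a limit
word is really approached by distances. -/
theorem le_limsupDist_of_limitWord {α : ℝ} {b : ℕ} (hα : 3 < α)
    (hroot : α ^ 2 - b * α - 1 = 0) {s : ℕ → ℤ} {B : ℤ} (hs : ∀ n, |s n| ≤ B) {x : ℝ}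
    (hx : x ∈ lattice α (-α⁻¹)) {U : Ultrafilter ℕ} {t : ℤ → ℤ} (hU : (U : Filter ℕ) ≤ atTop)
    (ht : IsLimitWord U s t) (hlt : |evalWord α t| / (α + α⁻¹) < 1 / 2) :
    |evalWord α t| / (α + α⁻¹) ≤ limsupDist α (realize α (-α⁻¹) (rightWord s) + x) := by
  obtain ⟨δ, hδ, hd⟩ := dist_eq_eval hα hroot hs hx
  have hpos : 0 < α + α⁻¹ := by positivity
  have h1 := ((ht.tendsto_eval hs (by linarith : 1 < α)).div_const (α + α⁻¹)).add
    (hδ.mono_left hU)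
  rw [add_zero] at h1
  have hv : |evalWord α t / (α + α⁻¹)| = |evalWord α t| / (α + α⁻¹) := by
    rw [abs_div, abs_of_pos hpos]
  refine le_limsupDist fun ε hε => ?_
  have h2 : ∀ᶠ n : ℕ in (U : Filter ℕ), |evalWord α t| / (α + α⁻¹) - ε ≤
      distInt ((realize α (-α⁻¹) (rightWord s) + x) * α ^ n) := by
    filter_upwards [h1 (Metric.ball_mem_nhds _ hε)] with n hn
    rw [hd n]
    have h3 := distInt_le_add (evalWord α t / (α + α⁻¹))
      (evalWord α (fun j => rightWord s (n + j)) / (α + α⁻¹) + δ n)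
    rw [distInt_eq_abs (by rwa [hv]), hv] at h3
    have hn' : dist (evalWord α (fun j => rightWord s (n + j)) / (α + α⁻¹) + δ n)
      (evalWord α t / (α + α⁻¹)) < ε := hn
    rw [dist_comm, Real.dist_eq] at hn'
    linarith
  exact (h2.frequently).filter_mono hU

/-! ### From numbers to words -/

theorem hasSum_telescope {g f : ℕ → ℝ} (hf : Summable f) (hg : Tendsto g atTop (𝓝 0))
    (h : ∀ k, f k = g k - g (k + 1)) : ∑' k, f k = g 0 := by
  have h1 := hf.hasSum.tendsto_sum_nat
  have h2 : Tendsto (fun n => ∑ k ∈ Finset.range n, f k) atTop (𝓝 (g 0)) := by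
    have : (fun n => ∑ k ∈ Finset.range n, f k) = fun n => g 0 - g n := by
      funext n
      rw [Finset.sum_congr rfl fun k _ => h k, Finset.sum_range_sub']
    rw [this]
    simpa using hg.const_sub (g 0)
  exact tendsto_nhds_unique h1 h2

theorem tendsto_bounded_mul_pow {f : ℕ → ℝ} {B ρ : ℝ} (hρ : |ρ| < 1) (hf : ∀ k, |f k| ≤ B) :
    Tendsto (fun k => f k * ρ ^ k) atTop (𝓝 0) :=
  (summable_bounded_mul_pow hρ hf).tendsto_atTop_zero

theorem tsum_right_telescope {α : ℝ} {b : ℕ} (hα : 3 < α) (hroot : α ^ 2 - b * α - 1 = 0)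
    {e : ℕ → ℝ} {B : ℝ} (he : ∀ k, |e k| ≤ B) {c : ℕ → ℝ}
    (hc : ∀ k, c k = b * e (k + 1) + e k - e (k + 2)) :
    ∑' k : ℕ, c k / α ^ (k + 1) = e 0 * α⁻¹ + e 1 := by
  have hb := alpha_sub_inv hα hroot
  have h0 : α ≠ 0 := by linarith
  have hρ : |α⁻¹| < 1 := by
    rw [abs_of_pos (by positivity)]; exact inv_lt_one_of_one_lt₀ (by linarith)
  have hcb : ∀ k, |c k| ≤ (b + 2) * B := by
    intro k
    have h1 := he k
    have h2 := he (k + 1)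
    have h3 := he (k + 2)
    rw [abs_le] at *
    have hb0 : (0 : ℝ) ≤ b := by positivity
    rw [hc]
    constructor <;> nlinarith
  have := hasSum_telescope (summable_right (by linarith : 1 < α) hcb)
    (g := fun k => e k * α⁻¹ ^ k * α⁻¹ + e (k + 1) * α⁻¹ ^ k) ?_ fun k => ?_
  · rw [this]; simp
  · have h1 := (tendsto_bounded_mul_pow hρ he).mul_const α⁻¹
    have h2 := tendsto_bounded_mul_pow hρ (fun k => he (k + 1))
    simpa using h1.add h2
  · rw [hc, hb, pow_succ, pow_succ, inv_pow]
    field_simp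
    ring

theorem tsum_left_telescope {α : ℝ} {b : ℕ} (hα : 3 < α) (hroot : α ^ 2 - b * α - 1 = 0)
    {e : ℕ → ℝ} {B : ℝ} (he : ∀ k, |e k| ≤ B) {c : ℕ → ℝ}
    (hc : ∀ k, c k = b * e (k + 1) + e (k + 2) - e k) :
    ∑' k : ℕ, c k * (-α⁻¹) ^ k = α * e 1 - e 0 := by
  have hb := alpha_sub_inv hα hroot
  have h0 : α ≠ 0 := by linarith
  have hρ : |-α⁻¹| < 1 := by
    rw [abs_neg, abs_of_pos (by positivity)]; exact inv_lt_one_of_one_lt₀ (by linarith)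
  have hcb : ∀ k, |c k| ≤ (b + 2) * B := by
    intro k
    have h1 := he k
    have h2 := he (k + 1)
    have h3 := he (k + 2)
    rw [abs_le] at *
    have hb0 : (0 : ℝ) ≤ b := by positivity
    rw [hc]
    constructor <;> nlinarith
  have := hasSum_telescope (summable_left (by linarith : 1 < α) hcb)
    (g := fun k => α * (e (k + 1) * (-α⁻¹) ^ k) - e k * (-α⁻¹) ^ k) ?_ fun k => ?_
  · rw [this]; simp
  · have h1 := tendsto_bounded_mul_pow hρ he
    have h2 := (tendsto_bounded_mul_pow hρ (fun k => he (k + 1))).const_mul α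
    simpa using h2.sub h1
  · rw [hc, hb, pow_succ]
    have h1 : α * α⁻¹ = 1 := mul_inv_cancel₀ h0
    linear_combination (- e (k + 2) * (-α⁻¹) ^ k) * h1

/-- The word t arises from e by the recurrence with characteristic roots α and -α⁻¹. Both half
series therefore telescope, leaving only boundary terms at 0, and those involving e 1 cancel. -/
theorem evalWord_telescope {α : ℝ} {b : ℕ} (hα : 3 < α) (hroot : α ^ 2 - b * α - 1 = 0)
    {e : ℤ → ℝ} {B : ℝ} (he : ∀ k, |e k| ≤ B) {t : ℤ → ℤ}
    (ht : ∀ j, (t j : ℝ) = b * e j + e (j - 1) - e (j + 1)) :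
    evalWord α t = (α + α⁻¹) * e 0 := by
  have h1 := tsum_right_telescope hα hroot (e := fun k : ℕ => e k) (fun k => he _)
    (c := fun k : ℕ => (t (k + 1) : ℝ)) (fun k => by
      rw [ht, show (k : ℤ) + 1 - 1 = k by ring, show (k : ℤ) + 1 + 1 = (k + 2 : ℕ) by push_cast; ring]
      push_cast
      rfl)
  have h2 := tsum_left_telescope hα hroot (e := fun k : ℕ => e (1 - k)) (fun k => he _)
    (c := fun k : ℕ => (t (-(k : ℤ)) : ℝ)) (fun k => by
      rw [ht, show -(k : ℤ) - 1 = 1 - (k + 2 : ℕ) by push_cast; ring,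
        show -(k : ℤ) + 1 = 1 - k by ring, show -(k : ℤ) = 1 - (k + 1 : ℕ) by push_cast; ring])
  rw [evalWord, h1, h2]
  simp
  ring

/-- Every real number is coded by a bounded word; the values of the limit words of the code are
controlled by the limit superior of the number. -/
theorem exists_coding {α : ℝ} {b : ℕ} (hα : 3 < α) (hroot : α ^ 2 - b * α - 1 = 0) (ξ : ℝ) :
    ∃ (s : ℕ → ℤ) (B : ℤ) (x : ℝ), (∀ n, |s n| ≤ B) ∧ x ∈ lattice α (-α⁻¹) ∧
      ξ = realize α (-α⁻¹) (rightWord s) + x ∧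
      ∀ (U : Ultrafilter ℕ) (t : ℤ → ℤ), (U : Filter ℕ) ≤ atTop → IsLimitWord U s t →
        (∀ j, |(t j : ℝ)| ≤ (b + 2) * limsupDist α ξ) ∧
        |evalWord α t| ≤ limsupDist α ξ * (α + α⁻¹) := by
  have hb := alpha_sub_inv hα hroot
  have h0 : α ≠ 0 := by linarith
  have hpos : 0 < α + α⁻¹ := by positivity
  -- The recurrence annihilates ξαⁿ, so applied to the nearest integers it depends only on the
  -- rounding errors ε and is bounded.
  obtain ⟨u, hu⟩ : ∃ u : ℕ → ℤ, u = fun n => round (ξ * α ^ n) := ⟨_, rfl⟩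
  obtain ⟨ε, hε⟩ : ∃ ε : ℕ → ℝ, ε = fun n => ξ * α ^ n - u n := ⟨_, rfl⟩
  obtain ⟨s, hs⟩ : ∃ s : ℕ → ℤ, s = fun n => u (n + 2) - b * u (n + 1) - u n := ⟨_, rfl⟩
  have habs : ∀ n, |ε n| = distInt (ξ * α ^ n) := fun n => by simp only [hε, hu, distInt]
  have hhalf : ∀ n, |ε n| ≤ 1 / 2 := fun n => by rw [habs]; exact distInt_le_half _
  have hsε : ∀ n, (s n : ℝ) = b * ε (n + 1) + ε n - ε (n + 2) := by
    intro n
    simp only [hs, hε]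
    push_cast
    linear_combination (ξ * α ^ n) * hroot
  have hsB : ∀ n, |s n| ≤ b + 2 := by
    intro n
    have h1 := abs_le.1 (hhalf n)
    have h2 := abs_le.1 (hhalf (n + 1))
    have h3 := abs_le.1 (hhalf (n + 2))
    have hb0 : (0 : ℝ) ≤ b := by positivity
    have : |(s n : ℝ)| ≤ b + 2 := by
      rw [hsε, abs_le]
      constructor <;> nlinarith
    exact_mod_cast this
  refine ⟨s, b + 2, (u 0 * α⁻¹ + u 1) / (α + α⁻¹), hsB, ?_, ?_, fun U t hU ht => ?_⟩
  · refine (lattice_iff hroot _).2 ⟨u 1 - b * u 0, u 0, ?_⟩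
    congr 1
    push_cast
    linear_combination (u 0 : ℝ) * hb
  · have h1 := tsum_right_telescope hα hroot hhalf hsε
    have h2 : rightEval α (rightWord s) = ∑' k : ℕ, (s k : ℝ) / α ^ (k + 1) := by
      unfold rightEval
      refine tsum_congr fun k => ?_
      rw [rightWord, if_pos (by omega)]
      simp
    rw [realize_eq, evalWord_split, leftEval_rightWord, zero_add, h2, h1, ← add_div,
      eq_div_iff hpos.ne']
    simp only [hε, pow_zero, pow_one]
    ring
  -- The rounding errors also converge along the ultrafilter, and their limits e are bounded by the
  -- limsup. The limit word is the recurrence applied to e, so its value is (α + α⁻¹) e 0.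
  · have hlim : ∀ j : ℤ, ∃ a : ℝ, Tendsto (fun n : ℕ => ε (n + j).toNat) U (𝓝 a) := by
      intro j
      have hc : IsCompact (Set.Icc (-(1 / 2) : ℝ) (1 / 2)) := isCompact_Icc
      obtain ⟨a, -, ha⟩ := hc.ultrafilter_le_nhds (U.map fun n : ℕ => ε (n + j).toNat) (by
        rw [le_principal_iff]
        exact (Eventually.of_forall fun n => abs_le.1 (hhalf _) :
          ∀ᶠ n : ℕ in (U : Filter ℕ), ε (n + j).toNat ∈ Set.Icc (-(1 / 2) : ℝ) (1 / 2)))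
      exact ⟨a, ha⟩
    choose e he using hlim
    have heb : ∀ j, |e j| ≤ limsupDist α ξ := by
      intro j
      refine le_of_forall_pos_le_add fun η hη => ?_
      refine le_of_tendsto (he j).abs ?_
      have := eventually_distInt_lt (α := α) (ξ := ξ) (c := limsupDist α ξ + η) (by linarith)
      obtain ⟨M, hM⟩ := eventually_atTop.1 this
      filter_upwards [eventually_natCast_add_ge hU j M] with n hn
      rw [habs]
      exact (hM _ (by omega)).le
    have hte : ∀ j, (t j : ℝ) = b * e j + e (j - 1) - e (j + 1) := by
      intro j
      have h1 := (((he j).const_mul (b : ℝ)).add (he (j - 1))).sub (he (j + 1))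
      refine tendsto_nhds_unique (tendsto_const_nhds.congr' ?_) h1
      filter_upwards [ht j, eventually_natCast_add_ge hU j 1] with n h2 h3
      rw [← h2, rightWord_natCast s n j h3, hsε]
      rw [show (n + j - 1).toNat + 1 = (n + j).toNat by omega,
        show (n + j - 1).toNat + 2 = (n + (j + 1)).toNat by omega,
        show (n + j - 1).toNat = (n + (j - 1)).toNat by congr 1; ring]
    constructor
    · intro j
      have h1 := abs_le.1 (heb j)
      have h2 := abs_le.1 (heb (j - 1))
      have h3 := abs_le.1 (heb (j + 1))
      have hb0 : (0 : ℝ) ≤ b := by positivity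
      rw [hte, abs_le]
      constructor <;> nlinarith
    · rw [evalWord_telescope hα hroot heb hte, abs_mul, abs_of_pos hpos, mul_comm]
      exact mul_le_mul_of_nonneg_right (heb 0) hpos.le

/-! ### The values `p n / q n` -/

/-- As b² + 2 = θ + θ⁻¹ with θ = α⁻², the recurrence has the characteristic roots θ and θ⁻¹; the
closed form is multiplied by θᵐ to avoid negative powers. -/
theorem recSeq_num {α : ℝ} {b : ℕ} (hα : 3 < α) (hroot : α ^ 2 - b * α - 1 = 0) (m : ℕ) :
    (recSeq b 0 b m : ℝ) * (α⁻¹ ^ 2) ^ m * (1 - (α⁻¹ ^ 2) ^ 2) =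
      b * α⁻¹ ^ 2 * (1 - (α⁻¹ ^ 2) ^ (2 * m)) := by
  have hb := alpha_sub_inv hα hroot
  have h1 : α * α⁻¹ = 1 := mul_inv_cancel₀ (by linarith)
  have key : ((b : ℝ) ^ 2 + 2) * α⁻¹ ^ 2 = 1 + (α⁻¹ ^ 2) ^ 2 := by
    rw [hb]
    linear_combination (α * α⁻¹ + 1 - 2 * α⁻¹ ^ 2) * h1
  generalize α⁻¹ ^ 2 = θ at *
  induction m using Nat.twoStepInduction with
  | zero => simp [recSeq]
  | one => simp [recSeq]
  | more n h2 h3 =>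
    simp only [recSeq]
    push_cast
    linear_combination (1 + θ ^ 2) * h3 - θ ^ 2 * h2 +
      (recSeq b 0 b (n + 1) : ℝ) * θ ^ (n + 1) * (1 - θ ^ 2) * key

theorem recSeq_den {α : ℝ} {b : ℕ} (hα : 3 < α) (hroot : α ^ 2 - b * α - 1 = 0) (m : ℕ) :
    (recSeq b 1 ((b : ℤ) ^ 2 + 3) m : ℝ) * (α⁻¹ ^ 2) ^ m * (1 - α⁻¹ ^ 2) =
      1 - (α⁻¹ ^ 2) ^ (2 * m + 1) := by
  have hb := alpha_sub_inv hα hroot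
  have h1 : α * α⁻¹ = 1 := mul_inv_cancel₀ (by linarith)
  have key : ((b : ℝ) ^ 2 + 2) * α⁻¹ ^ 2 = 1 + (α⁻¹ ^ 2) ^ 2 := by
    rw [hb]
    linear_combination (α * α⁻¹ + 1 - 2 * α⁻¹ ^ 2) * h1
  generalize α⁻¹ ^ 2 = θ at *
  induction m using Nat.twoStepInduction with
  | zero => simp [recSeq]
  | one =>
    simp only [recSeq]
    push_cast
    linear_combination (1 - θ) * key
  | more n h2 h3 =>
    simp only [recSeq]
    push_cast
    linear_combination (1 + θ ^ 2) * h3 - θ ^ 2 * h2 +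
      (recSeq b 1 ((b : ℤ) ^ 2 + 3) (n + 1) : ℝ) * θ ^ (n + 1) * (1 - θ) * key

theorem top_mul {α : ℝ} {b : ℕ} (hα : 3 < α) (hroot : α ^ 2 - b * α - 1 = 0) :
    (b : ℝ) / (1 + α ^ 2) * (α + α⁻¹) = 1 - α⁻¹ ^ 2 := by
  have h0 : α ≠ 0 := by linarith
  have : 1 + α ^ 2 ≠ 0 := by positivity
  rw [alpha_sub_inv hα hroot]
  field_simp
  ring

theorem top_eq {α : ℝ} {b : ℕ} (hα : 3 < α) (hroot : α ^ 2 - b * α - 1 = 0) :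
    (b : ℝ) / (1 + α ^ 2) = (1 - α⁻¹ ^ 2) / (α + α⁻¹) := by
  rw [eq_div_iff (by positivity), top_mul hα hroot]

theorem top_lt_half {α : ℝ} {b : ℕ} (hα : 3 < α) (hroot : α ^ 2 - b * α - 1 = 0) :
    (b : ℝ) / (1 + α ^ 2) < 1 / 2 := by
  rw [top_eq hα hroot, div_lt_iff₀ (by positivity)]
  have : 0 < α⁻¹ := by positivity
  nlinarith

/-- This bounds the integer letters of limit words strictly below 2, so they are ternary. -/
theorem top_mul_lt_two {α : ℝ} {b : ℕ} (hα : 3 < α) (hroot : α ^ 2 - b * α - 1 = 0) :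
    (b + 2 : ℝ) * (b / (1 + α ^ 2)) < 2 := by
  have hb := alpha_sub_inv hα hroot
  have : 0 < α⁻¹ := by positivity
  have hb0 : (0 : ℝ) ≤ b := by positivity
  rw [← mul_div_assoc, div_lt_iff₀ (by positivity)]
  nlinarith

theorem maxValue_lt {α : ℝ} (hα : 3.3 ≤ α) {N : ℕ} (hN : 0 < N) :
    maxValue α N < 1 - α⁻¹ ^ 2 := by
  obtain ⟨h0, h1⟩ := inv_sq_bounds hα
  unfold maxValue
  generalize α⁻¹ ^ 2 = θ at *
  have h2 : θ ^ N < 1 := pow_lt_one₀ h0.le (by linarith) hN.ne'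
  have h3 : θ ^ N < θ ^ (N - 1) := pow_lt_pow_right_of_lt_one₀ h0 (by linarith) (by omega)
  have h4 : (1 - θ ^ (N - 1)) / (1 - θ ^ N) < 1 := by
    rw [div_lt_one (by linarith)]; linarith
  nlinarith

/-- Even indices are the closed forms for N = n + 1 odd. For odd indices the sums of two
neighbouring terms have closed forms of the same shape, in which the factor 1 + θ is redistributed.
-/
theorem seq_eq_maxValue {α : ℝ} {b : ℕ} (hα : 3 < α) (hroot : α ^ 2 - b * α - 1 = 0) (n : ℕ) :
    (pSeq b n : ℝ) / (qSeq b n : ℝ) = maxValue α (n + 1) / (α + α⁻¹) := by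
  obtain ⟨h0, h1⟩ := inv_sq_bounds (alpha_ge hα hroot)
  have hpos : 0 < α + α⁻¹ := by positivity
  have htop : (b : ℝ) * α⁻¹ ^ 2 * (α + α⁻¹) = (1 - α⁻¹ ^ 2) * (1 + α⁻¹ ^ 2) := by
    have h0 : α ≠ 0 := by linarith
    rw [alpha_sub_inv hα hroot]
    field_simp
  have hp := recSeq_num hα hroot
  have hq := recSeq_den hα hroot
  rw [maxValue, Nat.add_sub_cancel]
  generalize α⁻¹ ^ 2 = θ at *
  generalize α + α⁻¹ = c at *
  have hθ : ∀ m : ℕ, θ ^ (m + 1) < 1 := fun m => pow_lt_one₀ h0.le (by linarith) (by omega)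
  have hn1 : (0 : ℝ) < 1 - θ ^ (n + 1) := by linarith [hθ n]
  rcases Nat.even_or_odd' n with ⟨m, rfl | rfl⟩
  · have e1 : pSeq b (2 * m) = recSeq b 0 b m := by simp [pSeq, interleave]
    have e2 : qSeq b (2 * m) = recSeq b 1 ((b : ℤ) ^ 2 + 3) m := by simp [qSeq, interleave]
    have p1 := hp m
    have q1 := hq m
    rw [e1, e2]
    have hm : 0 < θ ^ m := by positivity
    have hqpos : (recSeq b 1 ((b : ℤ) ^ 2 + 3) m : ℝ) ≠ 0 := by
      intro h; rw [h] at q1; simp at q1; linarith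
    generalize (recSeq b 1 ((b : ℤ) ^ 2 + 3) m : ℝ) = Q at *
    generalize (recSeq b 0 b m : ℝ) = P at *
    rw [← mul_div_assoc, div_div, div_eq_div_iff hqpos (by positivity), ← q1]
    have h2 : (1 - θ ^ 2) ≠ 0 := by nlinarith
    refine mul_right_cancel₀ h2 ?_
    linear_combination (c * Q * (1 - θ)) * p1 + (1 - θ ^ (2 * m)) * (1 - θ) * Q * htop
  · have hd : (2 * m + 1) / 2 = m := by omega
    have e1 : pSeq b (2 * m + 1) = recSeq b 0 b m + recSeq b 0 b (m + 1) := by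
      simp [pSeq, interleave, hd]
    have e2 : qSeq b (2 * m + 1) =
        recSeq b 1 ((b : ℤ) ^ 2 + 3) m + recSeq b 1 ((b : ℤ) ^ 2 + 3) (m + 1) := by
      simp [qSeq, interleave, hd]
    have p1 : ((pSeq b (2 * m + 1) : ℤ) : ℝ) * θ ^ (m + 1) * (1 - θ) =
        b * θ * (1 - θ ^ (2 * m + 1)) := by
      rw [e1]
      push_cast
      have h2 : (1 + θ) ≠ 0 := by linarith
      refine mul_right_cancel₀ h2 ?_
      linear_combination θ * hp m + hp (m + 1)
    have q1 : ((qSeq b (2 * m + 1) : ℤ) : ℝ) * θ ^ (m + 1) * (1 - θ) =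
        (1 + θ) * (1 - θ ^ (2 * m + 1 + 1)) := by
      rw [e2]
      push_cast
      linear_combination θ * hq m + hq (m + 1)
    have hm : 0 < θ ^ (m + 1) := by positivity
    have hqpos : (qSeq b (2 * m + 1) : ℝ) ≠ 0 := by
      intro h
      rw [h] at q1
      simp only [zero_mul, zero_eq_mul] at q1
      rcases q1 with q1 | q1 <;> linarith
    generalize (qSeq b (2 * m + 1) : ℝ) = Q at *
    generalize (pSeq b (2 * m + 1) : ℝ) = P at *
    rw [← mul_div_assoc, div_div, div_eq_div_iff hqpos (by positivity)]
    have h2 : (θ ^ (m + 1) * (1 - θ) * (1 + θ)) ≠ 0 := by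
      have : 0 < 1 - θ := by linarith
      positivity
    refine mul_right_cancel₀ h2 ?_
    linear_combination ((1 - θ ^ (2 * m + 1 + 1)) * c * (1 + θ)) * p1 +
      (1 - θ ^ (2 * m + 1)) * (1 + θ) * (1 - θ ^ (2 * m + 1 + 1)) * htop -
      (1 - θ) * (1 - θ ^ (2 * m + 1)) * (1 + θ) * q1

theorem maxValue_strictMono {α : ℝ} (hα : 3.3 ≤ α) :
    StrictMono fun n : ℕ => maxValue α (n + 1) := by
  obtain ⟨h0, h1⟩ := inv_sq_bounds hα
  refine strictMono_nat_of_lt_succ fun n => ?_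
  simp only [maxValue, Nat.add_sub_cancel]
  generalize α⁻¹ ^ 2 = θ at *
  have hθ : ∀ m : ℕ, θ ^ (m + 1) < 1 := fun m => pow_lt_one₀ h0.le (by linarith) (by omega)
  refine mul_lt_mul_of_pos_left ?_ (by linarith)
  rw [div_lt_div_iff₀ (by linarith [hθ n]) (by linarith [hθ (n + 1)])]
  have hpos : 0 < θ ^ n := by positivity
  have : 0 < θ ^ n * (1 - θ) ^ 2 := mul_pos hpos (by nlinarith)
  ring_nf at *
  nlinarith

theorem maxValue_tendsto {α : ℝ} (hα : 3.3 ≤ α) :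
    Tendsto (fun n : ℕ => maxValue α (n + 1)) atTop (𝓝 (1 - α⁻¹ ^ 2)) := by
  obtain ⟨h0, h1⟩ := inv_sq_bounds hα
  simp only [maxValue, Nat.add_sub_cancel]
  generalize α⁻¹ ^ 2 = θ at *
  have hp := tendsto_pow_atTop_nhds_zero_of_lt_one h0.le (by linarith : θ < 1)
  have hp' := (tendsto_add_atTop_iff_nat 1).2 hp
  have := ((hp.const_sub 1).div (hp'.const_sub 1) (by simp)).const_mul (1 - θ)
  simpa using this

/-! ### Numbers below the accumulation point -/

theorem exists_balanced_coding {α : ℝ} {b : ℕ} (hα : 3 < α) (hroot : α ^ 2 - b * α - 1 = 0)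
    {ξ : ℝ} (hξ : limsupDist α ξ ≤ b / (1 + α ^ 2)) :
    ∃ (s : ℕ → ℤ) (B : ℤ) (x : ℝ), (∀ n, |s n| ≤ B) ∧ x ∈ lattice α (-α⁻¹) ∧
      ξ = realize α (-α⁻¹) (rightWord s) + x ∧
      ∀ (U : Ultrafilter ℕ) (t : ℤ → ℤ), (U : Filter ℕ) ≤ atTop → IsLimitWord U s t →
        IsBalancedDiff t := by
  obtain ⟨s, B, x, hs, hx, h, hlim⟩ := exists_coding hα hroot ξ
  have hpos : 0 < α + α⁻¹ := by positivity
  refine ⟨s, B, x, hs, hx, h, fun U t hU ht => ?_⟩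
  refine TernaryMarkoff.isBalancedDiff (ternaryMarkoff_of_eval hα (fun j => ?_) fun n => ?_)
  · have h1 := (hlim U t hU ht).1 j
    have h2 : |(t j : ℝ)| < 2 := by
      refine h1.trans_lt (lt_of_le_of_lt ?_ (top_mul_lt_two hα hroot))
      exact mul_le_mul_of_nonneg_left hξ (by positivity)
    have h3 : |t j| < 2 := by exact_mod_cast h2
    omega
  · obtain ⟨U', hU', ht'⟩ := ht.shift hU n
    refine (hlim U' _ hU' ht').2.trans ?_
    rw [← top_mul hα hroot]
    exact mul_le_mul_of_nonneg_right hξ hpos.le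

theorem limsupDist_le_top {α : ℝ} {b : ℕ} (hα : 3 < α) (hroot : α ^ 2 - b * α - 1 = 0)
    {s : ℕ → ℤ} {B : ℤ} (hs : ∀ n, |s n| ≤ B) {x : ℝ} (hx : x ∈ lattice α (-α⁻¹))
    (h : ∀ (U : Ultrafilter ℕ) (t : ℤ → ℤ), (U : Filter ℕ) ≤ atTop → IsLimitWord U s t →
      IsBalancedDiff t) :
    limsupDist α (realize α (-α⁻¹) (rightWord s) + x) ≤ b / (1 + α ^ 2) := by
  refine limsupDist_le_of_limitWords hα hroot hs hx fun U t hU ht => ?_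
  rw [top_mul hα hroot]
  simpa using (h U t hU ht).abs_eval_le (alpha_ge hα hroot) 0

/-- For each n some limit word fails the period 2(2ⁿ⁺¹)!. By `IsBalancedDiff.exists_large_eval` it
has a shift, again a limit word, whose value is within order θⁿ⁺¹ of the top. -/
theorem limsupDist_eq_top {α : ℝ} {b : ℕ} (hα : 3 < α) (hroot : α ^ 2 - b * α - 1 = 0)
    {s : ℕ → ℤ} {B : ℤ} (hs : ∀ n, |s n| ≤ B) {x : ℝ} (hx : x ∈ lattice α (-α⁻¹))
    (h : ∀ (U : Ultrafilter ℕ) (t : ℤ → ℤ), (U : Filter ℕ) ≤ atTop → IsLimitWord U s t →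
      IsBalancedDiff t) (hper : ¬ IsEventuallyPeriodic s) :
    limsupDist α (realize α (-α⁻¹) (rightWord s) + x) = b / (1 + α ^ 2) := by
  refine le_antisymm (limsupDist_le_top hα hroot hs hx h) ?_
  have hα' := alpha_ge hα hroot
  obtain ⟨h0, h1⟩ := inv_sq_bounds hα'
  have hpos : 0 < α + α⁻¹ := by positivity
  have key : ∀ n : ℕ, (1 - α⁻¹ ^ 2) * (1 - (α⁻¹ ^ 2) ^ (n + 1) / (1 - α⁻¹ ^ 2)) / (α + α⁻¹) ≤
      limsupDist α (realize α (-α⁻¹) (rightWord s) + x) := by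
    intro n
    obtain ⟨P, hP⟩ : ∃ P : ℕ, P = 2 * (2 ^ (n + 1)).factorial := ⟨_, rfl⟩
    have hP0 : 0 < P := by rw [hP]; positivity
    -- The ultrafilter is concentrated on places where the period P fails in s, so the failure
    -- persists in the limit word at the index 1.
    have hfreq : ∃ᶠ m in atTop, s (m + P) ≠ s m := by
      rw [frequently_atTop]
      intro M
      by_contra hcon
      push Not at hcon
      exact hper ⟨M, P, hP0, hcon⟩
    obtain ⟨U, hU, hUp⟩ := exists_ultrafilter_of_frequently hfreq
    obtain ⟨t, ht⟩ := exists_limitWord hs U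
    have hne : ¬ ∀ z, t (z + 2 * ((2 ^ (n + 1)).factorial : ℕ)) = t z := by
      intro hall
      have h3 := hall 1
      obtain ⟨m, hm1, hm2, hm3⟩ := (hUp.and ((ht 1).and
        (ht (1 + 2 * ((2 ^ (n + 1)).factorial : ℕ))))).exists
      rw [h3, ← hm2, rightWord_natCast s m _ (by omega), rightWord_natCast s m _ (by omega)] at hm3
      rw [show ((m : ℤ) + 1 - 1).toNat = m by omega] at hm3
      exact hm1 (by rw [← hm3]; congr 1; omega)
    obtain ⟨m, hm⟩ := (h U t hU ht).exists_large_eval hα' (by omega : 1 ≤ n + 1) hne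
    obtain ⟨U', hU', ht'⟩ := ht.shift hU m
    have hle := (h U t hU ht).abs_eval_le hα' m
    have := le_limsupDist_of_limitWord hα hroot hs hx hU' ht' (by
      refine lt_of_le_of_lt ?_ (top_lt_half hα hroot)
      rw [top_eq hα hroot]
      gcongr)
    refine le_trans ?_ this
    gcongr
  have hlim : Tendsto (fun n : ℕ => (1 - α⁻¹ ^ 2) *
      (1 - (α⁻¹ ^ 2) ^ (n + 1) / (1 - α⁻¹ ^ 2)) / (α + α⁻¹)) atTop (𝓝 (b / (1 + α ^ 2))) := by
    rw [top_eq hα hroot]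
    have hp := (tendsto_add_atTop_iff_nat 1).2
      (tendsto_pow_atTop_nhds_zero_of_lt_one h0.le (by linarith : α⁻¹ ^ 2 < 1))
    have := (((hp.div_const (1 - α⁻¹ ^ 2)).const_sub 1).const_mul (1 - α⁻¹ ^ 2)).div_const
      (α + α⁻¹)
    simpa using this
  exact le_of_tendsto' hlim key

/-! ### Periodic words -/

/-- The bi-infinite periodic word with the period word `u`. -/
def biPeriodic (u : List ℤ) (j : ℤ) : ℤ := u.getD (j % u.length).toNat 0

theorem periodicWord_eq (u : List ℤ) (n : ℕ) : periodicWord u n = biPeriodic u n := by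
  rw [periodicWord, biPeriodic, ← Int.natCast_mod, Int.toNat_natCast]

theorem biPeriodic_add (u : List ℤ) (j : ℤ) : biPeriodic u (j + u.length) = biPeriodic u j := by
  rw [biPeriodic, biPeriodic, Int.add_emod_right]

theorem biPeriodic_add_mul (u : List ℤ) (j m : ℤ) :
    biPeriodic u (j + u.length * m) = biPeriodic u j := by
  rw [biPeriodic, biPeriodic, Int.add_mul_emod_self_left]

theorem eq_biPeriodic {t : ℤ → ℤ} {u : List ℤ} {c : ℤ} (hu : 0 < u.length)
    (hw : zwindow t c u.length = u) (ht : ∀ j, t (j + u.length) = t j) (j : ℤ) :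
    t j = biPeriodic u (j - c) := by
  have hL : (0 : ℤ) < u.length := by exact_mod_cast hu
  have h1 := Int.emod_nonneg (j - c) hL.ne'
  have h2 := Int.emod_lt_of_pos (j - c) hL
  have hper : ∀ m : ℤ, ∀ i, t (i + u.length * m) = t i := by
    intro m i
    have := eq_of_step_eq (f := fun m => t (i + u.length * m)) (fun m => by
      rw [show i + (u.length : ℤ) * (m + 1) = i + u.length * m + u.length by ring, ht]) m 0
    simpa using this
  have h3 : t j = t (c + ((j - c) % u.length).toNat) := by
    rw [← hper ((j - c) / u.length) (c + _), Int.toNat_of_nonneg h1, add_assoc,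
      Int.emod_add_mul_ediv, add_sub_cancel]
  have h4 : ((j - c) % u.length).toNat < u.length := by omega
  rw [h3, biPeriodic, ← zwindow_getD t c h4, hw]

theorem biPeriodic_abs_le (u : List (Fin 2)) (j : ℤ) : |biPeriodic (code u) j| ≤ 1 :=
  codeAt_abs_le u _

/-- The bi-infinite word given by a Christoffel word is the derivative of a mechanical word. -/
theorem IsChristoffel.biPeriodic_spec {ν : List (Fin 2)} (h : IsChristoffel ν) {n : ℕ}
    (hn : (code ν).length = 2 * (n + 1)) :
    ∃ p r : ℤ, 0 ≤ p ∧ 2 * p ≤ (n + 1 : ℕ) ∧ IsCoprime p (n + 1 : ℕ) ∧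
      (∀ j, biPeriodic (code ν) (2 * j + 1) =
        mechWord p (n + 1 : ℕ) r (j + 1) - mechWord p (n + 1 : ℕ) r j) ∧
      ∀ j, biPeriodic (code ν) (2 * j + 1 + 1) = 0 := by
  obtain ⟨p, q, r, hq, hpq, hcop, hr, hlen, hlet⟩ := h.exists_mech
  have hq' : (0 : ℤ) < q := by exact_mod_cast hq
  obtain ⟨hc, hcode⟩ := codeAt_mech (p := p) (q := q) (r := r) (by positivity) hq' ν 0
    (fun i hi => by rw [hlet i hi, zero_add])
  rw [hlen, mechSum_add_period hq', hr] at hc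
  have hN : n + 1 = p + q := by rw [code_length] at hn; omega
  have hNz : ((n + 1 : ℕ) : ℤ) = p + q := by rw [hN]; push_cast; rfl
  rw [hNz]
  have hNpos : (0 : ℤ) < p + q := by positivity
  have hL : ((code ν).length : ℤ) = 2 * (p + q) := by rw [hn, ← hNz]; push_cast; ring
  have hpos : ∀ j : ℤ, 0 ≤ j % (p + q) ∧ j % (p + q) < p + q := fun j =>
    ⟨Int.emod_nonneg j hNpos.ne', Int.emod_lt_of_pos j hNpos⟩
  refine ⟨p, r, by positivity, by omega, ?_, fun j => ?_, fun j => ?_⟩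
  · have : IsCoprime (p : ℤ) q := Nat.isCoprime_iff_coprime.2 hcop
    rw [add_comm]
    simpa using this.add_mul_left_right 1
  · obtain ⟨h1, h2⟩ := hpos j
    have hmod : (2 * j + 1) % (2 * (p + q) : ℤ) = 2 * (j % (p + q)) + 1 := by
      have h3 := Int.emod_add_mul_ediv j (p + q)
      rw [Int.emod_def]
      have : (2 * j + 1) / (2 * (p + q) : ℤ) = j / (p + q) := by
        rw [← Int.ediv_ediv_of_nonneg (by norm_num)]
        congr 1
        omega
      rw [this]
      linarith
    have h4 := hcode (j % (p + q)).toNat (by omega)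
    rw [biPeriodic, hL, hmod, show (2 * (j % (p + q : ℤ)) + 1).toNat =
      2 * (j % (p + q : ℤ)).toNat + 1 by omega]
    have h5 : ∀ i : ℤ, mechWord p (p + q) r (i % (p + q)) = mechWord p (p + q) r i ∧
        mechWord p (p + q) r (i % (p + q) + 1) = mechWord p (p + q) r (i + 1) := by
      intro i
      have hm : ∀ x m : ℤ, mechWord p (p + q) r (x + (p + q) * m) = mechWord p (p + q) r x := by
        intro x m
        have := eq_of_step_eq (f := fun m => mechWord p (p + q) r (x + (p + q) * m)) (fun m => by
          rw [show x + (p + q : ℤ) * (m + 1) = x + (p + q) * m + (p + q) by ring,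
            mechWord_periodic hNpos]) m 0
        simpa using this
      have h3 := Int.emod_add_mul_ediv i (p + q)
      constructor
      · rw [← hm _ (i / (p + q)), h3]
      · rw [← hm _ (i / (p + q)), add_right_comm, h3]
    rw [hr, zero_add, zero_add, Int.toNat_of_nonneg h1, (h5 j).1, (h5 j).2] at h4
    exact h4
  · obtain ⟨m, hm⟩ : ∃ m : ℤ, (2 * j + 1 + 1) % (2 * (p + q) : ℤ) = 2 * m :=
      ⟨(j + 1) - (p + q) * ((2 * j + 1 + 1) / (2 * (p + q))), by rw [Int.emod_def]; ring⟩
    have h3 := Int.emod_nonneg (2 * j + 1 + 1) (by omega : (2 * (p + q) : ℤ) ≠ 0)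
    rw [biPeriodic, hL, hm, show (2 * m).toNat = 2 * m.toNat by omega]
    exact codeAt_even ν _

/-- An ultrafilter selects one residue class modulo L; it is read off as a letter of a limit word of
n mod L. -/
theorem exists_residue (U : Ultrafilter ℕ) {L : ℕ} (hL : 0 < L) :
    ∃ c : ℤ, ∀ᶠ n : ℕ in (U : Filter ℕ), ((n % L : ℕ) : ℤ) = c := by
  obtain ⟨t, ht⟩ := exists_limitWord (s := fun n => ((n % L : ℕ) : ℤ)) (B := L) (fun n => by
    have := Nat.mod_lt n hL
    rw [abs_of_nonneg (by positivity)]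
    exact_mod_cast this.le) U
  refine ⟨t 1, (ht 1).mono fun n hn => ?_⟩
  rw [← hn, rightWord, if_pos (by omega), show ((n : ℤ) + 1 - 1).toNat = n by omega]

/-- The limit words of a periodic word are its shifts. -/
theorem IsLimitWord.of_periodic {U : Ultrafilter ℕ} (hU : (U : Filter ℕ) ≤ atTop) {s : ℕ → ℤ}
    {t : ℤ → ℤ} (ht : IsLimitWord U s t) {u : List ℤ} (hu : 0 < u.length) {ε k : ℤ}
    (hs : ∀ j : ℕ, s j = ε * biPeriodic u (j + k)) :
    ∃ c, ∀ j, t j = ε * biPeriodic u (j + c) := by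
  obtain ⟨c, hc⟩ := exists_residue U hu
  refine ⟨c - 1 + k, fun j => ?_⟩
  obtain ⟨n, h1, h2, h3⟩ := (hc.and ((ht j).and (eventually_natCast_add_ge hU j 1))).exists
  rw [← h2, rightWord_natCast s n j h3, hs, Int.toNat_of_nonneg (by omega),
    ← biPeriodic_add_mul u (j + _) ((n / u.length : ℕ) : ℤ)]
  congr 2
  have := Nat.mod_add_div n u.length
  have h4 : (((n % u.length : ℕ) : ℤ)) + u.length * ((n / u.length : ℕ) : ℤ) = n := by
    exact_mod_cast this
  linarith

theorem abs_evalWord_sign {α : ℝ} {ε : ℤ} (hε : ε = 1 ∨ ε = -1) (t : ℤ → ℤ) :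
    |evalWord α fun j => ε * t j| = |evalWord α t| := by
  rcases hε with rfl | rfl
  · simp
  · simp only [neg_mul, one_mul, evalWord_neg, abs_neg]

theorem exists_ultrafilter : ∃ U : Ultrafilter ℕ, (U : Filter ℕ) ≤ atTop :=
  ⟨Ultrafilter.of atTop, Ultrafilter.of_le _⟩

theorem sign_mul_biPeriodic_abs_le {ε : ℤ} (hε : ε = 1 ∨ ε = -1) (u : List (Fin 2)) (j : ℤ) :
    |ε * biPeriodic (code u) j| ≤ 1 := by
  rcases hε with rfl | rfl <;> simpa using biPeriodic_abs_le u j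

/-- All limit words are signed shifts of one periodic word, and shifting the ultrafilter realizes
the shift at which the value is maximal. -/
theorem IsChristoffel.limsupDist_eq {α : ℝ} {b : ℕ} (hα : 3 < α)
    (hroot : α ^ 2 - b * α - 1 = 0) {ν : List (Fin 2)} (h : IsChristoffel ν) {n : ℕ}
    (hn : (code ν).length = 2 * (n + 1)) {ε k : ℤ} (hε : ε = 1 ∨ ε = -1) {x : ℝ}
    (hx : x ∈ lattice α (-α⁻¹)) :
    limsupDist α (realize α (-α⁻¹)
      (rightWord fun j : ℕ => ε * biPeriodic (code ν) (j + k)) + x) =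
      maxValue α (n + 1) / (α + α⁻¹) := by
  obtain ⟨p, r, hp, hpN, hcop, ht, ht0⟩ := h.biPeriodic_spec hn
  have hα' := alpha_ge hα hroot
  have hpos : 0 < α + α⁻¹ := by positivity
  obtain ⟨hle, m, hm⟩ := maxValue_spec_of_mech hα' n.succ_pos hp hpN hcop ht ht0
  have hs : ∀ j : ℕ, |ε * biPeriodic (code ν) (j + k)| ≤ 1 := fun j =>
    sign_mul_biPeriodic_abs_le hε ν _
  have hlen : 0 < (code ν).length := by omega
  refine le_antisymm ?_ ?_
  · refine limsupDist_le_of_limitWords hα hroot hs hx fun U t hU htl => ?_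
    obtain ⟨c, hc⟩ := htl.of_periodic hU hlen (fun j => rfl)
    rw [div_mul_cancel₀ _ hpos.ne', funext hc, abs_evalWord_sign hε]
    simp_rw [add_comm _ c]
    exact hle c
  · obtain ⟨U, hU⟩ := exists_ultrafilter
    obtain ⟨t, htl⟩ := exists_limitWord hs U
    obtain ⟨c, hc⟩ := htl.of_periodic hU hlen (fun j => rfl)
    obtain ⟨U', hU', ht'⟩ := htl.shift hU (m - c)
    have e : |evalWord α fun j => t (m - c + j)| = maxValue α (n + 1) := by
      rw [← hm]
      simp_rw [hc]
      rw [abs_evalWord_sign hε]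
      congr 2
      funext j
      congr 1
      ring
    rw [← e]
    refine le_limsupDist_of_limitWord hα hroot hs hx hU' ht' ?_
    refine lt_of_le_of_lt ?_ (top_lt_half hα hroot)
    rw [e, top_eq hα hroot]
    have := maxValue_lt hα' n.succ_pos
    gcongr

theorem realize_neg (α : ℝ) (t : ℤ → ℤ) :
    -realize α (-α⁻¹) t = realize α (-α⁻¹) fun j => -t j := by
  rw [realize_eq, realize_eq, evalWord_neg, neg_div]

theorem rightWord_neg (s : ℕ → ℤ) (j : ℤ) : -rightWord s j = rightWord (fun n => -s n) j := by
  unfold rightWord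
  split_ifs <;> simp

theorem realize_rightWord_neg (α : ℝ) (s : ℕ → ℤ) :
    -realize α (-α⁻¹) (rightWord s) = realize α (-α⁻¹) (rightWord fun n => -s n) := by
  rw [realize_neg]
  congr 1
  funext j
  exact rightWord_neg s j

theorem mem_christoffelSet_iff {α : ℝ} {n : ℕ} {ξ : ℝ} :
    ξ ∈ christoffelSet α (-α⁻¹) n ↔ ∃ ν : List (Fin 2), IsChristoffel ν ∧
      (code ν).length = 2 * (n + 1) ∧ ∃ k ε : ℤ, (ε = 1 ∨ ε = -1) ∧ ∃ x ∈ lattice α (-α⁻¹),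
        ξ = realize α (-α⁻¹) (rightWord fun j : ℕ => ε * biPeriodic (code ν) (j + k)) + x := by
  simp only [christoffelSet, Set.mem_ofPred_eq, periodicWord_eq, realize_rightWord_neg]
  refine exists_congr fun ν => and_congr_right fun _ => and_congr_right fun hn => ?_
  constructor
  · rintro ⟨k, -, x, hx, h | h⟩
    · exact ⟨k, 1, Or.inl rfl, x, hx, by simpa using h⟩
    · exact ⟨k, -1, Or.inr rfl, x, hx, by simpa using h⟩
  · rintro ⟨k, ε, hε, x, hx, h⟩
    have hpos : (0 : ℤ) < (code ν).length := by omega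
    have h1 := Int.emod_nonneg k hpos.ne'
    have h2 := Int.emod_lt_of_pos k hpos
    have e : ∀ j : ℕ, biPeriodic (code ν) ((j + (k % (code ν).length).toNat : ℕ) : ℤ) =
        biPeriodic (code ν) (j + k) := by
      intro j
      rw [← biPeriodic_add_mul (code ν) _ (k / (code ν).length)]
      push_cast
      rw [Int.toNat_of_nonneg h1, add_assoc, Int.emod_add_mul_ediv]
    refine ⟨(k % (code ν).length).toNat, by omega, x, hx, ?_⟩
    simp_rw [e]
    rcases hε with rfl | rfl
    · left; simpa using h
    · right; simpa using h

theorem christoffelSet_subset {α : ℝ} {b : ℕ} (hα : 3 < α) (hroot : α ^ 2 - b * α - 1 = 0)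
    (n : ℕ) : christoffelSet α (-α⁻¹) n ⊆ levelSet α (maxValue α (n + 1) / (α + α⁻¹)) := by
  intro ξ hξ
  obtain ⟨ν, hν, hn, k, ε, hε, x, hx, rfl⟩ := mem_christoffelSet_iff.1 hξ
  exact hν.limsupDist_eq hα hroot hn hε hx

/-! ### Tails of words -/

theorem rightEval_rightWord (α : ℝ) (s : ℕ → ℤ) :
    rightEval α (rightWord s) = ∑' k : ℕ, (s k : ℝ) / α ^ (k + 1) := by
  unfold rightEval
  refine tsum_congr fun k => ?_
  rw [rightWord, if_pos (by omega)]
  simp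

theorem realize_rightWord (α : ℝ) (s : ℕ → ℤ) :
    realize α (-α⁻¹) (rightWord s) = (∑' k : ℕ, (s k : ℝ) / α ^ (k + 1)) / (α + α⁻¹) := by
  rw [realize_eq, evalWord_split, leftEval_rightWord, zero_add, rightEval_rightWord]

/-- Changing finitely many letters changes the numerator by a polynomial in α⁻¹ = α - b, which lies
in ℤ[α]. -/
theorem realize_sub_mem_lattice {α : ℝ} {b : ℕ} (hα : 3 < α) (hroot : α ^ 2 - b * α - 1 = 0)
    {s s' : ℕ → ℤ} {B B' : ℤ} (hs : ∀ n, |s n| ≤ B) (hs' : ∀ n, |s' n| ≤ B') {M : ℕ}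
    (h : ∀ n ≥ M, s n = s' n) :
    realize α (-α⁻¹) (rightWord s) - realize α (-α⁻¹) (rightWord s') ∈ lattice α (-α⁻¹) := by
  have sum : ∀ {s : ℕ → ℤ} {B : ℤ}, (∀ n, |s n| ≤ B) →
      Summable fun k : ℕ => (s k : ℝ) / α ^ (k + 1) := fun {s B} hs =>
    summable_right (B := B) (by linarith) fun k => by exact_mod_cast hs k
  have hinv : α⁻¹ ∈ Algebra.adjoin ℤ ({α} : Set ℝ) := by
    refine (mem_adjoin_iff hroot _).2 ⟨-b, 1, ?_⟩
    push_cast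
    linarith [alpha_sub_inv hα hroot]
  have hcast : ∀ z : ℤ, (z : ℝ) ∈ Algebra.adjoin ℤ ({α} : Set ℝ) := fun z =>
    Subalgebra.algebraMap_mem (Algebra.adjoin ℤ ({α} : Set ℝ)) z
  refine ⟨∑ k ∈ Finset.range M, ((s k - s' k : ℤ) : ℝ) * α⁻¹ ^ (k + 1),
    sum_mem fun k _ => mul_mem (hcast _) (pow_mem hinv _), ?_⟩
  rw [realize_rightWord, realize_rightWord, ← sub_div, ← (sum hs).tsum_sub (sum hs'), sub_neg_eq_add]
  congr 1
  rw [tsum_eq_sum (s := Finset.range M)]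
  · refine Finset.sum_congr rfl fun k _ => ?_
    push_cast
    rw [inv_pow, div_eq_mul_inv, div_eq_mul_inv]
    ring
  · intro k hk
    rw [h k (by simpa using hk), sub_self]

theorem lattice_add {α : ℝ} {b : ℕ} (hroot : α ^ 2 - b * α - 1 = 0) {x y : ℝ}
    (hx : x ∈ lattice α (-α⁻¹)) (hy : y ∈ lattice α (-α⁻¹)) : x + y ∈ lattice α (-α⁻¹) := by
  obtain ⟨c, d, rfl⟩ := (lattice_iff hroot x).1 hx
  obtain ⟨c', d', rfl⟩ := (lattice_iff hroot y).1 hy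
  refine (lattice_iff hroot _).2 ⟨c + c', d + d', ?_⟩
  rw [← add_div]
  push_cast
  ring

theorem christoffelSet_subset_adjoin {α : ℝ} {b : ℕ} (hα : 3 < α)
    (hroot : α ^ 2 - b * α - 1 = 0) (n : ℕ) :
    christoffelSet α (-α⁻¹) n ⊆ (IntermediateField.adjoin ℚ ({α} : Set ℝ) : Set ℝ) := by
  intro ξ hξ
  obtain ⟨ν, hν, hn, k, ε, hε, x, hx, rfl⟩ := mem_christoffelSet_iff.1 hξ
  obtain ⟨c, d, rfl⟩ := (lattice_iff hroot x).1 hx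
  have hmem : α ∈ IntermediateField.adjoin ℚ ({α} : Set ℝ) :=
    IntermediateField.mem_adjoin_simple_self ℚ α
  have hcast : ∀ z : ℤ, (z : ℝ) ∈ IntermediateField.adjoin ℚ ({α} : Set ℝ) := fun z =>
    intCast_mem _ z
  have hsqrt : α + α⁻¹ ∈ IntermediateField.adjoin ℚ ({α} : Set ℝ) :=
    add_mem hmem (inv_mem hmem)
  obtain ⟨s, hs⟩ : ∃ s : ℕ → ℤ, s = fun j : ℕ => ε * biPeriodic (code ν) (j + k) := ⟨_, rfl⟩
  have hsum : Summable fun k : ℕ => (s k : ℝ) / α ^ (k + 1) :=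
    summable_right (B := 1) (by linarith) fun j => by
      rw [hs]; exact_mod_cast sign_mul_biPeriodic_abs_le hε ν _
  obtain ⟨L, hL⟩ : ∃ L, L = (code ν).length := ⟨_, rfl⟩
  have hper : ∀ j, s (j + L) = s j := by
    intro j
    simp only [hs]
    rw [← biPeriodic_add (code ν) (j + k), hL]
    push_cast
    congr 2
    ring
  have hL1 : α ^ L ≠ 1 := (one_lt_pow₀ (by linarith) (by omega)).ne'
  have hα0 : α ≠ 0 := by linarith
  rw [← hs, realize_rightWord]
  -- A periodic expansion is a finite sum divided by 1 - α^(-L), hence an element of the field.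
  have key : (∑' k : ℕ, (s k : ℝ) / α ^ (k + 1)) =
      (∑ k ∈ Finset.range L, (s k : ℝ) / α ^ (k + 1)) * α ^ L / (α ^ L - 1) := by
    have h1 := hsum.sum_add_tsum_nat_add L
    have h2 : ∑' k : ℕ, (s (k + L) : ℝ) / α ^ (k + L + 1) =
        (∑' k : ℕ, (s k : ℝ) / α ^ (k + 1)) / α ^ L := by
      rw [← tsum_div_const]
      refine tsum_congr fun j => ?_
      rw [hper, div_div, ← pow_add]
      congr 2
      ring
    rw [h2] at h1
    rw [eq_div_iff (sub_ne_zero.2 hL1), mul_sub, mul_one, ← h1]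
    have : α ^ L ≠ 0 := pow_ne_zero _ hα0
    generalize ∑' k : ℕ, (s k : ℝ) / α ^ (k + 1) = R at *
    field_simp at h1 ⊢
    linear_combination -h1
  rw [key]
  refine add_mem (div_mem (div_mem (mul_mem (sum_mem fun j _ => div_mem (hcast _) (pow_mem hmem _))
    (pow_mem hmem _)) (sub_mem (pow_mem hmem _) (one_mem _))) hsqrt)
    (div_mem (add_mem (hcast _) (mul_mem (hcast _) hmem)) hsqrt)

/-! ### Eventually periodic words -/

/-- A periodic balanced difference is up to sign given by a Christoffel word. -/
theorem IsBalancedDiff.exists_christoffel {t : ℤ → ℤ} (ht : IsBalancedDiff t) {T : ℕ} (hT : 0 < T)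
    (hper : ∀ j, t (j + T) = t j) :
    ∃ (ν : List (Fin 2)) (k ε : ℤ), IsChristoffel ν ∧ 0 < (code ν).length ∧ (ε = 1 ∨ ε = -1) ∧
      ∀ j, t j = ε * biPeriodic (code ν) (j + k) := by
  have main : ∀ (S y t : ℤ → ℤ) (e : ℤ), IsBinarySum S y → BalancedSum S →
      (∀ j, y j = 1 → y (j + 1) = 0) → (∀ j, t (2 * j + e) = y (j + 1) - y j) →
      (∀ j, t (2 * j + e + 1) = 0) → (∀ j, t (j + T) = t j) →
      ∃ (ν : List (Fin 2)) (k : ℤ), IsChristoffel ν ∧ 0 < (code ν).length ∧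
        ∀ j, t j = biPeriodic (code ν) (j + k) := by
    intro S y t e hS hB h11 h1 h2 hper
    -- A period T of t is also a period 2T, that is, T in the index of y. It makes y(j+T) - y(j)
    -- constant, and this constant is 0 because y is bounded.
    have hyT : ∀ j, y (j + T) = y j := by
      have hd := eq_of_step_eq (f := fun j => y (j + T) - y j) (fun j => by
        have a1 := h1 j
        have a2 := h1 (j + T)
        rw [show 2 * (j + (T : ℤ)) + e = 2 * j + e + T + T by ring, hper, hper] at a2
        rw [show j + 1 + (T : ℤ) = j + T + 1 by ring]
        linarith)
      intro j
      have a1 := hd (j + T) j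
      have := hS.bin j
      have := hS.bin (j + T)
      have := hS.bin (j + T + T)
      omega
    obtain ⟨a, p, N, hN, hpN, hcop, hslope⟩ := hB.exists_slope hS (by exact_mod_cast hT) hyT
    have hN' : (0 : ℤ) < N := by exact_mod_cast hN
    have hshift : ∀ l, S (a + l + N) = S (a + l) + p := by
      intro l
      rw [add_assoc, hslope, hslope l, show (l + N : ℤ) * p = l * p + p * N by ring,
        Int.add_mul_ediv_right _ _ hN'.ne']
      ring
    have hyN : ∀ j, y (j + N) = y j := by
      intro j
      have a1 := hshift (j - a)
      have a2 := hshift (j - a + 1)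
      have a3 := hS.step j
      have a4 := hS.step (j + N)
      rw [show a + (j - a) + (N : ℤ) = j + N by ring, show a + (j - a) = j by ring] at a1
      rw [show a + (j - a + 1) + (N : ℤ) = j + N + 1 by ring, show a + (j - a + 1) = j + 1 by ring]
        at a2
      omega
    -- Slope 1 would make y constantly 1, contrary to the absence of 11. Thus y a = 0, and one
    -- period can be cut into blocks starting at a.
    have hplt : p < N := by
      rcases hpN.lt_or_eq with h | h
      · exact h
      · exfalso
        have hone : ∀ l, S (a + l) = S a + l := fun l => by
          rw [hslope, h, Int.mul_ediv_cancel _ hN'.ne']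
        have b1 := hone 1
        have b2 := hone 2
        have b3 := hS.step a
        have b4 := hS.step (a + 1)
        have b5 := h11 a
        rw [show a + 2 = a + 1 + 1 by ring] at b2
        omega
    have hya : y a = 0 := by
      have b1 := hslope 1
      have b2 := hS.step a
      rw [one_mul, Int.ediv_eq_zero_of_lt (by positivity) (by exact_mod_cast hplt)] at b1
      omega
    obtain ⟨u, hu, hv⟩ := exists_desubstitution hS h11 h1 h2 N a hya (by rw [hyN, hya])
    have hlen : (code u).length = 2 * N := by rw [← hu, zwindow_length]
    have hlen' : u.length + u.count 1 = N := by rw [code_length] at hlen; omega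
    refine ⟨u, -(2 * a + e - 1), isChristoffel_of_desubstitution hS hN hcop hslope hlen' hv,
      by omega, eq_biPeriodic (by omega) (by rw [hlen, hu]) fun j => ?_⟩
    rw [hlen]
    push_cast
    rcases Int.even_or_odd' (j - e) with ⟨i, hi | hi⟩
    · rw [show j + 2 * (N : ℤ) = 2 * (i + N) + e by omega, show j = 2 * i + e by omega, h1, h1,
        show i + (N : ℤ) + 1 = i + 1 + N by ring, hyN, hyN]
    · rw [show j + 2 * (N : ℤ) = 2 * (i + N) + e + 1 by omega,
        show j = 2 * i + e + 1 by omega, h2, h2]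
  obtain ⟨e, S, y, hS, hB, h1, h2⟩ := ht
  rcases hB.no_ones_or_no_zeros hS with h11 | h11
  · obtain ⟨ν, k, hν, hl, h⟩ := main S y t e hS hB h11 h1 h2 hper
    exact ⟨ν, k, 1, hν, hl, Or.inl rfl, fun j => by rw [one_mul, h]⟩
  · obtain ⟨ν, k, hν, hl, h⟩ := main _ _ (fun j => -t j) e hS.compl hB.compl h11
      (fun j => by rw [h1]; ring) (fun j => by rw [h2, neg_zero])
      (fun j => by rw [hper])
    exact ⟨ν, k, -1, hν, hl, Or.inr rfl, fun j => by rw [← h]; ring⟩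

theorem mem_christoffelSet_of_eventuallyPeriodic {α : ℝ} {b : ℕ} (hα : 3 < α)
    (hroot : α ^ 2 - b * α - 1 = 0) {s : ℕ → ℤ} {B : ℤ} (hs : ∀ n, |s n| ≤ B) {x : ℝ}
    (hx : x ∈ lattice α (-α⁻¹))
    (h : ∀ (U : Ultrafilter ℕ) (t : ℤ → ℤ), (U : Filter ℕ) ≤ atTop → IsLimitWord U s t →
      IsBalancedDiff t) (hper : IsEventuallyPeriodic s) :
    ∃ n, realize α (-α⁻¹) (rightWord s) + x ∈ christoffelSet α (-α⁻¹) n := by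
  obtain ⟨M, T, hT, hM⟩ := hper
  obtain ⟨U, hU⟩ := exists_ultrafilter
  obtain ⟨t, ht⟩ := exists_limitWord hs U
  have htT : ∀ j, t (j + T) = t j := by
    intro j
    obtain ⟨n, h1, h2, h3⟩ := ((ht j).and ((ht (j + T)).and
      (eventually_natCast_add_ge hU j (M + 1)))).exists
    rw [← h1, ← h2, rightWord_natCast s n _ (by omega), rightWord_natCast s n _ (by omega),
      ← hM (n + j - 1).toNat (by omega)]
    congr 1
    omega
  obtain ⟨ν, k, ε, hν, hlen, hε, htν⟩ := (h U t hU ht).exists_christoffel hT htT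
  obtain ⟨n, h1, h2⟩ := ((ht.window 1 T).and (eventually_natCast_add_ge hU 0 M)).exists
  -- One full period of s agrees with the limit word, and both have the period T from there on, so s
  -- is itself a signed shift of the Christoffel code beyond n.
  have hsν : ∀ m ≥ n, s m = ε * biPeriodic (code ν) (m + (k + 1 - n)) := by
    intro m hm
    have h3 : ∀ l : ℕ, s (n + l) = t (1 + l) := by
      intro l
      induction l using Nat.strong_induction_on with
      | _ l ih =>
        rcases lt_or_ge l T with hl | hl
        · rw [← h1 l hl, rightWord_natCast s n _ (by omega)]
          congr 1
          omega
        · have h4 := ih (l - T) (by omega)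
          rw [← htT, ← hM _ (by omega)] at h4
          rw [show n + (l - T) + T = n + l by omega,
            show 1 + ((l - T : ℕ) : ℤ) + T = 1 + l by omega] at h4
          exact h4
    have h4 := h3 (m - n)
    rw [show n + (m - n) = m by omega, htν] at h4
    rw [h4]
    congr 2
    omega
  have hcl := code_length ν
  refine ⟨ν.length + ν.count 1 - 1, mem_christoffelSet_iff.2 ⟨ν, hν, by omega, k + 1 - n, ε, hε, _,
    lattice_add hroot hx (realize_sub_mem_lattice hα hroot hs (s' := fun j : ℕ =>
      ε * biPeriodic (code ν) (j + (k + 1 - n))) (fun j => sign_mul_biPeriodic_abs_le hε ν _)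
      hsν), ?_⟩⟩
  ring

/-! ### Windows of words that are eventually balanced in code -/

theorem window_eq_zwindow (s : ℕ → ℤ) (i j : ℕ) :
    window s i j = zwindow (rightWord s) (i + 1) (j + 1 - i) := by
  refine List.map_congr_left fun l _ => ?_
  rw [rightWord, if_pos (by omega)]
  congr 1
  omega

theorem zwindow_infix_window {t : ℤ → ℤ} {s : ℕ → ℤ} {a : ℤ} {c n i j : ℕ}
    (h : ∀ l < n, t (a + l) = s (c + l)) (h1 : i ≤ c) (h2 : c + n ≤ j + 1) :
    zwindow t a n <:+: window s i j := by
  rw [window_eq_zwindow, zwindow_congr (t' := rightWord s) (a' := c + 1) fun l hl => ?_]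
  · exact zwindow_infix _ (by omega) (by omega)
  · rw [h l hl, rightWord, if_pos (by omega)]
    congr 1
    omega

theorem abs_le_one_of_mem_code {u : List (Fin 2)} {x : ℤ} (h : x ∈ code u) : |x| ≤ 1 := by
  obtain ⟨i, hi, rfl⟩ := List.getElem_of_mem h
  have := codeAt_abs_le u i
  rwa [codeAt, List.getD_eq_getElem _ _ hi] at this

theorem IsEventuallyBalancedCode.bounded {s : ℕ → ℤ} (h : IsEventuallyBalancedCode s) :
    ∃ B : ℤ, ∀ n, |s n| ≤ B := by
  obtain ⟨m₀, r, -, h⟩ := h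
  have h1 : ∀ m ≥ m₀, |s m| ≤ 1 := by
    intro m hm
    obtain ⟨u, -, hu⟩ := h m hm
    have hmem : s m ∈ window s (m - r m) (m + r m) := by
      refine List.mem_map.2 ⟨m - (m - r m), List.mem_range.2 (by omega), ?_⟩
      congr 1
      omega
    rcases hu with hu | hu
    · exact abs_le_one_of_mem_code (hu.subset hmem)
    · rw [← abs_neg]
      exact abs_le_one_of_mem_code (hu.subset (List.mem_map.2 ⟨_, hmem, rfl⟩))
  refine ⟨1 + ∑ i ∈ Finset.range m₀, |s i|, fun n => ?_⟩
  have h2 : 0 ≤ ∑ i ∈ Finset.range m₀, |s i| := Finset.sum_nonneg fun i _ => abs_nonneg _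
  rcases lt_or_ge n m₀ with hn | hn
  · have := Finset.single_le_sum (f := fun i => |s i|) (fun i _ => abs_nonneg _)
      (Finset.mem_range.2 hn)
    linarith
  · linarith [h1 n hn]

theorem IsEventuallyBalancedCode.isBalancedDiff {s : ℕ → ℤ} (h : IsEventuallyBalancedCode s)
    {U : Ultrafilter ℕ} {t : ℤ → ℤ} (hU : (U : Filter ℕ) ≤ atTop) (ht : IsLimitWord U s t) :
    IsBalancedDiff t := by
  obtain ⟨m₀, r, hr, h⟩ := h
  refine TernaryMarkoff.isBalancedDiff (ternaryMarkoff_of_windows fun a n => ?_)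
  obtain ⟨m, h1, h2, h3, h4⟩ := ((ht.window a n).and ((eventually_natCast_add_ge hU a 1).and
    (((eventually_ge_atTop m₀).filter_mono hU).and
      ((hr.eventually_ge_atTop (a.natAbs + n + 1)).filter_mono hU)))).exists
  obtain ⟨u, hu, hw⟩ := h m h3
  have hinf : zwindow t a n <:+: window s (m - r m) (m + r m) := by
    refine zwindow_infix_window (c := (m + a - 1).toNat) (fun l hl => ?_) (by omega) (by omega)
    rw [← h1 l hl, rightWord_natCast s m _ (by omega)]
    congr 1
    omega
  exact ⟨u, hu, hw.imp (fun h => hinf.trans h) fun h => (hinf.map _).trans h⟩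

/-- Compactness: if windows of some fixed radius R failed infinitely often, a limit word would
contain such a window, against `IsBalancedDiff.windows`. -/
theorem isEventuallyBalancedCode_of_limitWords {s : ℕ → ℤ} {B : ℤ} (hs : ∀ n, |s n| ≤ B)
    (h : ∀ (U : Ultrafilter ℕ) (t : ℤ → ℤ), (U : Filter ℕ) ≤ atTop → IsLimitWord U s t →
      IsBalancedDiff t) : IsEventuallyBalancedCode s := by
  have key : ∀ R : ℕ, ∃ M : ℕ, ∀ m ≥ M, ∃ u : List (Fin 2), IsBalanced u ∧
      (window s (m - R) (m + R) <:+: code u ∨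
        (window s (m - R) (m + R)).map (fun a => -a) <:+: code u) := by
    intro R
    rw [← eventually_atTop]
    by_contra hcon
    obtain ⟨U, hU, hUp⟩ := exists_ultrafilter_of_frequently (not_eventually.1 hcon)
    obtain ⟨t, ht⟩ := exists_limitWord hs U
    obtain ⟨u, hu, hw⟩ := (h U t hU ht).windows (1 - R) (2 * R + 1)
    obtain ⟨m, h1, h2, h3⟩ := (hUp.and ((ht.window (1 - R) (2 * R + 1)).and
      (eventually_natCast_add_ge hU 0 R))).exists
    refine h1 ⟨u, hu, ?_⟩
    have e : window s (m - R) (m + R) = zwindow t (1 - R) (2 * R + 1) := by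
      rw [window_eq_zwindow, show m + R + 1 - (m - R) = 2 * R + 1 by omega]
      refine zwindow_congr fun l hl => ?_
      rw [← h2 l hl]
      congr 1
      omega
    rwa [e]
  choose M hM using key
  -- The thresholds M R for fixed radii are diagonalized: at m the largest radius R ≤ m with M R ≤ m
  -- is used.
  refine ⟨M 0, fun m => Nat.findGreatest (fun R => M R ≤ m) m, ?_, fun m hm => ?_⟩
  · refine tendsto_atTop.2 fun R => ?_
    filter_upwards [eventually_ge_atTop R, eventually_ge_atTop (M R)] with m h1 h2
    exact Nat.le_findGreatest h1 h2
  · exact hM _ m (Nat.findGreatest_spec (P := fun R => M R ≤ m) (Nat.zero_le m) hm)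

/-! ### Codes of eventually balanced words -/

/-- The prefix of length `n` of an infinite word. -/
def prefixWord (y : ℕ → Fin 2) (n : ℕ) : List (Fin 2) := (List.range n).map y

/-- The position of the code of the letter at the index `i`. -/
def codePos (y : ℕ → Fin 2) (i : ℕ) : ℕ := (code (prefixWord y i)).length

theorem prefixWord_add (y : ℕ → Fin 2) (i n : ℕ) :
    prefixWord y (i + n) = prefixWord y i ++ (List.range n).map fun l => y (i + l) := by
  simp [prefixWord, List.range_add]

theorem prefixWord_succ (y : ℕ → Fin 2) (i : ℕ) :
    prefixWord y (i + 1) = prefixWord y i ++ [y i] := by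
  simp [prefixWord, List.range_succ]

theorem codePos_zero (y : ℕ → Fin 2) : codePos y 0 = 0 := rfl

theorem codePos_succ (y : ℕ → Fin 2) (i : ℕ) :
    codePos y (i + 1) = codePos y i + (codeLetter (y i)).length := by
  rw [codePos, prefixWord_succ, code_append, List.length_append]
  simp [codePos, code]

theorem codeLetter_length (a : Fin 2) :
    2 ≤ (codeLetter a).length ∧ (codeLetter a).length ≤ 4 := by
  fin_cases a <;> simp [codeLetter]

theorem codePos_add (y : ℕ → Fin 2) (i n : ℕ) : codePos y i + 2 * n ≤ codePos y (i + n) := by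
  induction n with
  | zero => simp
  | succ n ih =>
    have := codePos_succ y (i + n)
    have := (codeLetter_length (y (i + n))).1
    rw [← add_assoc]
    omega

theorem codePos_le (y : ℕ → Fin 2) (i : ℕ) : codePos y i ≤ 4 * i := by
  induction i with
  | zero => simp [codePos_zero]
  | succ i ih =>
    have := codePos_succ y i
    have := (codeLetter_length (y i)).2
    omega

theorem exists_codePos (y : ℕ → Fin 2) (x : ℕ) : ∃ i, codePos y i ≤ x ∧ x < codePos y (i + 1) := by
  induction x with
  | zero =>
    refine ⟨0, by simp [codePos_zero], ?_⟩
    have := codePos_add y 0 1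
    rw [zero_add] at *
    omega
  | succ x ih =>
    obtain ⟨i, h1, h2⟩ := ih
    rcases Nat.lt_or_ge (x + 1) (codePos y (i + 1)) with h | h
    · exact ⟨i, by omega, h⟩
    · have := codePos_add y (i + 1) 1
      exact ⟨i + 1, h, by omega⟩

theorem codeInf_eq (y : ℕ → Fin 2) {n N : ℕ} (h : n < codePos y N) :
    codeInf y n = codeAt (prefixWord y N) n := by
  have key : ∀ i j, i ≤ j → n < codePos y i →
      codeAt (prefixWord y j) n = codeAt (prefixWord y i) n := by
    intro i j hij hn
    obtain ⟨d, rfl⟩ := Nat.exists_eq_add_of_le hij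
    rw [prefixWord_add, codeAt_append_left _ _ hn]
  have h1 : n < codePos y (n + 1) := by
    have := codePos_add y 0 (n + 1)
    rw [zero_add] at this
    omega
  change codeAt (prefixWord y (n + 1)) n = _
  rcases le_total (n + 1) N with h2 | h2
  · exact (key _ _ h2 h1).symm
  · exact key _ _ h2 h

theorem codeInf_codePos_add (y : ℕ → Fin 2) (i n l : ℕ)
    (h : l < (code ((List.range n).map fun l => y (i + l))).length) :
    codeInf y (codePos y i + l) = codeAt ((List.range n).map fun l => y (i + l)) l := by
  rw [codeInf_eq y (N := i + n), prefixWord_add]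
  · exact codeAt_append_right _ _ _
  · rw [codePos, codePos, prefixWord_add, code_append, List.length_append]
    exact Nat.add_lt_add_left h _

theorem codeInf_codePos (y : ℕ → Fin 2) (i : ℕ) :
    codeInf y (codePos y i + 1) = if y i = 1 then 1 else 0 := by
  have e : (List.range 1).map (fun l => y (i + l)) = [y i] := by simp
  rw [codeInf_codePos_add y i 1 1, e]
  · generalize y i = a
    fin_cases a <;> simp [codeAt, code, codeLetter]
  · rw [e]
    have := (codeLetter_length (y i)).1
    simp only [code, List.flatMap_cons, List.flatMap_nil, List.append_nil]
    omega

theorem eq_of_codeInf_eq {y y' : ℕ → Fin 2} {i i' : ℕ}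
    (h : codeInf y (codePos y i + 1) = codeInf y' (codePos y' i' + 1)) : y i = y' i' := by
  rw [codeInf_codePos, codeInf_codePos] at h
  generalize y i = a at *
  generalize y' i' = c at *
  fin_cases a <;> fin_cases c <;> simp_all

theorem codeInf_injective : Function.Injective codeInf := by
  intro y y' h
  have key : ∀ i, codePos y i = codePos y' i := by
    intro i
    induction i with
    | zero => rfl
    | succ i ih =>
      rw [codePos_succ, codePos_succ, ih,
        eq_of_codeInf_eq (y := y) (y' := y') (i := i) (i' := i) (by rw [h, ih])]
  funext i
  exact eq_of_codeInf_eq (by rw [h, key])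

/-- If the code has an eventual period T, two block starts are congruent modulo T. Congruent starts
carry equal letters, so the next starts are congruent too, and y repeats from there on. -/
theorem codeInf_not_eventuallyPeriodic {y : ℕ → Fin 2} (hy : ¬ IsEventuallyPeriodic y) (k : ℕ) :
    ¬ IsEventuallyPeriodic fun j => codeInf y (j + k) := by
  rintro ⟨M, T, hT, h⟩
  apply hy
  have hle : ∀ n, n ≤ codePos y n := fun n => by
    have := codePos_add y 0 n
    rw [zero_add] at this
    omega
  have hmul : ∀ x ≥ M + k, ∀ d, codeInf y (x + d * T) = codeInf y x := by
    intro x hx d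
    induction d with
    | zero => simp
    | succ d ih =>
      have := h (x + d * T - k) (by omega)
      simp only at this
      rw [← ih]
      convert this using 2
      · rw [add_mul]; omega
      · omega
  have hmod : ∀ a c, M + k ≤ a → M + k ≤ c → a % T = c % T → codeInf y a = codeInf y c := by
    have aux : ∀ a c, M + k ≤ a → a ≤ c → a % T = c % T → codeInf y a = codeInf y c := by
      intro a c ha hac hmod
      obtain ⟨d, hd⟩ := (Nat.modEq_iff_dvd' hac).1 hmod
      have := hmul a ha d
      rw [mul_comm, ← hd, Nat.add_sub_cancel' hac] at this
      exact this.symm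
    intro a c ha hc hm
    rcases le_total a c with h1 | h1
    · exact aux a c ha h1 hm
    · exact (aux c a hc h1 hm.symm).symm
  obtain ⟨i, i', hne, hi⟩ := Finite.exists_ne_map_eq_of_infinite
    fun i : ℕ => (⟨codePos y (M + k + i) % T, Nat.mod_lt _ hT⟩ : Fin T)
  rw [Fin.mk.injEq] at hi
  have main : ∀ i i', i < i' → codePos y (M + k + i) % T = codePos y (M + k + i') % T →
      IsEventuallyPeriodic y := by
    intro i i' hlt hi
    have letter : ∀ l, codePos y (M + k + i + l) % T = codePos y (M + k + i' + l) % T →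
        y (M + k + i + l) = y (M + k + i' + l) := by
      intro l hl
      refine eq_of_codeInf_eq (hmod _ _ ?_ ?_ (Nat.ModEq.add_right 1 hl))
      · have := hle (M + k + i + l); omega
      · have := hle (M + k + i' + l); omega
    have step : ∀ l, codePos y (M + k + i + l) % T = codePos y (M + k + i' + l) % T := by
      intro l
      induction l with
      | zero => exact hi
      | succ l ih =>
        rw [← add_assoc, ← add_assoc, codePos_succ, codePos_succ, letter l ih]
        exact Nat.ModEq.add_right _ ih
    refine ⟨M + k + i, i' - i, by omega, fun n hn => ?_⟩
    have := letter (n - (M + k + i)) (step _)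
    rw [show M + k + i + (n - (M + k + i)) = n by omega,
      show M + k + i' + (n - (M + k + i)) = n + (i' - i) by omega] at this
    exact this.symm
  rcases Nat.lt_or_gt_of_ne hne with h1 | h1
  · exact main i i' h1 hi
  · exact main i' i h1 hi.symm

/-- Around the block containing the position m + k the balanced window of y of radius ρ is used.
Blocks have length at least 2, so its code covers ρ positions on either side or reaches the start of
the word; blocks have length at most 4, so the block index tends to infinity with m. -/
theorem IsEventuallyBalanced.code {y : ℕ → Fin 2} (h : IsEventuallyBalanced y) (k : ℕ) :
    IsEventuallyBalancedCode fun j => codeInf y (j + k) := by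
  obtain ⟨m₀, r, hr, h⟩ := h
  choose ι h1 h2 using fun m => exists_codePos y (m + k)
  have hι : ∀ m, m < 4 * (ι m + 1) := fun m => by
    have := codePos_le y (ι m + 1)
    have := h2 m
    omega
  refine ⟨4 * m₀, fun m => r (ι m), hr.comp ?_, fun m hm => ?_⟩
  · refine tendsto_atTop.2 fun c => ?_
    filter_upwards [eventually_ge_atTop (4 * c)] with m hm
    have := hι m
    omega
  · have him : m₀ ≤ ι m := by have := hι m; omega
    refine ⟨_, h _ him, Or.inl ?_⟩
    have a1 := h1 m
    have a2 := h2 m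
    beta_reduce
    generalize ι m = i at a1 a2 ⊢
    generalize r i = ρ
    obtain ⟨n, hn⟩ : ∃ n, n = i + ρ + 1 - (i - ρ) := ⟨_, rfl⟩
    have hW : window y (i - ρ) (i + ρ) = (List.range n).map fun l => y (i - ρ + l) := by
      rw [window, hn]
    rw [hW]
    have hlen : codePos y (i - ρ) + (MarkoffPisot.code ((List.range n).map
        fun l => y (i - ρ + l))).length = codePos y (i + ρ + 1) := by
      rw [show i + ρ + 1 = i - ρ + n by omega, codePos, codePos, prefixWord_add, code_append,
        List.length_append]
    have b1 := codePos_add y (i + 1) ρ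
    rw [show i + 1 + ρ = i + ρ + 1 by ring] at b1
    have b2 : codePos y (i - ρ) + 2 * ρ ≤ codePos y i ∨ codePos y (i - ρ) = 0 := by
      rcases le_total ρ i with hle | hle
      · left
        have := codePos_add y (i - ρ) ρ
        rwa [Nat.sub_add_cancel hle] at this
      · right
        rw [Nat.sub_eq_zero_of_le hle, codePos_zero]
    have hcode : MarkoffPisot.code ((List.range n).map fun l => y (i - ρ + l)) =
        window (codeInf y) (codePos y (i - ρ)) (codePos y (i + ρ + 1) - 1) := by
      refine List.ext_getElem ?_ fun l hl hl' => ?_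
      · simp only [window, List.length_map, List.length_range]
        omega
      · simp only [window, List.getElem_map, List.getElem_range]
        rw [codeInf_codePos_add y _ n l hl, codeAt, List.getD_eq_getElem _ _ hl]
    rw [hcode, window_eq_zwindow]
    refine zwindow_infix_window (c := m - ρ + k) (fun l hl => ?_) (by omega) (by omega)
    rw [rightWord, if_pos (by omega), show ((m - ρ : ℕ) + 1 + (l : ℤ) - 1).toNat = m - ρ + l by omega]
    congr 1
    omega

theorem IsEventuallyBalancedCode.neg {s : ℕ → ℤ} (h : IsEventuallyBalancedCode s) :
    IsEventuallyBalancedCode fun j => -s j := by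
  obtain ⟨m₀, r, hr, h⟩ := h
  refine ⟨m₀, r, hr, fun m hm => ?_⟩
  obtain ⟨u, hu, hw⟩ := h m hm
  refine ⟨u, hu, ?_⟩
  have e : window (fun j => -s j) (m - r m) (m + r m) =
      (window s (m - r m) (m + r m)).map fun a => -a := by
    simp [window]
  have e' : (window (fun j => -s j) (m - r m) (m + r m)).map (fun a => -a) =
      window s (m - r m) (m + r m) := by
    simp [window, Function.comp_def]
  rw [e', e]
  exact hw.symm

theorem eventuallyBalancedSet_subset (α : ℝ) :
    eventuallyBalancedSet α (-α⁻¹) ⊆ eventuallyBalancedCodeSet α (-α⁻¹) := by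
  rintro ξ ⟨y, hy, hper, k, x, hx, rfl | rfl⟩
  · exact ⟨_, hy.code k, codeInf_not_eventuallyPeriodic hper k, x, hx, rfl⟩
  · refine ⟨_, (hy.code k).neg, fun h => codeInf_not_eventuallyPeriodic hper k ?_, x, hx, ?_⟩
    · obtain ⟨N, t, ht, h⟩ := h
      exact ⟨N, t, ht, fun n hn => neg_injective (h n hn)⟩
    · rw [realize_rightWord_neg]

/-- A coding word of a number at the top cannot be eventually periodic, since it would then lie in a
Christoffel set, whose limsup is strictly smaller. -/
theorem levelSet_top_eq {α : ℝ} {b : ℕ} (hα : 3 < α) (hroot : α ^ 2 - b * α - 1 = 0) :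
    levelSet α (b / (1 + α ^ 2)) = eventuallyBalancedCodeSet α (-α⁻¹) := by
  ext ξ
  constructor
  · intro hξ
    change limsupDist α ξ = _ at hξ
    obtain ⟨s, B, x, hs, hx, rfl, hlim⟩ := exists_balanced_coding hα hroot hξ.le
    refine ⟨s, isEventuallyBalancedCode_of_limitWords hs hlim, fun hper => ?_, x, hx, rfl⟩
    obtain ⟨n, hn⟩ := mem_christoffelSet_of_eventuallyPeriodic hα hroot hs hx hlim hper
    have h1 : limsupDist α _ = _ := christoffelSet_subset hα hroot n hn
    have h2 := maxValue_lt (alpha_ge hα hroot) n.succ_pos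
    rw [hξ, top_eq hα hroot, div_left_inj' (by positivity)] at h1
    exact h2.ne' h1
  · rintro ⟨s, hs, hper, x, hx, rfl⟩
    obtain ⟨B, hB⟩ := hs.bounded
    exact limsupDist_eq_top hα hroot hB hx (fun U t hU ht => hs.isBalancedDiff hU ht) hper

/-! ### Sparse words -/

open Classical in
/-- The word with the letters `1` at the positions `4 ^ (i + 1)` or `4 ^ (i + 1) + 1`. -/
noncomputable def sparseWord (A : ℕ → Bool) (n : ℕ) : Fin 2 :=
  if ∃ i, n = 4 ^ (i + 1) + (A i).toNat then 1 else 0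

theorem sparseWord_eq_one {A : ℕ → Bool} {n : ℕ} :
    sparseWord A n = 1 ↔ ∃ i, n = 4 ^ (i + 1) + (A i).toNat := by
  unfold sparseWord
  split_ifs with h <;> simp [h]

theorem four_pow_gap {i j : ℕ} (h : i < j) : 4 * 4 ^ (i + 1) ≤ 4 ^ (j + 1) := by
  rw [← pow_succ']
  exact Nat.pow_le_pow_right (by norm_num) (by omega)

/-- The bit `A i` only moves the i-th letter 1 by one place, so it is read off at 4^(i+1), while the
gaps between the ones stay of geometric size. -/
theorem sparseWord_injective : Function.Injective sparseWord := by
  intro A A' h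
  have key : ∀ A : ℕ → Bool, ∀ i, sparseWord A (4 ^ (i + 1)) = 1 ↔ A i = false := by
    intro A i
    rw [sparseWord_eq_one]
    constructor
    · rintro ⟨j, hj⟩
      have hA := Bool.toNat_le (A j)
      have hpos := Nat.one_le_pow i 4 (by norm_num)
      have hpos' := Nat.one_le_pow j 4 (by norm_num)
      have e1 : 4 ^ (i + 1) = 4 * 4 ^ i := pow_succ' 4 i
      have e2 : 4 ^ (j + 1) = 4 * 4 ^ j := pow_succ' 4 j
      rcases lt_trichotomy i j with hij | hij | hij
      · have := four_pow_gap hij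
        omega
      · subst hij
        cases hb : A i
        · rfl
        · simp [hb] at hj
      · have := four_pow_gap hij
        omega
    · intro hA
      exact ⟨i, by simp [hA]⟩
  funext i
  have h1 := key A i
  have h2 := key A' i
  rw [h] at h1
  cases hA : A i <;> cases hA' : A' i <;> simp_all

theorem sparseWord_not_eventuallyPeriodic (A : ℕ → Bool) :
    ¬ IsEventuallyPeriodic (sparseWord A) := by
  rintro ⟨M, T, hT, h⟩
  obtain ⟨i, hi⟩ : ∃ i, i = M + T := ⟨_, rfl⟩
  have hlt : i + 1 < 4 ^ (i + 1) := Nat.lt_pow_self (by norm_num)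
  have h1 := h (4 ^ (i + 1) + (A i).toNat) (by omega)
  rw [sparseWord_eq_one.2 ⟨i, rfl⟩, sparseWord_eq_one] at h1
  obtain ⟨j, hj⟩ := h1
  have := Bool.toNat_le (A i)
  have := Bool.toNat_le (A j)
  rcases lt_trichotomy i j with hij | hij | hij
  · have := four_pow_gap hij
    omega
  · subst hij
    omega
  · have := four_pow_gap hij
    omega

theorem count_map_range_le_one (f : ℕ → Fin 2) (n : ℕ)
    (h : ∀ l l', l < n → l' < n → f l = 1 → f l' = 1 → l = l') :
    ((List.range n).map f).count 1 ≤ 1 := by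
  induction n with
  | zero => simp
  | succ n ih =>
    have h1 := ih fun l l' hl hl' => h l l' (by omega) (by omega)
    rw [List.range_succ, List.map_append, List.count_append]
    by_cases hn : f n = 1
    · have : ((List.range n).map f).count 1 = 0 := by
        rw [List.count_eq_zero]
        intro hmem
        obtain ⟨l, hl, hl1⟩ := List.mem_map.1 hmem
        have hl' := List.mem_range.1 hl
        have := h l n (by omega) (by omega) hl1 hn
        omega
      simp [this, hn]
    · simp [hn, h1]

/-- With radius m / 4 the ends of a window have ratio at most about 5/3, while successive ones are
further apart than a factor 3. Such a window contains at most one letter 1 and is trivially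
balanced. -/
theorem sparseWord_isEventuallyBalanced (A : ℕ → Bool) : IsEventuallyBalanced (sparseWord A) := by
  refine ⟨3, fun m => m / 4, ?_, fun m hm => ?_⟩
  · exact tendsto_atTop.2 fun c => (eventually_ge_atTop (4 * c)).mono fun m hm => by omega
  · have hc : (window (sparseWord A) (m - m / 4) (m + m / 4)).count 1 ≤ 1 := by
      refine count_map_range_le_one _ _ fun l l' hl hl' h1 h2 => ?_
      obtain ⟨i, hi⟩ := sparseWord_eq_one.1 h1
      obtain ⟨j, hj⟩ := sparseWord_eq_one.1 h2
      have := Bool.toNat_le (A i)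
      have := Bool.toNat_le (A j)
      rcases lt_trichotomy i j with hij | hij | hij
      · have := four_pow_gap hij
        omega
      · subst hij
        omega
      · have := four_pow_gap hij
        omega
    intro v w hv hw _
    have h1 := hv.sublist.count_le 1
    have h2 := hw.sublist.count_le 1
    beta_reduce at h1 h2
    rw [abs_le]
    omega

/-- At the first difference the words differ by at least 1, and all later differences are at most 2,
so for α > 3 the first one dominates the rest. -/
theorem realize_injOn {α : ℝ} (hα : 3 < α) {s s' : ℕ → ℤ} (hs : ∀ n, |s n| ≤ 1)
    (hs' : ∀ n, |s' n| ≤ 1)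
    (h : realize α (-α⁻¹) (rightWord s) = realize α (-α⁻¹) (rightWord s')) : s = s' := by
  by_contra hne
  have hex : ∃ n, s n ≠ s' n := by
    by_contra hcon
    push Not at hcon
    exact hne (funext hcon)
  classical
  obtain ⟨n, hn, hmin⟩ : ∃ n, s n ≠ s' n ∧ ∀ m < n, s m = s' m :=
    ⟨Nat.find hex, Nat.find_spec hex, fun m hm => not_not.1 (Nat.find_min hex hm)⟩
  have hα0 : 0 < α := by linarith
  have hd : ∀ k, |((s k - s' k : ℤ) : ℝ)| ≤ 2 := by
    intro k
    have h1 := abs_le.1 (hs k)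
    have h2 := abs_le.1 (hs' k)
    have : |s k - s' k| ≤ 2 := by rw [abs_le]; omega
    exact_mod_cast this
  have sum : ∀ {s : ℕ → ℤ}, (∀ n, |s n| ≤ 1) →
      Summable fun k : ℕ => (s k : ℝ) / α ^ (k + 1) := fun {s} hs =>
    summable_right (B := 1) (by linarith) fun k => by exact_mod_cast hs k
  have hzero : ∑' k : ℕ, ((s k - s' k : ℤ) : ℝ) / α ^ (k + 1) = 0 := by
    rw [realize_rightWord, realize_rightWord, div_left_inj' (by positivity)] at h
    have := (sum hs).tsum_sub (sum hs')
    rw [h, sub_self] at this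
    rw [← this]
    refine tsum_congr fun k => ?_
    push_cast
    ring
  have hsum : Summable fun k : ℕ => ((s k - s' k : ℤ) : ℝ) / α ^ (k + 1) :=
    summable_right (by linarith) hd
  have h1 := hsum.sum_add_tsum_nat_add (n + 1)
  rw [hzero, Finset.sum_range_succ, Finset.sum_eq_zero, zero_add] at h1
  swap
  · intro k hk
    rw [hmin k (Finset.mem_range.1 hk)]
    simp
  have hgeo : HasSum (fun k : ℕ => 2 * (α⁻¹ ^ (n + 2) * α⁻¹ ^ k))
      (2 * (α⁻¹ ^ (n + 2) * (1 - α⁻¹)⁻¹)) :=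
    ((hasSum_geometric_of_lt_one (by positivity)
      (inv_lt_one_of_one_lt₀ (by linarith))).mul_left _).mul_left _
  have htail : |∑' k : ℕ, ((s (k + (n + 1)) - s' (k + (n + 1)) : ℤ) : ℝ) / α ^ (k + (n + 1) + 1)| ≤
      2 * (α⁻¹ ^ (n + 2) * (1 - α⁻¹)⁻¹) := by
    rw [← Real.norm_eq_abs]
    refine tsum_of_norm_bounded hgeo fun k => ?_
    rw [Real.norm_eq_abs, abs_div, abs_of_pos (by positivity : 0 < α ^ (k + (n + 1) + 1)),
      div_eq_mul_inv, ← inv_pow, show k + (n + 1) + 1 = n + 2 + k by ring, pow_add]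
    exact mul_le_mul_of_nonneg_right (hd _) (by positivity)
  have hone : 1 ≤ |((s n - s' n : ℤ) : ℝ)| := by
    have : 1 ≤ |s n - s' n| := Int.one_le_abs (sub_ne_zero.2 hn)
    exact_mod_cast this
  have hhead : |((s n - s' n : ℤ) : ℝ) / α ^ (n + 1)| ≤ 2 * (α⁻¹ ^ (n + 2) * (1 - α⁻¹)⁻¹) := by
    rw [eq_neg_of_add_eq_zero_left h1, abs_neg]
    exact htail
  rw [abs_div, abs_of_pos (by positivity : 0 < α ^ (n + 1)), div_eq_mul_inv, ← inv_pow] at hhead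
  have hρ0 : 0 < α⁻¹ := by positivity
  have hρ : α⁻¹ < 1 / 3 := by
    rw [inv_lt_comm₀ hα0 (by norm_num)]
    norm_num
    exact hα
  have h2 : α⁻¹ ^ (n + 1) ≤ α⁻¹ ^ (n + 1) * (2 * (α⁻¹ * (1 - α⁻¹)⁻¹)) := by
    calc α⁻¹ ^ (n + 1) = 1 * α⁻¹ ^ (n + 1) := (one_mul _).symm
      _ ≤ _ := mul_le_mul_of_nonneg_right hone (by positivity)
      _ ≤ _ := hhead
      _ = _ := by ring
  have h3 : α⁻¹ * (1 - α⁻¹)⁻¹ < 1 / 2 := by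
    rw [← div_eq_mul_inv, div_lt_iff₀ (by linarith)]
    linarith
  have h4 : 0 < α⁻¹ ^ (n + 1) := by positivity
  nlinarith

theorem codeInf_abs_le (y : ℕ → Fin 2) (n : ℕ) : |codeInf y n| ≤ 1 := codeAt_abs_le _ _

theorem eventuallyBalancedSet_not_countable {α : ℝ} {b : ℕ} (hα : 3 < α)
    (hroot : α ^ 2 - b * α - 1 = 0) : ¬ (eventuallyBalancedSet α (-α⁻¹)).Countable := by
  intro hc
  have hinj : Function.Injective fun A : ℕ → Bool =>
      realize α (-α⁻¹) (rightWord (codeInf (sparseWord A))) := fun A A' h =>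
    sparseWord_injective (codeInf_injective
      (realize_injOn hα (codeInf_abs_le _) (codeInf_abs_le _) h))
  have hzero : (0 : ℝ) ∈ lattice α (-α⁻¹) := (lattice_iff hroot 0).2 ⟨0, 0, by simp⟩
  have hmem : ∀ A : ℕ → Bool, realize α (-α⁻¹) (rightWord (codeInf (sparseWord A))) ∈
      eventuallyBalancedSet α (-α⁻¹) := fun A =>
    ⟨sparseWord A, sparseWord_isEventuallyBalanced A, sparseWord_not_eventuallyPeriodic A, 0, 0,
      hzero, Or.inl (by simp)⟩
  have : Countable (eventuallyBalancedSet α (-α⁻¹)) := hc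
  have : Countable (ℕ → Bool) := Function.Injective.countable
    (f := fun A => (⟨_, hmem A⟩ : eventuallyBalancedSet α (-α⁻¹)))
    fun A A' h => hinj (congrArg Subtype.val h)
  -- Cantor's diagonal argument.
  obtain ⟨f, hf⟩ := exists_surjective_nat (ℕ → Bool)
  obtain ⟨n, hn⟩ := hf fun n => !f n n
  have := congrFun hn n
  simp at this

/-! ### The spectrum below the accumulation point -/

/-- The witnesses are the word 0 and the words 0ⁿ1 of slope 1/(n+1). -/
theorem exists_christoffel_code_length (n : ℕ) :
    ∃ ν, IsChristoffel ν ∧ (code ν).length = 2 * (n + 1) := by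
  rcases n with _ | n
  · refine ⟨[0], ⟨0, 1, by simp, by simp, Or.inl ⟨rfl, fun i hi => ?_⟩⟩, rfl⟩
    obtain rfl : i = 0 := by simpa using hi
    simp
  · refine ⟨List.replicate n 0 ++ [1], ⟨1, n + 1, by simp, by simp, Or.inl ⟨by simp, fun i hi => ?_⟩⟩,
      ?_⟩
    · have hi' : i ≤ n := by simp at hi; omega
      have hn : (0 : ℚ) < n + 1 := by positivity
      have h0 : ⌊((1 : ℕ) : ℚ) * i / ((n + 1 : ℕ) : ℚ)⌋ = 0 := by
        rw [Int.floor_eq_zero_iff]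
        push_cast
        rw [one_mul]
        have : (i : ℚ) ≤ n := by exact_mod_cast hi'
        exact ⟨by positivity, by rw [div_lt_one hn]; linarith⟩
      rw [h0, sub_zero]
      rcases hi'.lt_or_eq with h | h
      · rw [List.getElem_append_left (by simpa using h), List.getElem_replicate]
        symm
        simp only [Fin.val_zero, Nat.cast_zero]
        rw [Int.floor_eq_zero_iff]
        push_cast
        rw [one_mul]
        have : (i : ℚ) + 1 ≤ n := by exact_mod_cast h
        exact ⟨by positivity, by rw [div_lt_one hn]; linarith⟩
      · subst h
        rw [List.getElem_append_right (by simp)]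
        push_cast
        rw [one_mul, div_self hn.ne']
        simp
    · rw [code_length]
      simp [List.count_append, List.count_replicate]

/-- A limsup below the top forces an eventually periodic code, hence membership in some Christoffel
set. Strict monotonicity of the values identifies its index. -/
theorem levelSet_eq_christoffelSet {α : ℝ} {b : ℕ} (hα : 3 < α)
    (hroot : α ^ 2 - b * α - 1 = 0) (n : ℕ) :
    levelSet α (maxValue α (n + 1) / (α + α⁻¹)) = christoffelSet α (-α⁻¹) n := by
  refine (christoffelSet_subset hα hroot n).antisymm' fun ξ hξ => ?_
  change limsupDist α ξ = _ at hξ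
  have hα' := alpha_ge hα hroot
  have hpos : 0 < α + α⁻¹ := by positivity
  have hlt : limsupDist α ξ < b / (1 + α ^ 2) := by
    rw [hξ, top_eq hα hroot]
    have := maxValue_lt hα' n.succ_pos
    gcongr
  obtain ⟨s, B, x, hs, hx, rfl, hlim⟩ := exists_balanced_coding hα hroot hlt.le
  have hper : IsEventuallyPeriodic s := by
    by_contra hper
    exact hlt.ne (limsupDist_eq_top hα hroot hs hx hlim hper)
  obtain ⟨n', hn'⟩ := mem_christoffelSet_of_eventuallyPeriodic hα hroot hs hx hlim hper
  have h1 : limsupDist α _ = _ := christoffelSet_subset hα hroot n' hn'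
  rw [hξ, div_left_inj' hpos.ne'] at h1
  rwa [(maxValue_strictMono hα').injective h1]

theorem christoffelSet_nonempty {α : ℝ} {b : ℕ} (hroot : α ^ 2 - b * α - 1 = 0) (n : ℕ) :
    (christoffelSet α (-α⁻¹) n).Nonempty := by
  obtain ⟨ν, hν, hn⟩ := exists_christoffel_code_length n
  exact ⟨_, mem_christoffelSet_iff.2 ⟨ν, hν, hn, 0, 1, Or.inl rfl, 0,
    (lattice_iff hroot 0).2 ⟨0, 0, by simp⟩, rfl⟩⟩

theorem spectrum_inter {α : ℝ} {b : ℕ} (hα : 3 < α) (hroot : α ^ 2 - b * α - 1 = 0) :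
    spectrumL α ∩ Set.Icc 0 (b / (1 + α ^ 2)) =
      Set.range (fun n : ℕ => maxValue α (n + 1) / (α + α⁻¹)) ∪ {(b : ℝ) / (1 + α ^ 2)} := by
  have hα' := alpha_ge hα hroot
  have hpos : 0 < α + α⁻¹ := by positivity
  obtain ⟨h0, h1⟩ := inv_sq_bounds hα'
  ext η
  constructor
  · rintro ⟨⟨ξ, rfl⟩, -, hle⟩
    obtain ⟨s, B, x, hs, hx, rfl, hlim⟩ := exists_balanced_coding hα hroot hle
    by_cases hper : IsEventuallyPeriodic s
    · obtain ⟨n, hn⟩ := mem_christoffelSet_of_eventuallyPeriodic hα hroot hs hx hlim hper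
      exact Or.inl ⟨n, (christoffelSet_subset hα hroot n hn).symm⟩
    · exact Or.inr (limsupDist_eq_top hα hroot hs hx hlim hper)
  · rintro (⟨n, rfl⟩ | rfl)
    · obtain ⟨ξ, hξ⟩ := christoffelSet_nonempty hroot n
      refine ⟨⟨ξ, christoffelSet_subset hα hroot n hξ⟩, ?_, ?_⟩
      · have hm : maxValue α (0 + 1) ≤ maxValue α (n + 1) :=
          (maxValue_strictMono hα').monotone (Nat.zero_le n)
        have h2 : maxValue α (0 + 1) = 0 := by simp [maxValue]
        rw [h2] at hm
        exact div_nonneg hm hpos.le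
      · rw [top_eq hα hroot]
        exact div_le_div_of_nonneg_right (maxValue_lt hα' n.succ_pos).le hpos.le
    · refine ⟨?_, by positivity, le_rfl⟩
      -- The top value is attained because its level set contains an uncountable set and so is
      -- nonempty.
      by_contra hcon
      refine eventuallyBalancedSet_not_countable hα hroot (Set.Countable.mono
        ((eventuallyBalancedSet_subset α).trans (levelSet_top_eq hα hroot).symm.subset) ?_)
      have : levelSet α (b / (1 + α ^ 2)) = ∅ :=
        Set.eq_empty_of_forall_notMem fun ξ hξ => hcon ⟨ξ, hξ⟩
      rw [this]
      exact Set.countable_empty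

end MarkoffPisot

/-! ### The theorem -/

theorem mainTheorem2 (b : ℕ) (α α₂ : ℝ) (hα : 3 < α)
    (hroot : α ^ 2 - b * α - 1 = 0) (hroot₂ : α₂ ^ 2 - b * α₂ - 1 = 0) (hneg : α₂ < 0) :
    StrictMono (fun n : ℕ => (MarkoffPisot.pSeq b n : ℝ) / (MarkoffPisot.qSeq b n : ℝ)) ∧
    Filter.Tendsto (fun n : ℕ => (MarkoffPisot.pSeq b n : ℝ) / (MarkoffPisot.qSeq b n : ℝ))
      Filter.atTop (nhds (b / (1 + α ^ 2))) ∧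
    MarkoffPisot.spectrumL α ∩ Set.Icc 0 (b / (1 + α ^ 2)) =
      Set.range (fun n : ℕ => (MarkoffPisot.pSeq b n : ℝ) / (MarkoffPisot.qSeq b n : ℝ)) ∪
        {(b : ℝ) / (1 + α ^ 2)} ∧
    (∀ n : ℕ,
      MarkoffPisot.levelSet α ((MarkoffPisot.pSeq b n : ℝ) / (MarkoffPisot.qSeq b n : ℝ)) ⊆
          (IntermediateField.adjoin ℚ ({α} : Set ℝ) : Set ℝ) ∧
      MarkoffPisot.levelSet α ((MarkoffPisot.pSeq b n : ℝ) / (MarkoffPisot.qSeq b n : ℝ)) =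
          MarkoffPisot.christoffelSet α α₂ n) ∧
    ¬ (MarkoffPisot.levelSet α (b / (1 + α ^ 2))).Countable ∧
    MarkoffPisot.levelSet α (b / (1 + α ^ 2)) = MarkoffPisot.eventuallyBalancedCodeSet α α₂ ∧
    MarkoffPisot.eventuallyBalancedSet α α₂ ⊆ MarkoffPisot.levelSet α (b / (1 + α ^ 2)) := by
  obtain rfl : α₂ = -α⁻¹ := by
    -- Eliminating b from the two equations leaves α₂ = α, excluded by the sign, or α α₂ = -1.
    have h1 : (α - α₂) * (α * α₂ + 1) = 0 := by
      linear_combination α₂ * hroot - α * hroot₂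
    rcases mul_eq_zero.1 h1 with h | h
    · linarith
    · field_simp
      linarith
  have hα' := MarkoffPisot.alpha_ge hα hroot
  have hpos : 0 < α + α⁻¹ := by positivity
  simp only [MarkoffPisot.seq_eq_maxValue hα hroot]
  have hmono := MarkoffPisot.maxValue_strictMono hα'
  have hsub := (MarkoffPisot.eventuallyBalancedSet_subset α).trans
    (MarkoffPisot.levelSet_top_eq hα hroot).symm.subset
  refine ⟨fun m n h => ?_, ?_, MarkoffPisot.spectrum_inter hα hroot, fun n => ⟨?_, ?_⟩,
    fun hc => MarkoffPisot.eventuallyBalancedSet_not_countable hα hroot (hc.mono hsub),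
    MarkoffPisot.levelSet_top_eq hα hroot, hsub⟩
  · have := hmono h
    exact div_lt_div_of_pos_right this hpos
  · rw [MarkoffPisot.top_eq hα hroot]
    exact (MarkoffPisot.maxValue_tendsto hα').div_const _
  · rw [MarkoffPisot.levelSet_eq_christoffelSet hα hroot n]
    exact MarkoffPisot.christoffelSet_subset_adjoin hα hroot n
  · exact MarkoffPisot.levelSet_eq_christoffelSet hα hroot n
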